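/- Fix a level $\alpha\in(0,1)$ and a noise level $\sigma>0$. Let $\Phi$ be the distribution function of $N(0,1)$, $z_\alpha$ its upper $\alpha$ quantile, and $q_{\alpha,k,m}$ the upper $\alpha$ quantile of the $F$-distribution with $(k,m)$ degrees of freedom. For each sample size $n$ let $p=p_n$, $r=r_n$, $k=k_n$ be positive integers, $\boldsymbol\beta=\boldsymbol\beta_n\in\mathbb R^{p}$, and $\boldsymbol\Sigma=\boldsymbol\Sigma_n\in\mathbb R^{p\times p}$ a symmetric positive semidefinite matrix. One observes $\boldsymbol X\in\mathbb R^{n\times p}$ with i.i.d. rows $N(\boldsymbol 0,\boldsymbol\Sigma)$ and $\boldsymbol y=\boldsymbol X\boldsymbol\beta+\sigma\boldsymbol z$, where $\boldsymbol z\sim N(\boldsymbol 0,\mathbf I_n)$ is independent of $\boldsymbol X$. For a sketching matrix $S\in\mathbb R^{p\times k}$ put $$\hat{\boldsymbol\beta}^S=(S^\top \boldsymbol X^\top \boldsymbol XS)^{-1}S^\top \boldsymbol X^\top \boldsymbol y,\qquad F(S)=\frac{\boldsymbol y^\top \boldsymbol XS\hat{\boldsymbol\beta}^S/k}{\|\boldsymbol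 y-\boldsymbol XS\hat{\boldsymbol\beta}^S\|_2^2/(n-k)},$$ and let $\Psi_n^S(S)=\mathbb P_{\boldsymbol X,\boldsymbol z}\bigl(F(S)>q_{\alpha,k,n-k}\bigr)$ be the power of the sketched $F$-test given $S$. The sequence $(\boldsymbol\beta,\boldsymbol\Sigma)$ is said to belong to $\mathcal D(r)$ if there are reals $\eta=\eta_n\to0$ such that, for all large $n$, $1\le r\le p$ and there is a spectral decomposition $\boldsymbol\Sigma=\boldsymbol U\,\mathrm{diag}(\lambda_1,\dots,\lambda_p)\,\boldsymbol U^\top$ with $\boldsymbol U$ orthogonal and $\lambda_1\ge\dots\ge\lambda_p$ for which, with $\widetilde{\boldsymbol\beta}=\boldsymbol U^\top\boldsymbol\beta$, $$\Bigl(\frac1r\sum_{i=1}^r\widetilde\beta_i^2\Bigr)\Bigl(\sum_{i=r+1}^p\lambda_i\Bigr)+\sum_{i=r+1}^p\widetilde\beta_i^2\lambda_i\le\eta\,\boldsymbol\beta^\top\boldsymbol\Sigma\boldsymbol\beta,\qquad \Bigl(\frac1r\sum_{i=1}^r\widetilde\beta_i^2+\frac1{p-r}\sum_{i=r+1}^p\widetilde\beta_i^2\Bigr)r\lambda_{r+1}\le\eta\,\boldsymbol\beta^\top\boldsymbol\Sigma\boldsymbol\beta$$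 (for $r=p$ the left side of the second inequality is read as $0$). **Theorem.** Suppose $(\boldsymbol\beta,\boldsymbol\Sigma)\in\mathcal D(r)$; for constants $1<a\le b$, suppose that $ar\le k\le br$ for all large $n$; suppose $k<n$ and $k<\operatorname{rank}(\boldsymbol\Sigma)$ for all large $n$, and $\boldsymbol\beta^\top\boldsymbol\Sigma\boldsymbol\beta=o(k/n)$ as $n\to\infty$. Let $S_k=S_{k_n}\in\mathbb R^{p\times k}$, $n\ge1$, be random matrices on a common probability space, each with i.i.d. $N(0,1)$ entries (with any dependence between different $n$) and independent of the data. Then for almost all sequences of sketching matrices the test is well defined for all large $n$ (that is, almost surely over $(\boldsymbol X,\boldsymbol z)$, $S_k^\top \boldsymbol X^\top \boldsymbol XS_k$ is invertible and the denominator of $F(S_k)$ is nonzero), and $$\Psi_n^S(S_k)-\Phi\left(-z_\alpha+\frac{\sqrt n\,\boldsymbol\beta^\top\boldsymbol\Sigma\boldsymbol\beta}{\sigma^2}\sqrt{\frac{1-k/n}{2k/n}}\right)\longrightarrow0$$ in probability with respect to the law of the sketching matrices. -/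

import Mathlib

open MeasureTheory ProbabilityTheory Filter Topology Asymptotics Matrix

noncomputable section

namespace SketchedFTest

/-- The standard normal distribution function `Φ`. -/
def stdNormalCDF (x : ℝ) : ℝ := cdf (gaussianReal 0 1) x

/-- The upper `α` quantile of a probability measure on `ℝ`. -/
def upperQuantile (μ : Measure ℝ) (α : ℝ) : ℝ := sInf {x : ℝ | μ.real (Set.Ioi x) ≤ α}

/-- The law of a vector of `d` independent standard normal variables. -/
def stdNormalVector (d : ℕ) : Measure (Fin d → ℝ) := Measure.pi fun _ => gaussianReal 0 1

/-- The (central) `F`-distribution with `(d₁, d₂)` degrees of freedom: the law of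
`(χ²_{d₁} / d₁) / (χ²_{d₂} / d₂)` with independent chi-square variables, each of which is a sum of
squares of independent standard normal variables. -/
def fDist (d₁ d₂ : ℕ) : Measure ℝ :=
  ((stdNormalVector d₁).prod (stdNormalVector d₂)).map fun w =>
    ((∑ i, w.1 i ^ 2) / (d₁ : ℝ)) / ((∑ j, w.2 j ^ 2) / (d₂ : ℝ))

/-- The signal strength `βᵀ Σ β`. -/
def signal {p : ℕ} (β : Fin p → ℝ) (Sig : Matrix (Fin p) (Fin p) ℝ) : ℝ := β ⬝ᵥ (Sig *ᵥ β)

/-- The sketched least squares estimate `((XS)ᵀ XS)⁻¹ (XS)ᵀ y`. -/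
def sketchedEstimate {n p k : ℕ} (X : Matrix (Fin n) (Fin p) ℝ) (y : Fin n → ℝ)
    (S : Matrix (Fin p) (Fin k) ℝ) : Fin k → ℝ :=
  ((X * S)ᵀ * (X * S))⁻¹ *ᵥ ((X * S)ᵀ *ᵥ y)

/-- The residual vector `y - XS β̂`, where `β̂` is the sketched least squares estimate. -/
def sketchedResidual {n p k : ℕ} (X : Matrix (Fin n) (Fin p) ℝ) (y : Fin n → ℝ)
    (S : Matrix (Fin p) (Fin k) ℝ) : Fin n → ℝ :=
  y - (X * S) *ᵥ sketchedEstimate X y S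

/-- The sketched `F`-test statistic
`(yᵀ XS β̂ / k) / (‖y - XS β̂‖² / (n - k))`. -/
def sketchedF {n p k : ℕ} (X : Matrix (Fin n) (Fin p) ℝ) (y : Fin n → ℝ)
    (S : Matrix (Fin p) (Fin k) ℝ) : ℝ :=
  (y ⬝ᵥ ((X * S) *ᵥ sketchedEstimate X y S) / (k : ℝ)) /
    (sketchedResidual X y S ⬝ᵥ sketchedResidual X y S / ((n : ℝ) - (k : ℝ)))

/-- No degenerate operation occurs in the sketched `F`-test statistic: the inverted matrix is
nonsingular and the denominator does not vanish. -/
def SketchedFDefined {n p k : ℕ} (X : Matrix (Fin n) (Fin p) ℝ) (y : Fin n → ℝ)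
    (S : Matrix (Fin p) (Fin k) ℝ) : Prop :=
  IsUnit ((X * S)ᵀ * (X * S)).det ∧ sketchedResidual X y S ≠ 0

/-- The joint law of the rows of the design and of the noise: `n` independent `N(0, Σ)` rows, and
an independent vector of `n` independent standard normal variables. -/
def dataLaw (n : ℕ) {p : ℕ} (Sig : Matrix (Fin p) (Fin p) ℝ) :
    Measure ((Fin n → EuclideanSpace ℝ (Fin p)) × (Fin n → ℝ)) :=
  (Measure.pi fun _ => multivariateGaussian 0 Sig).prod (stdNormalVector n)

/-- The design matrix whose rows are given. -/
def designMatrix {n p : ℕ} (x : Fin n → EuclideanSpace ℝ (Fin p)) : Matrix (Fin n) (Fin p) ℝ :=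
  Matrix.of fun i j => x i j

/-- The response `y = X β + σ z`. -/
def response {n p : ℕ} (β : Fin p → ℝ) (σ : ℝ)
    (d : (Fin n → EuclideanSpace ℝ (Fin p)) × (Fin n → ℝ)) : Fin n → ℝ :=
  designMatrix d.1 *ᵥ β + σ • d.2

/-- The power of the level `α` sketched `F`-test given the sketching matrix `S`: the probability,
over the design and the noise, that the statistic exceeds the upper `α` quantile of the
`F`-distribution with `(k, n - k)` degrees of freedom. -/
def sketchedPower (n : ℕ) {p k : ℕ} (α σ : ℝ) (β : Fin p → ℝ) (Sig : Matrix (Fin p) (Fin p) ℝ)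
    (S : Matrix (Fin p) (Fin k) ℝ) : ℝ :=
  (dataLaw n Sig).real
    {d | upperQuantile (fDist k (n - k)) α < sketchedF (designMatrix d.1) (response β σ d) S}

/-- The law of a `p × k` Gaussian sketching matrix: independent `N(0, 1)` entries. -/
def sketchLaw (p k : ℕ) : Measure (Fin p → Fin k → ℝ) :=
  Measure.pi fun _ => Measure.pi fun _ => gaussianReal 0 1

/-- `Σ = U diag(l) Uᵀ` with `U` orthogonal and `l` in descending order. -/
def IsSpectralDecomposition {p : ℕ} (Sig U : Matrix (Fin p) (Fin p) ℝ) (l : Fin p → ℝ) : Prop :=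
  U ∈ Matrix.orthogonalGroup (Fin p) ℝ ∧ Antitone l ∧ Sig = U * Matrix.diagonal l * Uᵀ

/-- The two inequalities that define intrinsic dimension up to `r` with accuracy `η`. In the
`0`-based indexing of `Fin p`, the indices `1, …, r` are those with value `< r`, and `λ_{r+1}` is
`l ⟨r, _⟩` (read as `0` when `r = p`). -/
def IntrinsicDimBounds {p : ℕ} (r : ℕ) (η : ℝ) (β : Fin p → ℝ)
    (Sig : Matrix (Fin p) (Fin p) ℝ) : Prop :=
  1 ≤ r ∧ r ≤ p ∧ ∃ (U : Matrix (Fin p) (Fin p) ℝ) (l : Fin p → ℝ),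
    IsSpectralDecomposition Sig U l ∧
    let b : Fin p → ℝ := Uᵀ *ᵥ β
    let head : ℝ := ∑ i with i.val < r, b i ^ 2
    let tail : ℝ := ∑ i with r ≤ i.val, b i ^ 2
    let next : ℝ := if h : r < p then l ⟨r, h⟩ else 0
    (1 / (r : ℝ) * head) * (∑ i with r ≤ i.val, l i) + ∑ i with r ≤ i.val, b i ^ 2 * l i
        ≤ η * signal β Sig ∧
    (1 / (r : ℝ) * head + 1 / ((p : ℝ) - (r : ℝ)) * tail) * ((r : ℝ) * next)
        ≤ η * signal β Sig

/-- The sequence of models `(β n, Σ n)` belongs to the class `D(r)`: it has intrinsic dimension up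
to `r n`, with an accuracy `η n` that tends to `0`. -/
def InClassD {p : ℕ → ℕ} (r : ℕ → ℕ) (β : (n : ℕ) → Fin (p n) → ℝ)
    (Sig : (n : ℕ) → Matrix (Fin (p n)) (Fin (p n)) ℝ) : Prop :=
  ∃ η : ℕ → ℝ, Tendsto η atTop (𝓝 0) ∧ ∀ᶠ n in atTop, IntrinsicDimBounds (r n) (η n) (β n) (Sig n)

end SketchedFTest

end

noncomputable section

namespace SketchedFTest

open scoped ENNReal NNReal

/-- The law of a family of independent standard normal variables. -/
abbrev gaussPi (ι : Type*) [Fintype ι] : Measure (ι → ℝ) := Measure.pi fun _ => gaussianReal 0 1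

/-- The chi-square distribution with `d` degrees of freedom. -/
def chiSq (d : ℕ) : Measure ℝ := (stdNormalVector d).map fun w => ∑ i, w i ^ 2

instance (d : ℕ) : IsProbabilityMeasure (stdNormalVector d) := by
  unfold stdNormalVector; infer_instance

instance (d : ℕ) : IsProbabilityMeasure (chiSq d) :=
  Measure.isProbabilityMeasure_map (Measurable.aemeasurable (by fun_prop))

lemma gaussPi_map_sum_sq {ι : Type*} [Fintype ι] {d : ℕ} (h : Fintype.card ι = d) :
    (gaussPi ι).map (fun w => ∑ i, w i ^ 2) = chiSq d := by
  have e : Fin d ≃ ι := (Fintype.equivFinOfCardEq h).symm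
  have := (measurePreserving_piCongrLeft (fun _ : ι => gaussianReal 0 1) e)
  rw [gaussPi, ← this.map_eq, Measure.map_map (by fun_prop) this.measurable, chiSq, stdNormalVector]
  congr 1
  ext w
  simp only [Function.comp_apply]
  rw [← e.sum_comp]
  simp [MeasurableEquiv.piCongrLeft]

lemma gaussianReal_le_volume : gaussianReal 0 1 ≤ (volume : Measure ℝ) := by
  refine Measure.le_iff.2 fun s _ => ?_
  rw [gaussianReal_apply _ one_ne_zero]
  calc ∫⁻ x in s, gaussianPDF 0 1 x ≤ ∫⁻ x in s, 1 := by
        refine lintegral_mono fun x => ?_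
        rw [gaussianPDF_def]
        simp only [gaussianPDFReal]
        rw [ENNReal.ofReal_le_one]
        have h1 : Real.exp (-(x - 0) ^ 2 / (2 * ((1 : ℝ≥0) : ℝ))) ≤ 1 := by
          rw [Real.exp_le_one_iff]
          exact div_nonpos_of_nonpos_of_nonneg (by nlinarith [sq_nonneg (x - 0)]) (by simp)
        have h2 : (Real.sqrt (2 * Real.pi * ((1 : ℝ≥0) : ℝ)))⁻¹ ≤ 1 := by
          apply inv_le_one_of_one_le₀
          rw [Real.one_le_sqrt]
          have := Real.pi_gt_three
          simp; linarith
        calc _ ≤ (1 : ℝ) * 1 := by gcongr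
          _ = 1 := by ring
    _ = volume s := by simp

lemma pi_mono {ι : Type*} [Fintype ι] {α : ι → Type*} [∀ i, MeasurableSpace (α i)]
    {μ ν : ∀ i, Measure (α i)} [∀ i, SigmaFinite (μ i)] (h : ∀ i, μ i ≤ ν i) :
    Measure.pi μ ≤ Measure.pi ν := by
  refine Measure.le_iff.2 fun s hs => ?_
  have : (Measure.pi μ).toOuterMeasure ≤ OuterMeasure.pi fun i => (ν i).toOuterMeasure := by
    rw [OuterMeasure.le_pi]
    intro t _
    change Measure.pi μ _ ≤ _
    rw [Measure.pi_pi]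
    exact Finset.prod_le_prod' fun i _ => h i _
  refine (this s).trans ?_
  rw [Measure.pi]
  exact le_toMeasure_apply _ _ _

lemma gaussPi_le_volume (ι : Type*) [Fintype ι] : gaussPi ι ≤ volume :=
  pi_mono fun _ => gaussianReal_le_volume

lemma gaussianReal_sq_mem_Icc (c l : ℝ) :
    gaussianReal 0 1 {x | x ^ 2 ∈ Set.Icc c (c + l)} ≤ ENNReal.ofReal (2 * √l) := by
  rcases lt_or_ge l 0 with hl | hl
  · have : {x : ℝ | x ^ 2 ∈ Set.Icc c (c + l)} = ∅ := by
      ext x; simp; intro; linarith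
    rw [this]; simp
  have hsub : {x : ℝ | x ^ 2 ∈ Set.Icc c (c + l)} ⊆
      Set.Icc (√c) (√c + √l) ∪ Set.Icc (-(√c + √l)) (-√c) := by
    intro x hx
    have h1 : √c ≤ |x| := by rw [← Real.sqrt_sq_eq_abs]; exact Real.sqrt_le_sqrt hx.1
    have h2 : |x| ≤ √c + √l := by
      rw [← Real.sqrt_sq_eq_abs]
      refine (Real.sqrt_le_sqrt hx.2).trans ?_
      rw [Real.sqrt_le_left (by positivity)]
      rcases le_total 0 c with hc | hc
      · nlinarith [Real.sq_sqrt hc, Real.sq_sqrt hl, Real.sqrt_nonneg c, Real.sqrt_nonneg l]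
      · rw [Real.sqrt_eq_zero_of_nonpos hc, zero_add, Real.sq_sqrt hl]; linarith
    rcases abs_cases x with ⟨h, _⟩ | ⟨h, _⟩
    · left; rw [h] at h1 h2; exact ⟨h1, h2⟩
    · right; rw [h] at h1 h2; constructor <;> linarith
  calc gaussianReal 0 1 {x | x ^ 2 ∈ Set.Icc c (c + l)} ≤ volume {x : ℝ | x ^ 2 ∈ Set.Icc c (c + l)} :=
        gaussianReal_le_volume _
    _ ≤ _ := measure_mono hsub
    _ ≤ _ := measure_union_le _ _
    _ = ENNReal.ofReal (2 * √l) := by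
        rw [Real.volume_Icc, Real.volume_Icc, ← ENNReal.ofReal_add] <;> ring_nf <;> positivity

/-- Integrating out one coordinate of a product measure. -/
lemma lintegral_pi_update {ι : Type*} [Fintype ι] [DecidableEq ι] {α : ι → Type*}
    [∀ i, MeasurableSpace (α i)] (μ : ∀ i, Measure (α i)) [∀ i, IsProbabilityMeasure (μ i)]
    (i : ι) {f : (∀ i, α i) → ℝ≥0∞} (hf : Measurable f) :
    ∫⁻ x, f x ∂Measure.pi μ = ∫⁻ x, ∫⁻ y, f (Function.update x i y) ∂μ i ∂Measure.pi μ := by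
  refine lintegral_eq_of_lmarginal_eq {i} hf ?_ ?_
  · have : Measurable fun p : (∀ i, α i) × α i => f (Function.update p.1 i p.2) := by
      refine hf.comp ?_
      exact measurable_update' 
    exact this.lintegral_prod_right'
  · rw [lmarginal_singleton, lmarginal_singleton]
    ext x
    simp

lemma measure_pi_update_le {ι : Type*} [Fintype ι] [DecidableEq ι] {α : ι → Type*}
    [∀ i, MeasurableSpace (α i)] (μ : ∀ i, Measure (α i)) [∀ i, IsProbabilityMeasure (μ i)]
    (i : ι) {s : Set (∀ i, α i)} (hs : MeasurableSet s) {c : ℝ≥0∞}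
    (h : ∀ᵐ x ∂Measure.pi μ, μ i {y | Function.update x i y ∈ s} ≤ c) : Measure.pi μ s ≤ c := by
  rw [← lintegral_indicator_one hs, lintegral_pi_update μ i (measurable_one.indicator hs)]
  have : ∀ x, ∫⁻ y, s.indicator 1 (Function.update x i y) ∂μ i =
      μ i {y | Function.update x i y ∈ s} := by
    intro x
    rw [← lintegral_indicator_one (μ := μ i) (s := {y | Function.update x i y ∈ s})
      (measurable_update x hs)]
    rfl
  simp_rw [this]
  calc _ ≤ ∫⁻ _, c ∂Measure.pi μ := lintegral_mono_ae h
    _ = c := by simp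

lemma chiSq_Icc_le {d : ℕ} (hd : 1 ≤ d) (c l : ℝ) :
    chiSq d (Set.Icc c (c + l)) ≤ ENNReal.ofReal (2 * √l) := by
  rw [chiSq, Measure.map_apply (by fun_prop) measurableSet_Icc]
  refine measure_pi_update_le _ (⟨0, hd⟩ : Fin d) (measurableSet_Icc.preimage (by fun_prop)) ?_
  refine ae_of_all _ fun x => ?_
  refine (measure_mono ?_).trans
    (gaussianReal_sq_mem_Icc (c - ∑ i ∈ Finset.univ.erase (⟨0, hd⟩ : Fin d), x i ^ 2) l)
  intro y hy
  have : ∑ i, (Function.update x ⟨0, hd⟩ y) i ^ 2 =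
      y ^ 2 + ∑ i ∈ Finset.univ.erase (⟨0, hd⟩ : Fin d), x i ^ 2 := by
    rw [← Finset.add_sum_erase Finset.univ (fun i => (Function.update x ⟨0, hd⟩ y) i ^ 2)
      (Finset.mem_univ (⟨0, hd⟩ : Fin d))]
    simp only [Function.update_self, add_right_inj]
    · refine Finset.sum_congr rfl fun i hi => ?_
      rw [Function.update_of_ne (Finset.ne_of_mem_erase hi)]
  simp only [Set.mem_ofPred_eq, Set.mem_preimage, Set.mem_Icc, this] at hy ⊢
  constructor <;> linarith [hy.1, hy.2]

lemma chiSq_singleton {d : ℕ} (hd : 1 ≤ d) (c : ℝ) : chiSq d {c} = 0 := by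
  have := chiSq_Icc_le hd c 0
  simpa using this

lemma chiSq_ae_pos {d : ℕ} (hd : 1 ≤ d) : ∀ᵐ x ∂chiSq d, 0 < x := by
  have h1 : ∀ᵐ x ∂chiSq d, x ≠ 0 := by
    rw [ae_iff]; simpa using chiSq_singleton hd 0
  have h2 : ∀ᵐ x ∂chiSq d, 0 ≤ x := by
    rw [chiSq, ae_map_iff (Measurable.aemeasurable (by fun_prop)) measurableSet_Ici]
    exact ae_of_all _ fun w => Finset.sum_nonneg fun i _ => sq_nonneg _
  filter_upwards [h1, h2] with x a b using lt_of_le_of_ne b a.symm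

lemma chiSq_lower_tail {d : ℕ} (hd : 1 ≤ d) {κ : ℝ} (hκ : 0 < κ) :
    chiSq d (Set.Iio (κ * d / 2)) ≤ ENNReal.ofReal (4 * √κ) := by
  rw [chiSq, Measure.map_apply (by fun_prop) measurableSet_Iio]
  set f : (Fin d → ℝ) → ℝ≥0∞ := fun w => ∑ i, {x : ℝ | x ^ 2 ∈ Set.Icc 0 κ}.indicator 1 (w i)
    with hf
  have hm : MeasurableSet {x : ℝ | x ^ 2 ∈ Set.Icc 0 κ} :=
    measurableSet_Icc.preimage (by fun_prop)
  have hfm : Measurable f := by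
    refine Finset.measurable_sum _ fun i _ => ?_
    exact (measurable_one.indicator hm).comp (measurable_pi_apply i)
  have hint : ∫⁻ w, f w ∂stdNormalVector d ≤ d * ENNReal.ofReal (2 * √κ) := by
    rw [hf, lintegral_finsetSum]
    · calc _ ≤ ∑ i : Fin d, ENNReal.ofReal (2 * √κ) := by
            refine Finset.sum_le_sum fun i _ => ?_
            rw [stdNormalVector, (measurePreserving_eval (fun _ : Fin d => gaussianReal 0 1)
              i).lintegral_comp (f := {x : ℝ | x ^ 2 ∈ Set.Icc 0 κ}.indicator 1)
              (measurable_one.indicator hm), lintegral_indicator_one hm]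
            simpa using gaussianReal_sq_mem_Icc 0 κ
        _ = _ := by simp
    · exact fun i _ => (measurable_one.indicator hm).comp (measurable_pi_apply i)
  have hsub : (fun w : Fin d → ℝ => ∑ i, w i ^ 2) ⁻¹' Set.Iio (κ * d / 2) ⊆
      {w | ((d / 2 : ℝ≥0) : ℝ≥0∞) ≤ f w} := by
    intro w hw
    simp only [Set.mem_preimage, Set.mem_Iio] at hw
    have hfw : f w = (((Finset.univ.filter fun i => w i ^ 2 ≤ κ).card : ℝ≥0) : ℝ≥0∞) := by
      simp only [hf, Set.indicator_apply, Set.mem_ofPred_eq, Set.mem_Icc, sq_nonneg, true_and,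
        Pi.one_apply, Finset.sum_boole]
      simp
    simp only [Set.mem_ofPred_eq, hfw]
    rw [ENNReal.coe_le_coe, ← NNReal.coe_le_coe]
    push_cast
    have hcard : ((Finset.univ.filter fun i => w i ^ 2 ≤ κ).card : ℝ) +
        ((Finset.univ.filter fun i => ¬ w i ^ 2 ≤ κ).card : ℝ) = d := by
      rw [← Nat.cast_add, Finset.card_filter_add_card_filter_not]; simp
    have h2 : κ * ((Finset.univ.filter fun i => ¬ w i ^ 2 ≤ κ).card : ℝ) ≤ ∑ i, w i ^ 2 := by
      calc _ = ∑ i ∈ Finset.univ.filter fun i => ¬ w i ^ 2 ≤ κ, κ := by simp [mul_comm]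
        _ ≤ ∑ i ∈ Finset.univ.filter fun i => ¬ w i ^ 2 ≤ κ, w i ^ 2 := by
            refine Finset.sum_le_sum fun i hi => ?_
            simp at hi; exact hi.le
        _ ≤ _ := Finset.sum_le_sum_of_subset_of_nonneg (Finset.filter_subset _ _)
            fun i _ _ => sq_nonneg _
    by_contra hlt
    push Not at hlt
    have h3 : (d : ℝ) / 2 < ((Finset.univ.filter fun i => ¬ w i ^ 2 ≤ κ).card : ℝ) := by linarith
    nlinarith
  have hd0 : ((d / 2 : ℝ≥0) : ℝ≥0∞) ≠ 0 := by
    have : (0 : ℝ≥0) < d / 2 := by positivity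
    simpa using this.ne'
  calc _ ≤ stdNormalVector d {w | ((d / 2 : ℝ≥0) : ℝ≥0∞) ≤ f w} := measure_mono hsub
    _ ≤ (∫⁻ w, f w ∂stdNormalVector d) / ((d / 2 : ℝ≥0) : ℝ≥0∞) :=
        meas_ge_le_lintegral_div hfm.aemeasurable hd0 ENNReal.coe_ne_top
    _ ≤ (d * ENNReal.ofReal (2 * √κ)) / ((d / 2 : ℝ≥0) : ℝ≥0∞) := by gcongr
    _ = ENNReal.ofReal (4 * √κ) := by
        symm; rw [ENNReal.eq_div_iff hd0 ENNReal.coe_ne_top]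
        have e1 : (d : ℝ≥0∞) = ENNReal.ofReal d := by simp
        have e2 : ((d / 2 : ℝ≥0) : ℝ≥0∞) = ENNReal.ofReal ((d : ℝ) / 2) := by
          rw [ENNReal.ofReal, ENNReal.coe_inj]; ext; simp; positivity
        rw [e1, e2, ← ENNReal.ofReal_mul (by positivity), ← ENNReal.ofReal_mul (by positivity)]
        congr 1; ring


lemma integral_sq_gaussianReal : ∫ x, x ^ 2 ∂gaussianReal 0 1 = 1 := by
  have h := variance_id_gaussianReal (μ := 0) (v := 1)
  rw [variance_eq_integral (by fun_prop)] at h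
  simpa using h

lemma integral_pow_four_gaussianReal : ∫ x, x ^ 4 ∂gaussianReal 0 1 = 3 := by
  have h := iteratedDeriv_mgf_zero (X := id) (μ := gaussianReal 0 1) (by simp) 4
  have hd : ∀ (p p' : ℝ → ℝ), (∀ t, HasDerivAt p (p' t) t) →
      deriv (fun t : ℝ => p t * Real.exp (t ^ 2 / 2)) =
        fun t => (p' t + t * p t) * Real.exp (t ^ 2 / 2) := by
    intro p p' hp
    ext t
    have h2 : HasDerivAt (fun t : ℝ => Real.exp (t ^ 2 / 2)) (Real.exp (t ^ 2 / 2) * t) t := by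
      have := ((hasDerivAt_pow 2 t).div_const 2).exp
      convert this using 1
      ring
    rw [((hp t).fun_mul h2).deriv]
    ring
  have h0 : mgf id (gaussianReal 0 1) = fun t : ℝ => (1 : ℝ) * Real.exp (t ^ 2 / 2) := by
    ext t
    rw [mgf_id_gaussianReal]; simp
  have d1 (t : ℝ) : HasDerivAt (fun t : ℝ => 1 + t * t) (2 * t) t := by
    have := ((hasDerivAt_id' t).fun_mul (hasDerivAt_id' t)).const_add 1
    exact this.congr_deriv (by ring)
  have d2 (t : ℝ) : HasDerivAt (fun t : ℝ => 2 * t + t * (1 + t * t)) (3 + 3 * t ^ 2) t :=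
    (((hasDerivAt_id' t).const_mul 2).fun_add ((hasDerivAt_id' t).fun_mul (d1 t))).congr_deriv
      (by ring)
  have e : iteratedDeriv 4 (mgf id (gaussianReal 0 1)) =
      fun t => (3 + 6 * t ^ 2 + t ^ 4) * Real.exp (t ^ 2 / 2) := by
    rw [iteratedDeriv_succ, iteratedDeriv_succ, iteratedDeriv_succ, iteratedDeriv_one, h0,
      hd (fun _ => 1) (fun _ => 0) fun t => hasDerivAt_const t 1,
      show (fun t : ℝ => (0 + t * 1) * Real.exp (t ^ 2 / 2)) =
        fun t => t * Real.exp (t ^ 2 / 2) by ext; ring,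
      hd (fun t => t) (fun _ => 1) hasDerivAt_id',
      hd (fun t => 1 + t * t) (fun t => 2 * t) d1,
      hd (fun t => 2 * t + t * (1 + t * t)) (fun t => 3 + 3 * t ^ 2) d2]
    ext t; ring
  rw [e] at h
  simpa using h.symm

lemma memLp_sq_gaussianReal : MemLp (fun x : ℝ => x ^ 2) 2 (gaussianReal 0 1) := by
  rw [memLp_two_iff_integrable_sq (by fun_prop)]
  refine Integrable.of_integral_ne_zero ?_
  have : (fun x : ℝ => (x ^ 2) ^ 2) = fun x => x ^ 4 := by ext; ring
  rw [this, integral_pow_four_gaussianReal]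
  norm_num

lemma variance_sq_gaussianReal : Var[fun x : ℝ => x ^ 2; gaussianReal 0 1] = 2 := by
  rw [variance_eq_sub memLp_sq_gaussianReal, integral_sq_gaussianReal]
  have : ((fun x : ℝ => x ^ 2) ^ 2) = fun x => x ^ 4 := by ext; simp; ring
  rw [this, integral_pow_four_gaussianReal]
  norm_num

lemma memLp_sum_sq (d : ℕ) :
    MemLp (fun w : Fin d → ℝ => ∑ i, w i ^ 2) 2 (stdNormalVector d) := by
  refine memLp_finsetSum _ fun i _ => ?_
  exact memLp_sq_gaussianReal.comp_measurePreserving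
    (measurePreserving_eval (fun _ : Fin d => gaussianReal 0 1) i)

lemma integral_sum_sq (d : ℕ) : ∫ w : Fin d → ℝ, ∑ i, w i ^ 2 ∂stdNormalVector d = d := by
  rw [integral_finsetSum]
  · have : ∀ i : Fin d, ∫ w : Fin d → ℝ, w i ^ 2 ∂stdNormalVector d = 1 := by
      intro i
      rw [← integral_sq_gaussianReal]
      exact integral_comp_eval (μ := fun _ : Fin d => gaussianReal 0 1) (f := fun x : ℝ => x ^ 2)
        (by fun_prop)
    simp [this]
  · intro i _
    exact (memLp_sq_gaussianReal.comp_measurePreserving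
      (measurePreserving_eval (fun _ : Fin d => gaussianReal 0 1) i)).integrable one_le_two

lemma variance_sum_sq (d : ℕ) :
    Var[fun w : Fin d → ℝ => ∑ i, w i ^ 2; stdNormalVector d] = 2 * d := by
  have h := variance_sum_pi (μ := fun _ : Fin d => gaussianReal 0 1)
    (X := fun _ (x : ℝ) => x ^ 2) fun _ => memLp_sq_gaussianReal
  have e : (∑ i, fun w : Fin d → ℝ => w i ^ 2) = fun w => ∑ i, w i ^ 2 := by
    ext; simp
  rw [e] at h
  rw [stdNormalVector, h]
  simp [variance_sq_gaussianReal, mul_comm]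

lemma stdNormalVector_chebyshev (d : ℕ) (θ : ℝ) {t : ℝ} (ht : 0 < t) :
    stdNormalVector d {w | t ≤ |θ * ∑ i, w i ^ 2 - d * θ|} ≤
      ENNReal.ofReal (2 * d * θ ^ 2 / t ^ 2) := by
  have h := meas_ge_le_variance_div_sq ((memLp_sum_sq d).const_mul θ) ht
  rw [integral_const_mul, integral_sum_sq, variance_const_mul, variance_sum_sq] at h
  convert h using 3
  · ext; rw [mul_comm (d : ℝ)]
  · ring

lemma chiSq_chebyshev (d : ℕ) {t : ℝ} (ht : 0 < t) :
    chiSq d {x | t ≤ |x - d|} ≤ ENNReal.ofReal (2 * d / t ^ 2) := by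
  rw [chiSq, Measure.map_apply (by fun_prop) (measurableSet_le (by fun_prop) (by fun_prop))]
  simpa using stdNormalVector_chebyshev d 1 ht

lemma continuous_cdf {μ : Measure ℝ} [IsProbabilityMeasure μ] (hμ : ∀ x, μ {x} = 0) :
    Continuous (cdf μ) := by
  rw [continuous_iff_continuousAt]
  intro x
  rw [(monotone_cdf μ).continuousAt_iff_leftLim_eq_rightLim, StieltjesFunction.rightLim_eq]
  have h := (cdf μ).measure_singleton x
  rw [measure_cdf, hμ, eq_comm, ENNReal.ofReal_eq_zero] at h
  exact le_antisymm ((monotone_cdf μ).leftLim_le le_rfl) (by linarith)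

/-- An atomless law puts mass exactly `α` above its upper `α` quantile. -/
lemma measureReal_Ioi_upperQuantile {μ : Measure ℝ} [IsProbabilityMeasure μ]
    (hμ : ∀ x, μ {x} = 0) {α : ℝ} (h0 : 0 < α) (h1 : α < 1) :
    μ.real (Set.Ioi (upperQuantile μ α)) = α := by
  have hg : ∀ x, μ.real (Set.Ioi x) = 1 - cdf μ x := by
    intro x
    rw [cdf_eq_real, ← Set.compl_Iic, measureReal_compl measurableSet_Iic]
    simp
  have hcont := continuous_cdf hμ
  unfold upperQuantile
  simp_rw [hg]
  set s := {x : ℝ | 1 - cdf μ x ≤ α} with hs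
  have hsc : IsClosed s := isClosed_le (by fun_prop) continuous_const
  have hne : s.Nonempty := by
    obtain ⟨x, hx⟩ := ((tendsto_cdf_atTop μ).eventually (lt_mem_nhds (show 1 - α < 1 by linarith))).exists
    exact ⟨x, show 1 - cdf μ x ≤ α by linarith⟩
  have hbd : BddBelow s := by
    obtain ⟨x, hx⟩ := ((tendsto_cdf_atBot μ).eventually (gt_mem_nhds (show 0 < 1 - α by linarith))).exists
    refine ⟨x, fun y hy => ?_⟩
    by_contra hlt
    push Not at hlt
    have h2 := monotone_cdf μ hlt.le
    have : 1 - cdf μ y ≤ α := hy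
    linarith
  have hmem : 1 - cdf μ (sInf s) ≤ α := hsc.csInf_mem hne hbd
  refine le_antisymm hmem ?_
  have hle : ∀ x < sInf s, α ≤ 1 - cdf μ x := fun x hx => by
    by_contra hlt
    push Not at hlt
    exact (csInf_le hbd (show x ∈ s from hlt.le)).not_gt hx
  have : Tendsto (fun x => 1 - cdf μ x) (𝓝[<] (sInf s)) (𝓝 (1 - cdf μ (sInf s))) :=
    ((continuous_const.sub hcont).tendsto _).mono_left nhdsWithin_le_nhds
  exact ge_of_tendsto this (eventually_nhdsWithin_of_forall hle)

lemma fDist_eq_map (k m : ℕ) :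
    fDist k m = ((chiSq k).prod (chiSq m)).map fun w : ℝ × ℝ => (w.1 / (k : ℝ)) / (w.2 / (m : ℝ)) := by
  rw [chiSq, chiSq, Measure.map_prod_map _ _ (by fun_prop) (by fun_prop),
    Measure.map_map (by fun_prop) (by fun_prop)]
  rfl

instance (k m : ℕ) : IsProbabilityMeasure (fDist k m) := by
  rw [fDist_eq_map]
  exact Measure.isProbabilityMeasure_map (Measurable.aemeasurable (by fun_prop))

lemma fDist_singleton {k m : ℕ} (hk : 1 ≤ k) (hm : 1 ≤ m) (x : ℝ) : fDist k m {x} = 0 := by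
  rw [fDist_eq_map, Measure.map_apply (by fun_prop) (measurableSet_singleton x),
    Measure.measure_prod_null ((measurableSet_singleton x).preimage (by fun_prop))]
  filter_upwards [chiSq_ae_pos hk] with u hu
  refine measure_mono_null (t := {0} ∪ {u * m / (k * x)}) (fun v hv => ?_)
    (measure_union_null (chiSq_singleton hm _) (chiSq_singleton hm _))
  have hk0 : (k : ℝ) ≠ 0 := by positivity
  have hm0 : (m : ℝ) ≠ 0 := by positivity
  simp only [Set.mem_preimage, Set.mem_singleton_iff] at hv
  by_cases hv0 : v = 0
  · left; exact hv0
  · right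
    have hx : x ≠ 0 := by
      rw [← hv]; positivity
    rw [Set.mem_singleton_iff, eq_div_iff (by positivity), ← hv]
    field_simp

/-- The mass that a product of chi-square laws gives to the rejection region of the `F`-test. -/
lemma measureReal_fDist_quantile {k m : ℕ} (hk : 1 ≤ k) (hm : 1 ≤ m) {α : ℝ} (h0 : 0 < α)
    (h1 : α < 1) : ((chiSq k).prod (chiSq m)).real
      {w | upperQuantile (fDist k m) α < (w.1 / k) / (w.2 / m)} = α := by
  have h := measureReal_Ioi_upperQuantile (fDist_singleton hk hm) h0 h1
  generalize upperQuantile (fDist k m) α = q at h ⊢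
  rw [fDist_eq_map, map_measureReal_apply (by fun_prop) measurableSet_Ioi] at h
  exact h


/-- The characteristic function of a standardized `χ²₁` variable. -/
def chiCharFun (t : ℝ) : ℂ :=
  charFun ((gaussianReal 0 1).map fun x => (x ^ 2 - 1) / √2) t

lemma chiCharFun_eq (t : ℝ) :
    chiCharFun t = ∫ x, Complex.exp (t * ((x ^ 2 - 1) / √2 : ℝ) * Complex.I) ∂gaussianReal 0 1 := by
  rw [chiCharFun, charFun_apply_real, integral_map (by fun_prop)
    (Measurable.aestronglyMeasurable (by fun_prop))]

lemma norm_chiCharFun_le (t : ℝ) : ‖chiCharFun t‖ ≤ 1 := by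
  have : IsProbabilityMeasure ((gaussianReal 0 1).map fun x => (x ^ 2 - 1) / √2) :=
    Measure.isProbabilityMeasure_map (by fun_prop)
  exact norm_charFun_le_one t

lemma chiCharFun_sub_exp_isLittleO :
    (fun t : ℝ => chiCharFun t - Complex.exp (-t ^ 2 / 2)) =o[𝓝 0] fun t : ℝ => t ^ 2 := by
  have hX : AEMeasurable (fun x : ℝ => (x ^ 2 - 1) / √2) (gaussianReal 0 1) := by fun_prop
  have hint : Integrable (fun x : ℝ => x ^ 2) (gaussianReal 0 1) :=
    memLp_sq_gaussianReal.integrable one_le_two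
  have h0 : (gaussianReal 0 1)[fun x : ℝ => (x ^ 2 - 1) / √2] = 0 := by
    rw [integral_div, integral_sub hint (integrable_const _), integral_sq_gaussianReal]
    simp
  have h1 : (gaussianReal 0 1)[(fun x : ℝ => (x ^ 2 - 1) / √2) ^ 2] = 1 := by
    have e : (fun x : ℝ => (x ^ 2 - 1) / √2) ^ 2 = fun x => (x ^ 2 - 1) ^ 2 / 2 := by
      ext x; simp [div_pow]
    have hv := variance_sq_gaussianReal
    rw [variance_eq_integral (by fun_prop), integral_sq_gaussianReal] at hv
    rw [e, integral_div, hv]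
    norm_num
  have h2 := taylor_charFun_two hX h0 h1
  have h3 : (fun t : ℝ => Complex.exp (-t ^ 2 / 2) - (1 - t ^ 2 / 2)) =o[𝓝 0] fun t : ℝ => t ^ 2 := by
    have h4 : (fun z : ℂ => Complex.exp z - 1 - z) =o[𝓝 0] fun z => z := by
      have := (Complex.hasDerivAt_exp 0).isLittleO
      simpa using this
    have h5 : Tendsto (fun t : ℝ => (-(t : ℂ) ^ 2 / 2)) (𝓝 0) (𝓝 0) := by
      have : Continuous fun t : ℝ => (-(t : ℂ) ^ 2 / 2) := by fun_prop
      simpa using this.tendsto 0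
    have h6 := h4.comp_tendsto h5
    have h7 : (fun t : ℝ => (-(t : ℂ) ^ 2 / 2)) =O[𝓝 0] fun t : ℝ => t ^ 2 := by
      refine IsBigO.of_bound 1 (Eventually.of_forall fun t => ?_)
      simp
      nlinarith [sq_nonneg t]
    refine (h6.trans_isBigO h7).congr_left fun t => ?_
    simp only [Function.comp_apply]
    ring
  refine (h2.sub h3).congr_left fun t => ?_
  rw [chiCharFun]
  ring

lemma norm_pow_sub_pow_le_mul {x y : ℂ} (hx : ‖x‖ ≤ 1) (hy : ‖y‖ ≤ 1) (n : ℕ) :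
    ‖x ^ n - y ^ n‖ ≤ n * ‖x - y‖ := by
  induction n with
  | zero => simp
  | succ n ih =>
    have : x ^ (n + 1) - y ^ (n + 1) = x * (x ^ n - y ^ n) + (x - y) * y ^ n := by ring
    rw [this]
    refine (norm_add_le _ _).trans ?_
    rw [norm_mul, norm_mul, norm_pow]
    have h2 : ‖y‖ ^ n ≤ 1 := pow_le_one₀ (norm_nonneg _) hy
    push_cast
    nlinarith [norm_nonneg (x ^ n - y ^ n), norm_nonneg (x - y)]

/-- The standardized difference of two averaged chi-square variables. -/
def chiDiff (k m : ℕ) (w : ℝ × ℝ) : ℝ := (w.1 / k - w.2 / m) / √(2 / k + 2 / m)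

lemma measurable_chiDiff (k m : ℕ) : Measurable (chiDiff k m) := by
  unfold chiDiff; fun_prop

lemma chiDiff_charFun {k m : ℕ} (hk : 1 ≤ k) (hm : 1 ≤ m) (t : ℝ) :
    charFun (((chiSq k).prod (chiSq m)).map (chiDiff k m)) t =
      chiCharFun (√2 / (k * √(2 / k + 2 / m)) * t) ^ k *
        chiCharFun (-(√2 / (m * √(2 / k + 2 / m)) * t)) ^ m := by
  have hV : 0 < √(2 / (k : ℝ) + 2 / m) := by
    have : (0 : ℝ) < k := by positivity
    positivity
  set V := √(2 / (k : ℝ) + 2 / m) with hVd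
  have hk0 : (k : ℝ) ≠ 0 := by positivity
  have hm0 : (m : ℝ) ≠ 0 := by positivity
  have h2 : √2 * √2 = (2 : ℝ) := Real.mul_self_sqrt (by norm_num)
  have h20 : √2 ≠ (0 : ℝ) := by positivity
  rw [charFun_apply_real, integral_map (measurable_chiDiff k m).aemeasurable
    (Measurable.aestronglyMeasurable (by fun_prop)), chiSq, chiSq,
    Measure.map_prod_map _ _ (by fun_prop) (by fun_prop),
    integral_map (Measurable.aemeasurable (by fun_prop)) (Measurable.aestronglyMeasurable
      (by have := measurable_chiDiff k m; fun_prop))]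
  have e : ∀ w : (Fin k → ℝ) × (Fin m → ℝ),
      Complex.exp (t * (chiDiff k m (Prod.map (fun w => ∑ i, w i ^ 2) (fun w => ∑ i, w i ^ 2) w) : ℝ)
        * Complex.I) =
      (∏ i, Complex.exp ((√2 / (k * V) * t : ℝ) * ((w.1 i ^ 2 - 1) / √2 : ℝ) * Complex.I)) *
      (∏ i, Complex.exp ((-(√2 / (m * V) * t) : ℝ) * ((w.2 i ^ 2 - 1) / √2 : ℝ) * Complex.I)) := by
    intro w
    rw [← Complex.exp_sum, ← Complex.exp_sum, ← Complex.exp_add, ← Finset.sum_mul,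
      ← Finset.sum_mul, ← Finset.mul_sum, ← Finset.mul_sum, ← add_mul]
    congr 2
    norm_cast
    simp only [chiDiff, Prod.map, ← Finset.sum_div, Finset.sum_sub_distrib]
    simp only [Finset.sum_const, Finset.card_univ, Fintype.card_fin, nsmul_eq_mul, mul_one]
    rw [← hVd]
    field_simp
    ring
  simp_rw [e]
  rw [integral_prod_mul (μ := stdNormalVector k) (ν := stdNormalVector m)
    (fun w : Fin k → ℝ => ∏ i, Complex.exp ((√2 / (k * V) * t : ℝ) *
      ((w i ^ 2 - 1) / √2 : ℝ) * Complex.I))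
    (fun w : Fin m → ℝ => ∏ i, Complex.exp ((-(√2 / (m * V) * t) : ℝ) *
      ((w i ^ 2 - 1) / √2 : ℝ) * Complex.I)), stdNormalVector, stdNormalVector,
    integral_fintype_prod_eq_prod (f := fun (_ : Fin k) (x : ℝ) =>
      Complex.exp ((√2 / (k * V) * t : ℝ) * ((x ^ 2 - 1) / √2 : ℝ) * Complex.I)),
    integral_fintype_prod_eq_prod (f := fun (_ : Fin m) (x : ℝ) =>
      Complex.exp ((-(√2 / (m * V) * t) : ℝ) * ((x ^ 2 - 1) / √2 : ℝ) * Complex.I))]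
  simp only [← chiCharFun_eq, Finset.prod_const, Finset.card_univ, Fintype.card_fin]

lemma tendsto_chiDiff_charFun {k m : ℕ → ℕ} (hk : Tendsto k atTop atTop)
    (hm : Tendsto m atTop atTop) (hk1 : ∀ j, 1 ≤ k j) (hm1 : ∀ j, 1 ≤ m j) (t : ℝ) :
    Tendsto (fun j => charFun (((chiSq (k j)).prod (chiSq (m j))).map (chiDiff (k j) (m j))) t)
      atTop (𝓝 (Complex.exp (-t ^ 2 / 2))) := by
  set V : ℕ → ℝ := fun j => √(2 / (k j : ℝ) + 2 / m j) with hVd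
  set a : ℕ → ℝ := fun j => √2 / (k j * V j) * t with ha
  set b : ℕ → ℝ := fun j => -(√2 / (m j * V j) * t) with hb
  have hkpos : ∀ j, (0 : ℝ) < k j := fun j => by exact_mod_cast hk1 j
  have hmpos : ∀ j, (0 : ℝ) < m j := fun j => by exact_mod_cast hm1 j
  have hV2 : ∀ j, V j ^ 2 = 2 / (k j : ℝ) + 2 / m j := fun j =>
    Real.sq_sqrt (by have := hkpos j; have := hmpos j; positivity)
  have hV0 : ∀ j, 0 < V j := fun j => Real.sqrt_pos.2
    (by have := hkpos j; have := hmpos j; positivity)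
  have ha2 : ∀ j, a j ^ 2 = 2 / (k j ^ 2 * V j ^ 2) * t ^ 2 := fun j => by
    simp only [ha]; rw [mul_pow, div_pow, Real.sq_sqrt (by norm_num)]; ring
  have hb2 : ∀ j, b j ^ 2 = 2 / (m j ^ 2 * V j ^ 2) * t ^ 2 := fun j => by
    simp only [hb]; rw [neg_sq, mul_pow, div_pow, Real.sq_sqrt (by norm_num)]; ring
  have hsum : ∀ j, k j * a j ^ 2 + m j * b j ^ 2 = t ^ 2 := fun j => by
    rw [ha2, hb2, hV2]
    have := hkpos j; have := hmpos j
    field_simp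
  have hka : ∀ j, k j * a j ^ 2 ≤ t ^ 2 := fun j => by
    have := hsum j; nlinarith [mul_nonneg (hmpos j).le (sq_nonneg (b j))]
  have hmb : ∀ j, m j * b j ^ 2 ≤ t ^ 2 := fun j => by
    have := hsum j; nlinarith [mul_nonneg (hkpos j).le (sq_nonneg (a j))]
  have key : ∀ (d : ℕ → ℕ) (c : ℕ → ℝ), Tendsto d atTop atTop → (∀ j, (0 : ℝ) < d j) →
      (∀ j, d j * c j ^ 2 ≤ t ^ 2) → Tendsto (fun j => d j *
        ‖chiCharFun (c j) - Complex.exp (-(c j) ^ 2 / 2)‖) atTop (𝓝 0) := by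
    intro d c hd hd0 hdc
    have hd' : Tendsto (fun j => (d j : ℝ)) atTop atTop := tendsto_natCast_atTop_atTop.comp hd
    have hc : Tendsto c atTop (𝓝 0) := by
      have h1 : Tendsto (fun j => c j ^ 2) atTop (𝓝 0) := by
        refine squeeze_zero (fun j => sq_nonneg _) (fun j => ?_) (hd'.const_div_atTop (t ^ 2))
        rw [le_div_iff₀ (hd0 j)]; linarith [hdc j]
      have h2 := h1.sqrt
      simp only [Real.sqrt_sq_eq_abs, Real.sqrt_zero] at h2
      exact (tendsto_zero_iff_abs_tendsto_zero _).2 h2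
    have ho := chiCharFun_sub_exp_isLittleO.comp_tendsto hc
    rw [Metric.tendsto_atTop]
    intro ε hε
    have hε' : 0 < ε / (t ^ 2 + 1) := by positivity
    have h3 := ho.def hε'
    obtain ⟨N, hN⟩ := eventually_atTop.1 h3
    refine ⟨N, fun j hj => ?_⟩
    have h4 := hN j hj
    simp only [Function.comp_apply, norm_pow, Real.norm_eq_abs, sq_abs] at h4
    rw [Real.dist_eq, sub_zero, abs_of_nonneg (by have := hd0 j; positivity)]
    calc _ ≤ (d j : ℝ) * (ε / (t ^ 2 + 1) * c j ^ 2) := by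
          exact mul_le_mul_of_nonneg_left (by exact_mod_cast h4) (hd0 j).le
      _ = ε / (t ^ 2 + 1) * (d j * c j ^ 2) := by ring
      _ ≤ ε / (t ^ 2 + 1) * t ^ 2 := by gcongr; exact hdc j
      _ < ε := by
          rw [div_mul_eq_mul_div, div_lt_iff₀ (by positivity)]
          nlinarith
  rw [tendsto_iff_norm_sub_tendsto_zero]
  have h5 := (key k a hk hkpos hka).add (key m b hm hmpos hmb)
  rw [add_zero] at h5
  refine squeeze_zero (fun _ => norm_nonneg _) (fun j => ?_) h5
  rw [chiDiff_charFun (hk1 j) (hm1 j)]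
  have e1 : ∀ c : ℝ, ‖Complex.exp (-(c : ℂ) ^ 2 / 2)‖ ≤ 1 := fun c => by
    have : (-(c : ℂ) ^ 2 / 2) = ((-c ^ 2 / 2 : ℝ) : ℂ) := by push_cast; ring
    rw [this, Complex.norm_exp_ofReal, Real.exp_le_one_iff]
    nlinarith [sq_nonneg c]
  have e2 : Complex.exp (-(t : ℂ) ^ 2 / 2) =
      Complex.exp (-(a j : ℂ) ^ 2 / 2) ^ k j * Complex.exp (-(b j : ℂ) ^ 2 / 2) ^ m j := by
    rw [← Complex.exp_nat_mul, ← Complex.exp_nat_mul, ← Complex.exp_add]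
    congr 1
    have : ((t ^ 2 : ℝ) : ℂ) = ((k j * a j ^ 2 + m j * b j ^ 2 : ℝ) : ℂ) := by rw [hsum]
    push_cast at this
    rw [this]; ring
  rw [e2]
  change ‖chiCharFun (a j) ^ k j * chiCharFun (b j) ^ m j - _‖ ≤ _
  have e3 : ∀ x y u v : ℂ, x * y - u * v = (x - u) * y + u * (y - v) := by intros; ring
  rw [e3]
  refine (norm_add_le _ _).trans ?_
  rw [norm_mul, norm_mul]
  refine add_le_add ?_ ?_
  · refine (mul_le_of_le_one_right (norm_nonneg _) ?_).trans
      (norm_pow_sub_pow_le_mul (norm_chiCharFun_le _) (e1 _) _)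
    rw [norm_pow]
    exact pow_le_one₀ (norm_nonneg _) (norm_chiCharFun_le _)
  · refine (mul_le_of_le_one_left (norm_nonneg _) ?_).trans
      (norm_pow_sub_pow_le_mul (norm_chiCharFun_le _) (e1 _) _)
    rw [norm_pow]
    exact pow_le_one₀ (norm_nonneg _) (e1 _)

lemma gaussianReal_Ioi (x : ℝ) : (gaussianReal 0 1).real (Set.Ioi x) = stdNormalCDF (-x) := by
  rw [stdNormalCDF, cdf_eq_real]
  have h := gaussianReal_map_neg (μ := 0) (v := 1)
  rw [neg_zero] at h
  conv_rhs => rw [← h]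
  rw [map_measureReal_apply (by fun_prop) measurableSet_Iic]
  have : (fun x : ℝ => -x) ⁻¹' Set.Iic (-x) = Set.Ici x := by ext; simp
  rw [this]
  have := nullSingletonClass_gaussianReal (μ := 0) (v := 1) one_ne_zero
  exact measureReal_congr Ioi_ae_eq_Ici

lemma tendsto_chiDiff_seq {k m : ℕ → ℕ} (hk : Tendsto k atTop atTop)
    (hm : Tendsto m atTop atTop) (hk1 : ∀ j, 1 ≤ k j) (hm1 : ∀ j, 1 ≤ m j) (x : ℝ) :
    Tendsto (fun j => ((chiSq (k j)).prod (chiSq (m j))).real {w | x < chiDiff (k j) (m j) w})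
      atTop (𝓝 (stdNormalCDF (-x))) := by
  have hp : ∀ j, IsProbabilityMeasure
      (((chiSq (k j)).prod (chiSq (m j))).map (chiDiff (k j) (m j))) := fun j =>
    Measure.isProbabilityMeasure_map (measurable_chiDiff _ _).aemeasurable
  let μ : ℕ → ProbabilityMeasure ℝ := fun j => ⟨_, hp j⟩
  let μ₀ : ProbabilityMeasure ℝ := ⟨gaussianReal 0 1, inferInstance⟩
  have h : Tendsto μ atTop (𝓝 μ₀) := by
    refine ProbabilityMeasure.tendsto_iff_tendsto_charFun.2 fun t => ?_
    have := tendsto_chiDiff_charFun hk hm hk1 hm1 t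
    have e : charFun (gaussianReal 0 1) t = Complex.exp (-t ^ 2 / 2) := by
      rw [charFun_gaussianReal]; simp; ring_nf
    change Tendsto _ _ (𝓝 (charFun (gaussianReal 0 1) t))
    rw [e]
    exact this
  have := nullSingletonClass_gaussianReal (μ := 0) (v := 1) one_ne_zero
  have h2 := ProbabilityMeasure.tendsto_measure_of_null_frontier_of_tendsto' h
    (E := Set.Ioi x) (by simp [μ₀])
  have h3 := (ENNReal.tendsto_toReal (measure_ne_top _ _)).comp h2
  rw [← gaussianReal_Ioi]
  refine h3.congr fun j => ?_
  change (Measure.map _ _ (Set.Ioi x)).toReal = _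
  rw [Measure.map_apply (measurable_chiDiff _ _) measurableSet_Ioi]
  rfl

/-- **Central limit theorem** for the difference of two averaged chi-square variables. -/
lemma tendsto_chiDiff {ι : Type*} {l : Filter ι} {k m : ι → ℕ} (hk : Tendsto k l atTop)
    (hm : Tendsto m l atTop) (x : ℝ) :
    Tendsto (fun i => ((chiSq (k i)).prod (chiSq (m i))).real {w | x < chiDiff (k i) (m i) w})
      l (𝓝 (stdNormalCDF (-x))) := by
  have h : Tendsto (fun q : ℕ × ℕ => ((chiSq q.1).prod (chiSq q.2)).real
      {w | x < chiDiff q.1 q.2 w}) (atTop ×ˢ atTop) (𝓝 (stdNormalCDF (-x))) := by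
    refine tendsto_of_seq_tendsto fun q hq => ?_
    have hq1 : Tendsto (fun j => (q j).1) atTop atTop := tendsto_fst.comp hq
    have hq2 : Tendsto (fun j => (q j).2) atTop atTop := tendsto_snd.comp hq
    have h1 := tendsto_chiDiff_seq (k := fun j => max (q j).1 1) (m := fun j => max (q j).2 1)
      (tendsto_atTop_mono (fun _ => le_max_left _ _) hq1)
      (tendsto_atTop_mono (fun _ => le_max_left _ _) hq2) (fun _ => le_max_right _ _)
      (fun _ => le_max_right _ _) x
    refine h1.congr' ?_
    filter_upwards [hq1.eventually_ge_atTop 1, hq2.eventually_ge_atTop 1] with j h2 h3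
    simp [max_eq_left h2, max_eq_left h3]
  exact h.comp (hk.prodMk hm)


/-- The ingredients of a noncentral `F` statistic `((Q₁ + 2C + N) / k) / (Q₂ / m)`: independent
chi-square variables `Q₁`, `Q₂`, and second moment bounds for the cross term `C` and for the
noncentrality `N`, whose mean is `(k + m) θ`. -/
structure IsFModel {Ω : Type*} [MeasurableSpace Ω] (μ : Measure Ω) (k m : ℕ) (θ : ℝ)
    (Q₁ Q₂ C N : Ω → ℝ) : Prop where
  law : HasLaw (fun ω => (Q₁ ω, Q₂ ω)) ((chiSq k).prod (chiSq m)) μ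
  cross : ∀ t, 0 < t → μ.real {ω | t ≤ |C ω|} ≤ ((k : ℝ) + m) * θ / t ^ 2
  shift : ∀ t, 0 < t → μ.real {ω | t ≤ |N ω - ((k : ℝ) + m) * θ|} ≤
    2 * ((k : ℝ) + m) * θ ^ 2 / t ^ 2

/-- The probability that the noncentral `F` statistic exceeds the quantile of the central one. -/
def fPower {Ω : Type*} [MeasurableSpace Ω] (μ : Measure Ω) (k m : ℕ) (α : ℝ)
    (Q₁ Q₂ C N : Ω → ℝ) : ℝ :=
  μ.real {ω | upperQuantile (fDist k m) α < ((Q₁ ω + 2 * C ω + N ω) / k) / (Q₂ ω / m)}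

/-- The scale `k √(2/k + 2/m)`. -/
def fScale (k m : ℕ) : ℝ := k * √(2 / k + 2 / m)

lemma le_fScale_sq {k : ℕ} (hk : 1 ≤ k) (m : ℕ) : (k : ℝ) ≤ fScale k m ^ 2 := by
  have : (0 : ℝ) < k := by positivity
  rw [fScale, mul_pow, Real.sq_sqrt (by positivity), mul_add]
  have h1 : (k : ℝ) ^ 2 * (2 / k) = 2 * k := by field_simp
  have h2 : 0 ≤ (k : ℝ) ^ 2 * (2 / m) := by positivity
  linarith

lemma fScale_pos {k : ℕ} (hk : 1 ≤ k) (m : ℕ) : 0 < fScale k m := by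
  have : (0 : ℝ) < k := by positivity
  unfold fScale; positivity

section Single

variable {Ω : Type*} [MeasurableSpace Ω] {μ : Measure Ω} {k m : ℕ} {θ : ℝ}
    {Q₁ Q₂ C N : Ω → ℝ}

lemma IsFModel.isProbabilityMeasure (h : IsFModel μ k m θ Q₁ Q₂ C N) : IsProbabilityMeasure μ :=
  h.law.isProbabilityMeasure

lemma IsFModel.measureReal_noncentral_le (h : IsFModel μ k m θ Q₁ Q₂ C N) (hk : 1 ≤ k)
    (hθ : 0 ≤ θ) {ε : ℝ} (hε : 0 < ε) (hx : ((k : ℝ) + m) * θ / k ≤ ε / 4) :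
    μ.real {ω | ε * k ≤ |2 * C ω + N ω|} ≤
      16 / ε ^ 2 * (((k : ℝ) + m) * θ / k) + 32 / ε ^ 2 * (((k : ℝ) + m) * θ / k) ^ 2 := by
  have := h.isProbabilityMeasure
  have hk0 : (1 : ℝ) ≤ k := by exact_mod_cast hk
  have ht : 0 < ε * k / 4 := by positivity
  set x := ((k : ℝ) + m) * θ / k with hxd
  have hx0 : 0 ≤ x := by positivity
  have hxk : ((k : ℝ) + m) * θ = x * k := by rw [hxd]; field_simp
  have hsub : {ω | ε * k ≤ |2 * C ω + N ω|} ⊆ {ω | ε * k / 4 ≤ |C ω|} ∪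
      {ω | ε * k / 4 ≤ |N ω - ((k : ℝ) + m) * θ|} := by
    intro ω hω
    by_contra hc
    simp only [Set.mem_union, Set.mem_ofPred_eq, not_or, not_le] at hc hω
    have h1 : |2 * C ω + N ω| ≤ 2 * |C ω| + |N ω - ((k : ℝ) + m) * θ| + ((k : ℝ) + m) * θ := by
      have e : 2 * C ω + N ω = (2 * C ω + (N ω - ((k : ℝ) + m) * θ)) + ((k : ℝ) + m) * θ := by ring
      rw [e]
      refine (abs_add_le _ _).trans ?_
      rw [abs_of_nonneg (a := ((k : ℝ) + m) * θ) (by positivity)]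
      gcongr
      refine (abs_add_le _ _).trans ?_
      rw [abs_mul, abs_two]
    rw [hxk] at *
    nlinarith [hc.1, hc.2]
  refine (measureReal_mono hsub).trans ((measureReal_union_le _ _).trans ?_)
  refine add_le_add ((h.cross _ ht).trans ?_) ((h.shift _ ht).trans ?_)
  · rw [hxk]
    have : x * k / (ε * k / 4) ^ 2 = 16 / ε ^ 2 * x * (1 / k) := by field_simp; ring
    rw [this]
    refine mul_le_of_le_one_right (by positivity) ?_
    rw [div_le_one (by positivity)]; exact hk0
  · have hn : (1 : ℝ) ≤ (k : ℝ) + m := by have : (0 : ℝ) ≤ m := by positivity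
                                          linarith
    have : 2 * ((k : ℝ) + m) * θ ^ 2 / (ε * k / 4) ^ 2 =
        32 / ε ^ 2 * x ^ 2 * (1 / ((k : ℝ) + m)) := by rw [hxd]; field_simp; ring
    rw [this]
    refine mul_le_of_le_one_right (by positivity) ?_
    rw [div_le_one (by positivity)]; exact hn

lemma IsFModel.measureReal_shift_le (h : IsFModel μ k m θ Q₁ Q₂ C N) (hk : 1 ≤ k)
    {θ₀ : ℝ} (hθ : 0 ≤ θ) (hθ₀ : θ ≤ θ₀) {ε : ℝ} (hε : 0 < ε) (hρ : (1 - ε / 4) * θ₀ ≤ θ)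
    {Δ : ℝ} (hΔ : Δ = ((k : ℝ) + m) * θ₀ / fScale k m) :
    μ.real {ω | ε * (1 + Δ) ≤ |(2 * C ω + N ω) / fScale k m - Δ|} ≤
      64 / ε ^ 2 * (1 / fScale k m) + 32 / ε ^ 2 * (1 / ((k : ℝ) + m)) := by
  have := h.isProbabilityMeasure
  have hk0 : (1 : ℝ) ≤ k := by exact_mod_cast hk
  have hm0 : (0 : ℝ) ≤ m := by positivity
  have hs := fScale_pos hk m
  set s := fScale k m
  have hn : (0 : ℝ) < (k : ℝ) + m := by linarith
  have hΔ0 : 0 ≤ Δ := by rw [hΔ]; have := hθ.trans hθ₀; positivity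
  have hΔs : ((k : ℝ) + m) * θ₀ = Δ * s := by rw [hΔ]; field_simp
  have hnθ : ((k : ℝ) + m) * θ ≤ Δ * s := by rw [← hΔs]; gcongr
  have hnθ' : (1 - ε / 4) * (Δ * s) ≤ ((k : ℝ) + m) * θ := by
    rw [← hΔs]; nlinarith
  set t := ε * (1 + Δ) * s / 8 with ht
  have ht0 : 0 < t := by positivity
  have hsub : {ω | ε * (1 + Δ) ≤ |(2 * C ω + N ω) / s - Δ|} ⊆ {ω | t ≤ |C ω|} ∪
      {ω | 2 * t ≤ |N ω - ((k : ℝ) + m) * θ|} := by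
    intro ω hω
    by_contra hc
    simp only [Set.mem_union, Set.mem_ofPred_eq, not_or, not_le] at hc hω
    have e0 : (2 * C ω + N ω) / s - Δ = (2 * C ω + N ω - Δ * s) / s := by field_simp
    rw [e0, abs_div, abs_of_pos hs, le_div_iff₀ hs] at hω
    have h1 : |2 * C ω + N ω - Δ * s| ≤ 2 * |C ω| + |N ω - ((k : ℝ) + m) * θ| +
        (Δ * s - ((k : ℝ) + m) * θ) := by
      have e : 2 * C ω + N ω - Δ * s = (2 * C ω + (N ω - ((k : ℝ) + m) * θ)) -
        (Δ * s - ((k : ℝ) + m) * θ) := by ring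
      rw [e]
      refine (abs_sub _ _).trans ?_
      rw [abs_of_nonneg (a := Δ * s - ((k : ℝ) + m) * θ) (by linarith)]
      gcongr
      refine (abs_add_le _ _).trans ?_
      rw [abs_mul, abs_two]
    have hΔs0 : 0 ≤ ε * s := by positivity
    nlinarith [hc.1, hc.2]
  refine (measureReal_mono hsub).trans ((measureReal_union_le _ _).trans ?_)
  refine add_le_add ((h.cross _ ht0).trans ?_) ((h.shift _ (by positivity)).trans ?_)
  · calc ((k : ℝ) + m) * θ / t ^ 2 ≤ Δ * s / t ^ 2 := by gcongr
      _ = 64 / ε ^ 2 * (1 / s) * (Δ / (1 + Δ) ^ 2) := by rw [ht]; field_simp; ring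
      _ ≤ 64 / ε ^ 2 * (1 / s) := by
          refine mul_le_of_le_one_right (by positivity) ?_
          rw [div_le_one (by positivity)]
          nlinarith
  · have hsq : (((k : ℝ) + m) * θ) ^ 2 ≤ (Δ * s) ^ 2 := by gcongr
    calc 2 * ((k : ℝ) + m) * θ ^ 2 / (2 * t) ^ 2
        = 2 * (((k : ℝ) + m) * θ) ^ 2 / (2 * t) ^ 2 * (1 / ((k : ℝ) + m)) := by field_simp
      _ ≤ 2 * (Δ * s) ^ 2 / (2 * t) ^ 2 * (1 / ((k : ℝ) + m)) := by gcongr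
      _ = 32 / ε ^ 2 * (1 / ((k : ℝ) + m)) * (Δ ^ 2 / (1 + Δ) ^ 2) := by
          rw [ht]; field_simp; ring
      _ ≤ 32 / ε ^ 2 * (1 / ((k : ℝ) + m)) := by
          refine mul_le_of_le_one_right (by positivity) ?_
          rw [div_le_one (by positivity)]
          nlinarith

end Single

lemma prod_chiSq_near_le_left {k : ℕ} (hk : 1 ≤ k) (m : ℕ) (c t : ℝ) :
    ((chiSq k).prod (chiSq m)).real {w | |w.1 - c * w.2| ≤ t} ≤ 2 * √(2 * t) := by
  have hm : MeasurableSet {w : ℝ × ℝ | |w.1 - c * w.2| ≤ t} :=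
    measurableSet_le (by fun_prop) (by fun_prop)
  refine ENNReal.toReal_le_of_le_ofReal (by positivity) ?_
  rw [Measure.prod_apply_symm hm]
  calc _ ≤ ∫⁻ _, ENNReal.ofReal (2 * √(2 * t)) ∂chiSq m := by
        refine lintegral_mono fun v => (measure_mono ?_).trans
          (chiSq_Icc_le hk (c * v - t) (2 * t))
        intro u hu
        simp only [Set.mem_preimage, Set.mem_ofPred_eq, abs_le] at hu
        constructor <;> linarith [hu.1, hu.2]
    _ = _ := by simp

lemma prod_chiSq_near_le_right (k : ℕ) {m : ℕ} (hm : 1 ≤ m) {c : ℝ} (hc : 0 < c) (t : ℝ) :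
    ((chiSq k).prod (chiSq m)).real {w | |w.1 - c * w.2| ≤ t} ≤ 2 * √(2 * (t / c)) := by
  have hms : MeasurableSet {w : ℝ × ℝ | |w.1 - c * w.2| ≤ t} :=
    measurableSet_le (by fun_prop) (by fun_prop)
  refine ENNReal.toReal_le_of_le_ofReal (by positivity) ?_
  rw [Measure.prod_apply hms]
  calc _ ≤ ∫⁻ _, ENNReal.ofReal (2 * √(2 * (t / c))) ∂chiSq k := by
        refine lintegral_mono fun v => (measure_mono ?_).trans
          (chiSq_Icc_le hm ((v - t) / c) (2 * (t / c)))
        intro u hu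
        simp only [Set.mem_preimage, Set.mem_ofPred_eq, abs_le] at hu
        constructor
        · rw [div_le_iff₀ hc]; linarith
        · have e : (v - t) / c + 2 * (t / c) = (v + t) / c := by field_simp; ring
          rw [e, le_div_iff₀ hc]; linarith
    _ = _ := by simp


/-- The upper quantile of an `F`-distribution is bounded below uniformly in the degrees of
freedom. -/
lemma exists_le_upperQuantile_fDist {α : ℝ} (h0 : 0 < α) (h1 : α < 1) :
    ∃ q₀ : ℝ, 0 < q₀ ∧ ∀ k m : ℕ, 1 ≤ k → 1 ≤ m → q₀ ≤ upperQuantile (fDist k m) α := by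
  set δ := 1 - α with hδ
  have hδ0 : 0 < δ := by linarith
  set κ := (δ / 16) ^ 2 with hκ
  have hκ0 : 0 < κ := by positivity
  set M := 1 + 4 / δ with hM
  have hM0 : 0 < M := by positivity
  refine ⟨κ / 2 / M, by positivity, fun k m hk hm => ?_⟩
  by_contra hlt
  push Not at hlt
  have hk0 : (1 : ℝ) ≤ k := by exact_mod_cast hk
  have hm0 : (1 : ℝ) ≤ m := by exact_mod_cast hm
  set q := upperQuantile (fDist k m) α with hq
  set μ := (chiSq k).prod (chiSq m)
  have hq1 : μ.real {w | q < (w.1 / k) / (w.2 / m)} = α := measureReal_fDist_quantile hk hm h0 h1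
  have hA : μ.real {w | w.1 < κ * k / 2} ≤ δ / 4 := by
    have : {w : ℝ × ℝ | w.1 < κ * k / 2} = Prod.fst ⁻¹' (Set.Iio (κ * k / 2)) := rfl
    refine ENNReal.toReal_le_of_le_ofReal (by positivity) ?_
    rw [this, ← Measure.map_apply measurable_fst measurableSet_Iio]
    have e : μ.map Prod.fst = chiSq k := by simp [μ]
    rw [e]
    refine (chiSq_lower_tail hk hκ0).trans (le_of_eq ?_)
    rw [hκ, Real.sqrt_sq (by positivity)]
    congr 1; ring
  have hB : μ.real {w | ¬ (0 < w.2 ∧ w.2 < M * m)} ≤ δ / 4 := by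
    have hs : {w : ℝ × ℝ | ¬ (0 < w.2 ∧ w.2 < M * m)} =
      Prod.snd ⁻¹' {x | ¬ (0 < x ∧ x < M * m)} := rfl
    have hms : MeasurableSet {x : ℝ | ¬ (0 < x ∧ x < M * m)} :=
      (measurableSet_Ioo (a := (0 : ℝ)) (b := M * m)).compl
    refine ENNReal.toReal_le_of_le_ofReal (by positivity) ?_
    rw [hs, ← Measure.map_apply measurable_snd hms]
    have e : μ.map Prod.snd = chiSq m := by simp [μ]
    rw [e]
    calc chiSq m {x | ¬ (0 < x ∧ x < M * m)} ≤ chiSq m {x | (4 / δ) * m ≤ |x - m|} := by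
          refine measure_mono_ae ?_
          filter_upwards [chiSq_ae_pos hm] with x hx hx2
          have hx2' : ¬ (0 < x ∧ x < M * m) := hx2
          change (4 / δ) * m ≤ |x - m|
          push Not at hx2'
          have := hx2' hx
          refine le_trans ?_ (le_abs_self _)
          rw [hM] at this
          linarith
      _ ≤ ENNReal.ofReal (2 * m / ((4 / δ) * m) ^ 2) := chiSq_chebyshev m (by positivity)
      _ ≤ ENNReal.ofReal (δ / 4) := by
          refine ENNReal.ofReal_le_ofReal ?_
          have : 2 * m / ((4 / δ) * m) ^ 2 = δ / 8 * (δ * (1 / m)) := by field_simp; ring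
          rw [this]
          have h3 : δ * (1 / m) ≤ 1 * 1 := by
            gcongr
            · linarith
            · rw [div_le_one (by positivity)]; exact hm0
          nlinarith
  have hcov : (Set.univ : Set (ℝ × ℝ)) ⊆ {w | q < (w.1 / k) / (w.2 / m)} ∪
      ({w | w.1 < κ * k / 2} ∪ {w | ¬ (0 < w.2 ∧ w.2 < M * m)}) := by
    intro w _
    by_contra hc
    simp only [Set.mem_union, Set.mem_ofPred_eq, not_or, not_lt, not_not] at hc
    obtain ⟨c1, c2, c3, c4⟩ := hc
    have h5 : κ / 2 ≤ w.1 / k := by rw [le_div_iff₀ (by positivity)]; linarith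
    have h6 : w.2 / m < M := by rw [div_lt_iff₀ (by positivity)]; exact c4
    have h50 : 0 ≤ w.1 / k := le_trans (by positivity) h5
    have h7 : κ / 2 / M ≤ (w.1 / k) / (w.2 / m) := by gcongr
    linarith
  have h8 := measureReal_mono (μ := μ) hcov
  have h9 := measureReal_union_le (μ := μ) {w | q < (w.1 / k) / (w.2 / m)}
    ({w | w.1 < κ * k / 2} ∪ {w | ¬ (0 < w.2 ∧ w.2 < M * m)})
  have h10 := measureReal_union_le (μ := μ) {w | w.1 < κ * k / 2} {w | ¬ (0 < w.2 ∧ w.2 < M * m)}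
  have h11 : μ.real Set.univ = 1 := by simp [μ]
  linarith

lemma IsFModel.abs_fPower_sub_le {Ω : Type*} [MeasurableSpace Ω] {μ : Measure Ω} {k m : ℕ} {θ : ℝ}
    {Q₁ Q₂ C N : Ω → ℝ} (h : IsFModel μ k m θ Q₁ Q₂ C N) (hk : 1 ≤ k) (hm : 1 ≤ m)
    {α : ℝ} (h0 : 0 < α) (h1 : α < 1) (t : ℝ) :
    |fPower μ k m α Q₁ Q₂ C N - α| ≤ μ.real {ω | t ≤ |2 * C ω + N ω|} +
      ((chiSq k).prod (chiSq m)).real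
        {w | |w.1 - upperQuantile (fDist k m) α * k / m * w.2| ≤ t} := by
  have := h.isProbabilityMeasure
  have hk0 : (0 : ℝ) < k := by positivity
  have hm0 : (0 : ℝ) < m := by positivity
  set q := upperQuantile (fDist k m) α with hq
  have hpos : ∀ᵐ ω ∂μ, 0 < Q₂ ω := by
    have h2 : ∀ᵐ w ∂((chiSq k).prod (chiSq m)), 0 < w.2 :=
      Measure.quasiMeasurePreserving_snd.ae (chiSq_ae_pos hm)
    rw [← h.law.map_eq] at h2
    exact ae_of_ae_map h.law.aemeasurable h2
  have hα : μ.real {ω | q < (Q₁ ω / k) / (Q₂ ω / m)} = α := by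
    rw [← measureReal_fDist_quantile hk hm h0 h1]
    exact h.law.measureReal_eq (p := fun w => q < (w.1 / k) / (w.2 / m))
      (measurableSet_lt (by fun_prop) (by fun_prop))
  have hmid : ((chiSq k).prod (chiSq m)).real {w | |w.1 - q * k / m * w.2| ≤ t} =
      μ.real {ω | |Q₁ ω - q * k / m * Q₂ ω| ≤ t} :=
    (h.law.measureReal_eq (p := fun w => |w.1 - q * k / m * w.2| ≤ t)
      (measurableSet_le (by fun_prop) (by fun_prop))).symm
  rw [hmid, fPower, ← hq]
  have heq : ∀ x y : ℝ, 0 < y → (q < (x / k) / (y / m) ↔ q * k / m * y < x) := by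
    intro x y hy
    rw [lt_div_iff₀ (by positivity), lt_div_iff₀ hk0]
    have : q * (y / m) * k = q * k / m * y := by field_simp
    rw [this]
  have hA : μ.real {ω | q < ((Q₁ ω + 2 * C ω + N ω) / k) / (Q₂ ω / m)} ≤
      μ.real {ω | q < (Q₁ ω / k) / (Q₂ ω / m)} + (μ.real {ω | t ≤ |2 * C ω + N ω|} +
        μ.real {ω | |Q₁ ω - q * k / m * Q₂ ω| ≤ t}) := by
    refine le_trans ?_ (add_le_add le_rfl (measureReal_union_le _ _))
    refine le_trans ?_ (measureReal_union_le _ _)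
    refine ENNReal.toReal_mono (measure_ne_top _ _) (measure_mono_ae ?_)
    filter_upwards [hpos] with ω hω hin
    have hin' : q < ((Q₁ ω + 2 * C ω + N ω) / k) / (Q₂ ω / m) := hin
    rw [heq _ _ hω] at hin'
    by_contra hc
    change ¬ (q < (Q₁ ω / k) / (Q₂ ω / m) ∨ (t ≤ |2 * C ω + N ω| ∨
      |Q₁ ω - q * k / m * Q₂ ω| ≤ t)) at hc
    rw [heq _ _ hω] at hc
    push Not at hc
    obtain ⟨c1, c2, c3⟩ := hc
    rw [abs_of_nonpos (by linarith)] at c3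
    have := le_abs_self (2 * C ω + N ω)
    linarith
  have hB : μ.real {ω | q < (Q₁ ω / k) / (Q₂ ω / m)} ≤
      μ.real {ω | q < ((Q₁ ω + 2 * C ω + N ω) / k) / (Q₂ ω / m)} +
      (μ.real {ω | t ≤ |2 * C ω + N ω|} +
        μ.real {ω | |Q₁ ω - q * k / m * Q₂ ω| ≤ t}) := by
    refine le_trans ?_ (add_le_add le_rfl (measureReal_union_le _ _))
    refine le_trans ?_ (measureReal_union_le _ _)
    refine ENNReal.toReal_mono (measure_ne_top _ _) (measure_mono_ae ?_)
    filter_upwards [hpos] with ω hω hin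
    have hin' : q < (Q₁ ω / k) / (Q₂ ω / m) := hin
    rw [heq _ _ hω] at hin'
    by_contra hc
    change ¬ (q < ((Q₁ ω + 2 * C ω + N ω) / k) / (Q₂ ω / m) ∨ (t ≤ |2 * C ω + N ω| ∨
      |Q₁ ω - q * k / m * Q₂ ω| ≤ t)) at hc
    rw [heq _ _ hω] at hc
    push Not at hc
    obtain ⟨c1, c2, c3⟩ := hc
    rw [abs_of_nonneg (by linarith)] at c3
    have := neg_abs_le (2 * C ω + N ω)
    linarith
  rw [hα] at hA hB
  rw [abs_le]
  constructor <;> linarith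

section Slutsky

variable {ι : Type*} {l : Filter ι} {Ω : ι → Type*} [∀ i, MeasurableSpace (Ω i)]
  {μ : ∀ i, Measure (Ω i)} [∀ i, IsProbabilityMeasure (μ i)] {Z Y : ∀ i, Ω i → ℝ} {G : ℝ → ℝ}

lemma tendsto_measureReal_add_const (hG : Continuous G)
    (hZ : ∀ x, Tendsto (fun i => (μ i).real {ω | x < Z i ω}) l (𝓝 (G x))) {c : ℝ}
    (hY : ∀ ε, 0 < ε → Tendsto (fun i => (μ i).real {ω | ε ≤ |Y i ω - c|}) l (𝓝 0)) (x : ℝ) :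
    Tendsto (fun i => (μ i).real {ω | x < Z i ω + Y i ω}) l (𝓝 (G (x - c))) := by
  rw [Metric.tendsto_nhds]
  intro δ hδ
  obtain ⟨r, hr, hGr⟩ := Metric.continuousAt_iff.1 (hG.continuousAt (x := x - c)) (δ / 3)
    (by positivity)
  set ε := r / 2 with hε
  have hε0 : 0 < ε := by positivity
  have g1 := hGr (x := x - c - ε) (by rw [Real.dist_eq, abs_lt]; constructor <;> linarith)
  have g2 := hGr (x := x - c + ε) (by rw [Real.dist_eq, abs_lt]; constructor <;> linarith)
  rw [Real.dist_eq, abs_lt] at g1 g2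
  filter_upwards [Metric.tendsto_nhds.1 (hZ (x - c - ε)) (δ / 3) (by positivity),
    Metric.tendsto_nhds.1 (hZ (x - c + ε)) (δ / 3) (by positivity),
    Metric.tendsto_nhds.1 (hY ε hε0) (δ / 3) (by positivity)] with i a1 a2 a3
  rw [Real.dist_eq, abs_lt] at a1 a2 a3 ⊢
  have s1 : {ω | x < Z i ω + Y i ω} ⊆ {ω | x - c - ε < Z i ω} ∪ {ω | ε ≤ |Y i ω - c|} := by
    intro ω hω
    by_contra hc
    simp only [Set.mem_union, Set.mem_ofPred_eq, not_or, not_le, not_lt] at hc hω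
    have := (abs_lt.1 hc.2).2
    linarith [hc.1]
  have s2 : {ω | x - c + ε < Z i ω} ⊆ {ω | x < Z i ω + Y i ω} ∪ {ω | ε ≤ |Y i ω - c|} := by
    intro ω hω
    by_contra hc
    simp only [Set.mem_union, Set.mem_ofPred_eq, not_or, not_le, not_lt] at hc hω
    have := (abs_lt.1 hc.2).1
    linarith [hc.1]
  have b1 := (measureReal_mono (μ := μ i) s1).trans (measureReal_union_le _ _)
  have b2 := (measureReal_mono (μ := μ i) s2).trans (measureReal_union_le _ _)
  constructor <;> linarith [a1.1, a1.2, a2.1, a2.2, a3.1, a3.2, g1.1, g1.2, g2.1, g2.2]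

lemma tendsto_measureReal_add_atTop (hG : Tendsto G atBot (𝓝 1))
    (hZ : ∀ x, Tendsto (fun i => (μ i).real {ω | x < Z i ω}) l (𝓝 (G x)))
    (hY : ∀ B : ℝ, Tendsto (fun i => (μ i).real {ω | Y i ω ≤ B}) l (𝓝 0)) (x : ℝ) :
    Tendsto (fun i => (μ i).real {ω | x < Z i ω + Y i ω}) l (𝓝 1) := by
  rw [Metric.tendsto_nhds]
  intro δ hδ
  obtain ⟨y, hy⟩ := (Metric.tendsto_nhds.1 hG (δ / 3) (by positivity)).exists
  rw [Real.dist_eq, abs_lt] at hy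
  filter_upwards [Metric.tendsto_nhds.1 (hZ y) (δ / 3) (by positivity),
    Metric.tendsto_nhds.1 (hY (x - y)) (δ / 3) (by positivity)] with i a1 a2
  rw [Real.dist_eq, abs_lt] at a1 a2 ⊢
  have s2 : {ω | y < Z i ω} ⊆ {ω | x < Z i ω + Y i ω} ∪ {ω | Y i ω ≤ x - y} := by
    intro ω hω
    by_contra hc
    simp only [Set.mem_union, Set.mem_ofPred_eq, not_or, not_le, not_lt] at hc hω
    linarith [hc.1, hc.2]
  have b2 := (measureReal_mono (μ := μ i) s2).trans (measureReal_union_le _ _)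
  have b3 : (μ i).real {ω | x < Z i ω + Y i ω} ≤ 1 := measureReal_le_one
  constructor <;> linarith [a1.1, a1.2, a2.1, a2.2, hy.1]

end Slutsky

lemma continuous_stdNormalCDF : Continuous stdNormalCDF := by
  unfold stdNormalCDF
  have := nullSingletonClass_gaussianReal (μ := 0) (v := 1) one_ne_zero
  exact continuous_cdf fun x => measure_singleton x

lemma stdNormalCDF_neg_upperQuantile {α : ℝ} (h0 : 0 < α) (h1 : α < 1) :
    stdNormalCDF (-upperQuantile (gaussianReal 0 1) α) = α := by
  have := nullSingletonClass_gaussianReal (μ := 0) (v := 1) one_ne_zero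
  rw [← gaussianReal_Ioi]
  exact measureReal_Ioi_upperQuantile (fun x => measure_singleton x) h0 h1

lemma strictMono_stdNormalCDF : StrictMono stdNormalCDF := by
  intro x y hxy
  unfold stdNormalCDF
  rw [cdf_eq_real, cdf_eq_real, ← Set.Iic_union_Ioc_eq_Iic hxy.le,
    measureReal_union (Set.Iic_disjoint_Ioc le_rfl) measurableSet_Ioc]
  have : (gaussianReal 0 1) (Set.Ioc x y) ≠ 0 := by
    intro h
    have h2 := gaussianReal_absolutelyContinuous' 0 (v := 1) one_ne_zero h
    rw [Real.volume_Ioc, ENNReal.ofReal_eq_zero] at h2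
    linarith
  have : 0 < (gaussianReal 0 1).real (Set.Ioc x y) :=
    ENNReal.toReal_pos this (measure_ne_top _ _)
  linarith


section Core

variable {ι : Type*} {l : Filter ι} {Ω : ι → Type*} [∀ i, MeasurableSpace (Ω i)]
  {μ : ∀ i, Measure (Ω i)} {k m : ι → ℕ} {θ θ₀ : ι → ℝ}
  {Q₁ Q₂ C N : ∀ i, Ω i → ℝ} {α : ℝ}

/-- If one of the two degrees of freedom stays bounded, the power tends to the level. -/
lemma tendsto_fPower_of_bounded (h0 : 0 < α) (h1 : α < 1)
    (hM : ∀ᶠ i in l, IsFModel (μ i) (k i) (m i) (θ i) (Q₁ i) (Q₂ i) (C i) (N i))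
    (hk : ∀ᶠ i in l, 1 ≤ k i) (hm : ∀ᶠ i in l, 1 ≤ m i) (hθ : ∀ᶠ i in l, 0 ≤ θ i ∧ θ i ≤ θ₀ i)
    (hx : Tendsto (fun i => ((k i : ℝ) + m i) * θ₀ i / k i) l (𝓝 0))
    {K : ℕ} (hK : (∀ᶠ i in l, k i ≤ K) ∨ ∀ᶠ i in l, m i ≤ K) :
    Tendsto (fun i => fPower (μ i) (k i) (m i) α (Q₁ i) (Q₂ i) (C i) (N i)) l (𝓝 α) := by
  obtain ⟨q₀, hq₀, hq⟩ := exists_le_upperQuantile_fDist h0 h1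
  rw [Metric.tendsto_nhds]
  intro δ hδ
  set L : ℝ := 2 * ((K + 1) * (1 + 1 / q₀)) with hL
  have hL0 : 0 < L := by positivity
  set ε : ℝ := (δ / 4) ^ 2 / 2 / L with hε
  have hε0 : 0 < ε := by positivity
  have hsq : 2 * √(L * ε) < δ / 2 := by
    have : √(L * ε) < δ / 4 := by
      rw [Real.sqrt_lt' (by positivity), hε]
      have : L * ((δ / 4) ^ 2 / 2 / L) = (δ / 4) ^ 2 / 2 := by field_simp
      rw [this]
      have : 0 < (δ / 4) ^ 2 := by positivity
      linarith
    linarith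
  have hb : Tendsto (fun i => 16 / ε ^ 2 * (((k i : ℝ) + m i) * θ₀ i / k i) +
      32 / ε ^ 2 * (((k i : ℝ) + m i) * θ₀ i / k i) ^ 2) l (𝓝 0) := by
    have := (hx.const_mul (16 / ε ^ 2)).add ((hx.pow 2).const_mul (32 / ε ^ 2))
    simpa using this
  have hmid : ∀ᶠ i in l, ((chiSq (k i)).prod (chiSq (m i))).real
        {w | |w.1 - upperQuantile (fDist (k i) (m i)) α * k i / m i * w.2| ≤ ε * k i} ≤
          2 * √(L * ε) := by
    have h1q : 1 ≤ 1 + 1 / q₀ := by have : 0 < 1 / q₀ := by positivity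
                                    linarith
    rcases hK with hK | hK
    · filter_upwards [hK, hk] with i hi hki
      refine (prod_chiSq_near_le_left hki _ _ _).trans ?_
      gcongr 2 * √?_
      rw [hL]
      have : (k i : ℝ) ≤ K := by exact_mod_cast hi
      calc 2 * (ε * k i) ≤ 2 * (ε * ((K + 1) * 1)) := by gcongr; linarith
        _ ≤ 2 * (ε * ((K + 1) * (1 + 1 / q₀))) := by gcongr
        _ = _ := by ring
    · filter_upwards [hK, hk, hm] with i hi hki hmi
      have hqi := hq (k i) (m i) hki hmi
      have hqp := hq₀.trans_le hqi
      have hk0 : (0 : ℝ) < k i := by positivity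
      have hm0 : (0 : ℝ) < m i := by positivity
      refine (prod_chiSq_near_le_right _ hmi (by positivity) _).trans ?_
      gcongr 2 * √?_
      have : (m i : ℝ) ≤ K := by exact_mod_cast hi
      have e : ε * k i / (upperQuantile (fDist (k i) (m i)) α * k i / m i) =
        ε * (m i * (1 / upperQuantile (fDist (k i) (m i)) α)) := by field_simp
      rw [e, hL]
      have h3 : 1 / upperQuantile (fDist (k i) (m i)) α ≤ 1 / q₀ :=
        one_div_le_one_div_of_le hq₀ hqi
      calc 2 * (ε * (m i * (1 / upperQuantile (fDist (k i) (m i)) α)))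
          ≤ 2 * (ε * ((K + 1) * (1 + 1 / q₀))) := by gcongr <;> linarith
        _ = _ := by ring
  filter_upwards [hM, hk, hm, hθ, hmid, (hb.eventually (gt_mem_nhds (half_pos hδ))),
    hx.eventually (gt_mem_nhds (show 0 < ε / 4 by positivity))] with i hMi hki hmi hθi hmi2 hbi hxi
  have hle : ((k i : ℝ) + m i) * θ i / k i ≤ ((k i : ℝ) + m i) * θ₀ i / k i := by
    gcongr; exact hθi.2
  have hnn : 0 ≤ ((k i : ℝ) + m i) * θ i / k i := by have := hθi.1; positivity
  rw [Real.dist_eq]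
  calc _ ≤ _ := hMi.abs_fPower_sub_le hki hmi h0 h1 (ε * k i)
    _ ≤ (16 / ε ^ 2 * (((k i : ℝ) + m i) * θ i / k i) +
      32 / ε ^ 2 * (((k i : ℝ) + m i) * θ i / k i) ^ 2) + 2 * √(L * ε) :=
        add_le_add (hMi.measureReal_noncentral_le hki hθi.1 hε0 (hle.trans hxi.le)) hmi2
    _ ≤ (16 / ε ^ 2 * (((k i : ℝ) + m i) * θ₀ i / k i) +
      32 / ε ^ 2 * (((k i : ℝ) + m i) * θ₀ i / k i) ^ 2) + 2 * √(L * ε) := by gcongr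
    _ < δ := by linarith

/-- The standardized quantile of the `F`-distribution. -/
def fQuantileStd (α : ℝ) (k m : ℕ) : ℝ := (upperQuantile (fDist k m) α - 1) / √(2 / k + 2 / m)

lemma fStat_gt_iff {k m : ℕ} (hk : 1 ≤ k) (hm : 1 ≤ m) (q : ℝ) {x y d : ℝ} (hy : 0 < y) :
    q < ((x + d) / k) / (y / m) ↔
      (q - 1) / √(2 / (k : ℝ) + 2 / m) * (y / m) < chiDiff k m (x, y) + d / fScale k m := by
  have hk0 : (0 : ℝ) < k := by positivity
  have hm0 : (0 : ℝ) < m := by positivity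
  have hV : 0 < √(2 / (k : ℝ) + 2 / m) := by positivity
  rw [lt_div_iff₀ (by positivity), chiDiff, fScale]
  set V := √(2 / (k : ℝ) + 2 / m)
  have e1 : (q - 1) / V * (y / m) = (q * (y / m) - y / m) / V := by field_simp
  have e2 : (x / k - y / m) / V + d / (k * V) = ((x + d) / k - y / m) / V := by field_simp; ring
  simp only []
  rw [e1, e2, div_lt_div_iff_of_pos_right hV, sub_lt_sub_iff_right]

lemma tendsto_chiSq_snd_ratio (hm : Tendsto m l atTop) {ε : ℝ} (hε : 0 < ε) :
    Tendsto (fun i => ((chiSq (k i)).prod (chiSq (m i))).real {w | ε ≤ |w.2 / m i - 1|}) l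
      (𝓝 0) := by
  have hm' : Tendsto (fun i => (m i : ℝ)) l atTop := tendsto_natCast_atTop_atTop.comp hm
  have hb : Tendsto (fun i => 2 / ε ^ 2 * (1 / (m i : ℝ))) l (𝓝 0) := by
    simpa using (hm'.const_div_atTop 1).const_mul (2 / ε ^ 2)
  refine squeeze_zero' (Eventually.of_forall fun _ => measureReal_nonneg) ?_ hb
  filter_upwards [hm.eventually_ge_atTop 1] with i hi
  have hm0 : (0 : ℝ) < m i := by positivity
  refine ENNReal.toReal_le_of_le_ofReal (by positivity) ?_
  have hs : {w : ℝ × ℝ | ε ≤ |w.2 / m i - 1|} = Prod.snd ⁻¹' {x : ℝ | ε * m i ≤ |x - m i|} := by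
    ext w
    simp only [Set.mem_ofPred_eq, Set.mem_preimage]
    have : w.2 / m i - 1 = (w.2 - m i) / m i := by field_simp
    rw [this, abs_div, abs_of_pos hm0, le_div_iff₀ hm0]
  rw [hs, ← Measure.map_apply measurable_snd (measurableSet_le (by fun_prop) (by fun_prop))]
  have e : ((chiSq (k i)).prod (chiSq (m i))).map Prod.snd = chiSq (m i) := by simp
  rw [e]
  refine (chiSq_chebyshev (m i) (by positivity)).trans (le_of_eq ?_)
  congr 1
  field_simp

lemma tendsto_fQuantileStd (h0 : 0 < α) (h1 : α < 1) (hk : Tendsto k l atTop)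
    (hm : Tendsto m l atTop) :
    Tendsto (fun i => fQuantileStd α (k i) (m i)) l (𝓝 (upperQuantile (gaussianReal 0 1) α)) := by
  set z := upperQuantile (gaussianReal 0 1) α with hz
  have hzα : stdNormalCDF (-z) = α := stdNormalCDF_neg_upperQuantile h0 h1
  have key : ∀ y : ℝ, Tendsto (fun i => ((chiSq (k i)).prod (chiSq (m i))).real
      {w | y * (w.2 / m i) < chiDiff (k i) (m i) w}) l (𝓝 (stdNormalCDF (-y))) := by
    intro y
    have h2 := tendsto_measureReal_add_const (l := l) (μ := fun i => (chiSq (k i)).prod (chiSq (m i)))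
      (Z := fun i => chiDiff (k i) (m i)) (Y := fun i w => - y * (w.2 / m i - 1))
      (G := fun x => stdNormalCDF (-x)) (c := 0) (continuous_stdNormalCDF.comp continuous_neg)
      (fun x => tendsto_chiDiff hk hm x) ?_ y
    · simp only [sub_zero] at h2
      refine h2.congr fun i => ?_
      congr 1
      ext w
      simp only [Set.mem_ofPred_eq]
      constructor <;> intro <;> linarith
    · intro ε hε
      have h3 := tendsto_chiSq_snd_ratio (l := l) (k := k) hm
        (show 0 < ε / (|y| + 1) by positivity)
      refine squeeze_zero (fun _ => measureReal_nonneg) (fun i => ?_) h3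
      refine measureReal_mono fun w hw => ?_
      simp only [Set.mem_ofPred_eq, sub_zero, abs_mul, abs_neg] at hw ⊢
      rw [div_le_iff₀ (by positivity)]
      nlinarith [abs_nonneg y, abs_nonneg (w.2 / m i - 1)]
  have hα : ∀ᶠ i in l, ((chiSq (k i)).prod (chiSq (m i))).real
      {w | fQuantileStd α (k i) (m i) * (w.2 / m i) < chiDiff (k i) (m i) w} = α := by
    filter_upwards [hk.eventually_ge_atTop 1, hm.eventually_ge_atTop 1] with i hki hmi
    refine Eq.trans (measureReal_congr ?_) (measureReal_fDist_quantile hki hmi h0 h1)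
    have hp : ∀ᵐ w ∂((chiSq (k i)).prod (chiSq (m i))), 0 < w.2 :=
      Measure.quasiMeasurePreserving_snd.ae (chiSq_ae_pos hmi)
    filter_upwards [hp] with w hw
    have := fStat_gt_iff hki hmi (upperQuantile (fDist (k i) (m i)) α) (x := w.1) (d := 0) hw
    simp only [add_zero, zero_div] at this
    exact propext this.symm
  have hpos : ∀ᶠ i in l, ∀ᵐ w ∂((chiSq (k i)).prod (chiSq (m i))), 0 < w.2 := by
    filter_upwards [hm.eventually_ge_atTop 1] with i hmi
    exact Measure.quasiMeasurePreserving_snd.ae (chiSq_ae_pos hmi)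
  rw [Metric.tendsto_nhds]
  intro ε hε
  have hlo : stdNormalCDF (-(z + ε)) < α := by
    rw [← hzα]; exact strictMono_stdNormalCDF (by linarith)
  have hhi : α < stdNormalCDF (-(z - ε)) := by
    conv_lhs => rw [← hzα]
    exact strictMono_stdNormalCDF (by linarith)
  filter_upwards [hα, hpos, (key (z + ε)).eventually (gt_mem_nhds hlo),
    (key (z - ε)).eventually (lt_mem_nhds hhi)] with i a1 a2 a3 a4
  rw [Real.dist_eq, abs_lt]
  have mono : ∀ y y' : ℝ, y ≤ y' → ((chiSq (k i)).prod (chiSq (m i))).real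
      {w | y' * (w.2 / m i) < chiDiff (k i) (m i) w} ≤ ((chiSq (k i)).prod (chiSq (m i))).real
      {w | y * (w.2 / m i) < chiDiff (k i) (m i) w} := by
    intro y y' hy
    refine ENNReal.toReal_mono (measure_ne_top _ _) (measure_mono_ae ?_)
    filter_upwards [a2] with w hw hin
    have hin' : y' * (w.2 / m i) < chiDiff (k i) (m i) w := hin
    change y * (w.2 / m i) < chiDiff (k i) (m i) w
    refine lt_of_le_of_lt ?_ hin'
    gcongr
  constructor
  · by_contra hc
    have := mono _ _ (show fQuantileStd α (k i) (m i) ≤ z - ε by linarith)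
    linarith
  · by_contra hc
    have := mono _ _ (show z + ε ≤ fQuantileStd α (k i) (m i) by linarith)
    linarith

lemma tendsto_chiDiff_model
    (hM : ∀ᶠ i in l, IsFModel (μ i) (k i) (m i) (θ i) (Q₁ i) (Q₂ i) (C i) (N i))
    (hk : Tendsto k l atTop) (hm : Tendsto m l atTop) (x : ℝ) :
    Tendsto (fun i => (μ i).real {ω | x < chiDiff (k i) (m i) (Q₁ i ω, Q₂ i ω)}) l
      (𝓝 (stdNormalCDF (-x))) := by
  refine (tendsto_chiDiff hk hm x).congr' ?_
  filter_upwards [hM] with i hMi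
  exact (hMi.law.measureReal_eq (p := fun w => x < chiDiff (k i) (m i) w)
    (measurableSet_lt measurable_const (measurable_chiDiff _ _))).symm

/-- The deviation of the standardized noncentral part from the shift, relative to the shift. -/
lemma tendsto_deviation [∀ i, IsProbabilityMeasure (μ i)] (h0 : 0 < α) (h1 : α < 1)
    (hM : ∀ᶠ i in l, IsFModel (μ i) (k i) (m i) (θ i) (Q₁ i) (Q₂ i) (C i) (N i))
    (hk : Tendsto k l atTop) (hm : Tendsto m l atTop) (hθ : ∀ᶠ i in l, 0 ≤ θ i ∧ θ i ≤ θ₀ i)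
    (hρ : ∀ ε, 0 < ε → ∀ᶠ i in l, (1 - ε) * θ₀ i ≤ θ i) {ε : ℝ} (hε : 0 < ε) :
    Tendsto (fun i => (μ i).real {ω | ε * (1 + ((k i : ℝ) + m i) * θ₀ i / fScale (k i) (m i)) ≤
      |((2 * C i ω + N i ω) / fScale (k i) (m i) - (fQuantileStd α (k i) (m i) * (Q₂ i ω / m i) -
        upperQuantile (gaussianReal 0 1) α)) - ((k i : ℝ) + m i) * θ₀ i / fScale (k i) (m i)|}) l
      (𝓝 0) := by
  set z := upperQuantile (gaussianReal 0 1) α with hz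
  have hk' : Tendsto (fun i => (k i : ℝ)) l atTop := tendsto_natCast_atTop_atTop.comp hk
  have hs : Tendsto (fun i => fScale (k i) (m i)) l atTop := by
    refine tendsto_atTop_mono' l ?_ (Real.tendsto_sqrt_atTop.comp hk')
    filter_upwards [hk.eventually_ge_atTop 1] with i hi
    exact Real.sqrt_le_iff.2 ⟨(fScale_pos hi _).le, le_fScale_sq hi _⟩
  have hkm : Tendsto (fun i => (k i : ℝ) + m i) l atTop :=
    tendsto_atTop_mono (fun i => by have : (0 : ℝ) ≤ m i := by positivity
                                    linarith) hk'
  set η := ε / 4 / (|z| + ε) with hη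
  have hη0 : 0 < η := by positivity
  have hb : Tendsto (fun i => (64 / (ε / 2) ^ 2 * (1 / fScale (k i) (m i)) +
      32 / (ε / 2) ^ 2 * (1 / ((k i : ℝ) + m i))) + ((chiSq (k i)).prod (chiSq (m i))).real
        {w | η ≤ |w.2 / m i - 1|}) l (𝓝 0) := by
    have := (((hs.const_div_atTop 1).const_mul (64 / (ε / 2) ^ 2)).add
      ((hkm.const_div_atTop 1).const_mul (32 / (ε / 2) ^ 2))).add
      (tendsto_chiSq_snd_ratio (l := l) (k := k) hm hη0)
    simpa using this
  refine squeeze_zero' (Eventually.of_forall fun _ => measureReal_nonneg) ?_ hb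
  filter_upwards [hM, hk.eventually_ge_atTop 1, hθ, hρ (ε / 2 / 4) (by positivity),
    Metric.tendsto_nhds.1 (tendsto_fQuantileStd h0 h1 hk hm) (ε / 4) (by positivity)]
    with i hMi hki hθi hρi hqi
  rw [Real.dist_eq, ← hz] at hqi
  set Δ := ((k i : ℝ) + m i) * θ₀ i / fScale (k i) (m i) with hΔ
  have hΔ0 : 0 ≤ Δ := by
    have := fScale_pos hki (m i)
    have := hθi.1.trans hθi.2
    positivity
  set q := fQuantileStd α (k i) (m i)
  have hlaw : ((chiSq (k i)).prod (chiSq (m i))).real {w | η ≤ |w.2 / m i - 1|} =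
      (μ i).real {ω | η ≤ |Q₂ i ω / m i - 1|} :=
    (hMi.law.measureReal_eq (p := fun w => η ≤ |w.2 / m i - 1|)
      (measurableSet_le (by fun_prop) (by fun_prop))).symm
  rw [hlaw]
  refine le_trans (measureReal_mono ?_) ((measureReal_union_le _ _).trans (add_le_add
    (hMi.measureReal_shift_le hki hθi.1 hθi.2 (half_pos hε) hρi hΔ) le_rfl))
  intro ω hω
  by_contra hc
  simp only [Set.mem_union, Set.mem_ofPred_eq, not_or, not_le] at hc hω
  obtain ⟨c1, c2⟩ := hc
  have hq : |q| ≤ |z| + ε := by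
    have := abs_sub_abs_le_abs_sub q z
    linarith
  have c3 : |q * (Q₂ i ω / m i) - z| ≤ ε / 2 := by
    have e : q * (Q₂ i ω / m i) - z = q * (Q₂ i ω / m i - 1) + (q - z) := by ring
    rw [e]
    refine (abs_add_le _ _).trans ?_
    rw [abs_mul]
    have : |q| * |Q₂ i ω / m i - 1| ≤ (|z| + ε) * η := by gcongr
    have e2 : (|z| + ε) * η = ε / 4 := by rw [hη]; field_simp
    linarith
  have c4 := abs_sub ((2 * C i ω + N i ω) / fScale (k i) (m i) - Δ) (q * (Q₂ i ω / m i) - z)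
  have e3 : (2 * C i ω + N i ω) / fScale (k i) (m i) - (q * (Q₂ i ω / m i) - z) - Δ =
    ((2 * C i ω + N i ω) / fScale (k i) (m i) - Δ) - (q * (Q₂ i ω / m i) - z) := by ring
  rw [e3] at hω
  nlinarith

lemma fPower_eq {i : ι} (hMi : IsFModel (μ i) (k i) (m i) (θ i) (Q₁ i) (Q₂ i) (C i) (N i))
    (hk : 1 ≤ k i) (hm : 1 ≤ m i) (z : ℝ) :
    fPower (μ i) (k i) (m i) α (Q₁ i) (Q₂ i) (C i) (N i) = (μ i).real
      {ω | z < chiDiff (k i) (m i) (Q₁ i ω, Q₂ i ω) + ((2 * C i ω + N i ω) / fScale (k i) (m i) -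
        (fQuantileStd α (k i) (m i) * (Q₂ i ω / m i) - z))} := by
  have hpos : ∀ᵐ ω ∂μ i, 0 < Q₂ i ω := by
    have h2 : ∀ᵐ w ∂((chiSq (k i)).prod (chiSq (m i))), 0 < w.2 :=
      Measure.quasiMeasurePreserving_snd.ae (chiSq_ae_pos hm)
    rw [← hMi.law.map_eq] at h2
    exact ae_of_ae_map hMi.law.aemeasurable h2
  refine measureReal_congr ?_
  filter_upwards [hpos] with ω hω
  refine propext ?_
  change upperQuantile (fDist (k i) (m i)) α < ((Q₁ i ω + 2 * C i ω + N i ω) / k i) /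
    (Q₂ i ω / m i) ↔ z < _
  rw [add_assoc, fStat_gt_iff hk hm _ hω, fQuantileStd]
  constructor <;> intro <;> linarith

/-- If both degrees of freedom tend to infinity, the power is asymptotically normal. -/
lemma tendsto_fPower_sub_of_atTop [∀ i, IsProbabilityMeasure (μ i)] (h0 : 0 < α) (h1 : α < 1) {U : Ultrafilter ι}
    (hM : ∀ᶠ i in U, IsFModel (μ i) (k i) (m i) (θ i) (Q₁ i) (Q₂ i) (C i) (N i))
    (hk : Tendsto k U atTop) (hm : Tendsto m U atTop) (hθ : ∀ᶠ i in U, 0 ≤ θ i ∧ θ i ≤ θ₀ i)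
    (hρ : ∀ ε, 0 < ε → ∀ᶠ i in U, (1 - ε) * θ₀ i ≤ θ i) :
    Tendsto (fun i => fPower (μ i) (k i) (m i) α (Q₁ i) (Q₂ i) (C i) (N i) -
      stdNormalCDF (-upperQuantile (gaussianReal 0 1) α +
        ((k i : ℝ) + m i) * θ₀ i / fScale (k i) (m i))) U (𝓝 0) := by
  set z := upperQuantile (gaussianReal 0 1) α with hz
  set Δ : ι → ℝ := fun i => ((k i : ℝ) + m i) * θ₀ i / fScale (k i) (m i) with hΔ
  have hΔ0 : ∀ᶠ i in U, 0 ≤ Δ i := by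
    filter_upwards [hk.eventually_ge_atTop 1, hθ] with i hki hθi
    have := fScale_pos hki (m i)
    have := hθi.1.trans hθi.2
    simp only [hΔ]
    positivity
  have hdev := fun (ε : ℝ) (hε : 0 < ε) => tendsto_deviation (l := (U : Filter ι)) h0 h1 hM hk hm hθ hρ hε
  have hZ := fun x => tendsto_chiDiff_model (l := (U : Filter ι)) hM hk hm x
  have heq : ∀ᶠ i in (U : Filter ι), (μ i).real {ω | z < chiDiff (k i) (m i) (Q₁ i ω, Q₂ i ω) +
      ((2 * C i ω + N i ω) / fScale (k i) (m i) -
        (fQuantileStd α (k i) (m i) * (Q₂ i ω / m i) - z))} =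
      fPower (μ i) (k i) (m i) α (Q₁ i) (Q₂ i) (C i) (N i) := by
    filter_upwards [hM, hk.eventually_ge_atTop 1, hm.eventually_ge_atTop 1] with i a1 a2 a3
    exact (fPower_eq a1 a2 a3 z).symm
  have hGtop : Tendsto stdNormalCDF atTop (𝓝 1) := tendsto_cdf_atTop _
  by_cases hbdd : ∃ B : ℝ, ∀ᶠ i in U, Δ i ≤ B
  · obtain ⟨B, hB⟩ := hbdd
    obtain ⟨c, -, hc⟩ := (isCompact_Icc (a := (0 : ℝ)) (b := B)).ultrafilter_le_nhds (U.map Δ)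
      (by rw [le_principal_iff]; exact hΔ0.and hB)
    have hc' : Tendsto Δ U (𝓝 c) := hc
    have h2 := tendsto_measureReal_add_const (c := c) (G := fun x => stdNormalCDF (-x))
      (continuous_stdNormalCDF.comp continuous_neg) hZ
      (Y := fun i ω => (2 * C i ω + N i ω) / fScale (k i) (m i) -
        (fQuantileStd α (k i) (m i) * (Q₂ i ω / m i) - z)) (fun ε hε => ?_) z
    · have h3 := h2.congr' heq
      have h4 : Tendsto (fun i => stdNormalCDF (-z + Δ i)) U (𝓝 (stdNormalCDF (-z + c))) :=
        (continuous_stdNormalCDF.tendsto _).comp (tendsto_const_nhds.add hc')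
      have e : -(z - c) = -z + c := by ring
      rw [e] at h3
      simpa using h3.sub h4
    · have hB0 : 0 < |B| + 1 := by positivity
      refine squeeze_zero' (Eventually.of_forall fun _ => measureReal_nonneg) ?_
        (hdev (ε / 2 / (|B| + 1)) (by positivity))
      filter_upwards [hΔ0, hB, Metric.tendsto_nhds.1 hc' (ε / 2) (by positivity)] with i b1 b2 b3
      refine measureReal_mono fun ω hω => ?_
      simp only [Set.mem_ofPred_eq] at hω ⊢
      change ε / 2 / (|B| + 1) * (1 + Δ i) ≤ |_ - Δ i|
      rw [Real.dist_eq] at b3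
      have b4 : ε / 2 / (|B| + 1) * (1 + Δ i) ≤ ε / 2 := by
        calc _ ≤ ε / 2 / (|B| + 1) * (|B| + 1) := by
              refine mul_le_mul_of_nonneg_left ?_ (by positivity)
              linarith [le_abs_self B]
          _ = ε / 2 := by field_simp
      have b5 := abs_sub_le ((2 * C i ω + N i ω) / fScale (k i) (m i) -
        (fQuantileStd α (k i) (m i) * (Q₂ i ω / m i) - z)) (Δ i) c
      linarith
  · have htop : Tendsto Δ U atTop := by
      rw [tendsto_atTop]
      intro B
      rw [not_exists] at hbdd
      have := Ultrafilter.eventually_not.2 (hbdd B)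
      filter_upwards [this] with i hi using (not_le.1 hi).le
    have h2 := tendsto_measureReal_add_atTop (G := fun x => stdNormalCDF (-x))
      (hGtop.comp tendsto_neg_atBot_atTop) hZ
      (Y := fun i ω => (2 * C i ω + N i ω) / fScale (k i) (m i) -
        (fQuantileStd α (k i) (m i) * (Q₂ i ω / m i) - z)) (fun B => ?_) z
    · have h3 := h2.congr' heq
      have h4 : Tendsto (fun i => stdNormalCDF (-z + Δ i)) U (𝓝 1) :=
        hGtop.comp (tendsto_atTop_add_const_left _ _ htop)
      simpa using h3.sub h4
    · refine squeeze_zero' (Eventually.of_forall fun _ => measureReal_nonneg) ?_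
        (hdev (1 / 2) (by positivity))
      filter_upwards [hΔ0, htop.eventually_ge_atTop (2 * |B| + 1)] with i b1 b2
      refine measureReal_mono fun ω hω => ?_
      simp only [Set.mem_ofPred_eq] at hω ⊢
      change 1 / 2 * (1 + Δ i) ≤ |_ - Δ i|
      refine le_trans ?_ (neg_le_abs _)
      linarith [le_abs_self B]

/-- The power of a noncentral `F` test is asymptotically that of a normal shift test. -/
theorem tendsto_fPower_sub [∀ i, IsProbabilityMeasure (μ i)] (h0 : 0 < α) (h1 : α < 1)
    (hM : ∀ᶠ i in l, IsFModel (μ i) (k i) (m i) (θ i) (Q₁ i) (Q₂ i) (C i) (N i))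
    (hk : ∀ᶠ i in l, 1 ≤ k i) (hm : ∀ᶠ i in l, 1 ≤ m i) (hθ : ∀ᶠ i in l, 0 ≤ θ i ∧ θ i ≤ θ₀ i)
    (hρ : ∀ ε, 0 < ε → ∀ᶠ i in l, (1 - ε) * θ₀ i ≤ θ i)
    (hx : Tendsto (fun i => ((k i : ℝ) + m i) * θ₀ i / k i) l (𝓝 0)) :
    Tendsto (fun i => fPower (μ i) (k i) (m i) α (Q₁ i) (Q₂ i) (C i) (N i) -
      stdNormalCDF (-upperQuantile (gaussianReal 0 1) α +
        ((k i : ℝ) + m i) * θ₀ i / fScale (k i) (m i))) l (𝓝 0) := by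
  rw [tendsto_iff_ultrafilter]
  intro U hU
  by_cases hK : ∃ K : ℕ, (∀ᶠ i in U, k i ≤ K) ∨ ∀ᶠ i in U, m i ≤ K
  · obtain ⟨K, hK⟩ := hK
    have h2 := tendsto_fPower_of_bounded (l := (U : Filter ι)) h0 h1 (hU hM) (hU hk) (hU hm)
      (hU hθ) (hx.mono_left hU) hK
    have hΔ : Tendsto (fun i => ((k i : ℝ) + m i) * θ₀ i / fScale (k i) (m i)) U (𝓝 0) := by
      have hb := (hx.mono_left hU).mul_const (√K + 1)
      rw [zero_mul] at hb
      refine squeeze_zero' ?_ ?_ hb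
      · filter_upwards [hU hk, hU hθ] with i hki hθi
        have := fScale_pos hki (m i)
        have := hθi.1.trans hθi.2
        positivity
      · have hmin : ∀ᶠ i in U, k i ≤ K ∨ m i ≤ K := by
          rcases hK with h | h
          · exact h.mono fun _ => Or.inl
          · exact h.mono fun _ => Or.inr
        filter_upwards [hmin, hU hk, hU hm, hU hθ] with i hi hki hmi hθi
        have hk0 : (0 : ℝ) < k i := by positivity
        have hm0 : (0 : ℝ) < m i := by positivity
        have hK0 : (0 : ℝ) < K := by
          rcases hi with h | h
          · exact_mod_cast Nat.lt_of_lt_of_le hki h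
          · exact_mod_cast Nat.lt_of_lt_of_le hmi h
        have := hθi.1.trans hθi.2
        have hV : 1 / √(K : ℝ) ≤ √(2 / (k i : ℝ) + 2 / m i) := by
          rw [one_div, ← Real.sqrt_inv]
          refine Real.sqrt_le_sqrt ?_
          have a1 : 0 ≤ 2 / (k i : ℝ) := by positivity
          have a2 : 0 ≤ 2 / (m i : ℝ) := by positivity
          rcases hi with h | h
          · have : (K : ℝ)⁻¹ ≤ (k i : ℝ)⁻¹ := by gcongr
            have e : 2 / (k i : ℝ) = 2 * (k i : ℝ)⁻¹ := by ring
            have : 0 ≤ (k i : ℝ)⁻¹ := by positivity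
            linarith
          · have : (K : ℝ)⁻¹ ≤ (m i : ℝ)⁻¹ := by gcongr
            have e : 2 / (m i : ℝ) = 2 * (m i : ℝ)⁻¹ := by ring
            have : 0 ≤ (m i : ℝ)⁻¹ := by positivity
            linarith
        have hV0 : 0 < √(2 / (k i : ℝ) + 2 / m i) := by positivity
        rw [fScale, ← div_div]
        rw [div_le_iff₀ hV0, mul_assoc]
        refine le_mul_of_one_le_right (by positivity) ?_
        have hK1 : 0 < √(K : ℝ) := by positivity
        rw [div_le_iff₀ hK1] at hV
        nlinarith
    have h4 := ((continuous_stdNormalCDF.tendsto _).comp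
      (hΔ.const_add (-upperQuantile (gaussianReal 0 1) α)))
    rw [add_zero, stdNormalCDF_neg_upperQuantile h0 h1] at h4
    simpa using h2.sub h4
  · have htop : ∀ f : ι → ℕ, (∀ K : ℕ, ¬ ∀ᶠ i in U, f i ≤ K) → Tendsto f U atTop := by
      intro f hf
      rw [tendsto_atTop]
      intro B
      filter_upwards [Ultrafilter.eventually_not.2 (hf B)] with i hi using (not_le.1 hi).le
    push Not at hK
    exact tendsto_fPower_sub_of_atTop h0 h1 (hU hM)
      (htop _ fun K h => by
        obtain ⟨i, h1, h2⟩ := (h.and (hK K).1).exists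
        omega)
      (htop _ fun K h => by
        obtain ⟨i, h1, h2⟩ := (h.and (hK K).2).exists
        omega) (hU hθ) fun ε hε => hU (hρ ε hε)

end Core


section Projections

variable {n κ : Type*} [Fintype n] [DecidableEq n] [Fintype κ] [DecidableEq κ]

/-- The orthogonal projection onto the column space of a matrix with full column rank. -/
def hat (W : Matrix n κ ℝ) : Matrix n n ℝ := W * (Wᵀ * W)⁻¹ * Wᵀ

omit [DecidableEq n] [Fintype n] in
lemma hat_transpose [Fintype n] (W : Matrix n κ ℝ) : (hat W)ᵀ = hat W := by
  rw [hat, transpose_mul, transpose_mul, transpose_transpose, transpose_nonsing_inv,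
    transpose_mul, transpose_transpose, Matrix.mul_assoc]

omit [DecidableEq n] in
lemma hat_mul {W : Matrix n κ ℝ} (hW : IsUnit (Wᵀ * W).det) : hat W * W = W := by
  rw [hat, Matrix.mul_assoc, Matrix.mul_assoc, Matrix.nonsing_inv_mul _ hW, Matrix.mul_one]

omit [DecidableEq n] in
lemma hat_mul_hat {W : Matrix n κ ℝ} (hW : IsUnit (Wᵀ * W).det) : hat W * hat W = hat W := by
  conv_lhs => rw [hat.eq_1 W, ← hat.eq_1 W]
  nth_rw 2 [hat]
  rw [← Matrix.mul_assoc, ← Matrix.mul_assoc, hat_mul hW]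
  rfl

omit [DecidableEq n] in
lemma trace_hat {W : Matrix n κ ℝ} (hW : IsUnit (Wᵀ * W).det) :
    (hat W).trace = Fintype.card κ := by
  rw [hat, Matrix.mul_assoc, Matrix.trace_mul_comm, Matrix.mul_assoc,
    Matrix.nonsing_inv_mul _ hW, Matrix.trace_one]

omit [DecidableEq n] [DecidableEq κ] [Fintype n] in
lemma measurable_mulVec (A : Matrix n κ ℝ) : Measurable fun g : κ → ℝ => A *ᵥ g := by
  refine measurable_pi_lambda _ fun i => ?_
  simp only [Matrix.mulVec, dotProduct]
  fun_prop

lemma gaussPi_map_orthogonal {O : Matrix n n ℝ} (hO : O ∈ Matrix.orthogonalGroup n ℝ) :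
    (gaussPi n).map (fun g => O *ᵥ g) = gaussPi n := by
  have hOO : Oᵀ * O = 1 := by
    have := (Matrix.mem_orthogonalGroup_iff' n ℝ).1 hO
    simpa [Matrix.star_eq_conjTranspose] using this
  let L : EuclideanSpace ℝ n →ₗᵢ[ℝ] EuclideanSpace ℝ n :=
    { toLinearMap := Matrix.toEuclideanLin O
      norm_map' := fun x => by
        rw [EuclideanSpace.norm_eq, EuclideanSpace.norm_eq]
        congr 1
        have h1 : ∀ y : EuclideanSpace ℝ n, ∑ i, ‖y i‖ ^ 2 = y.ofLp ⬝ᵥ y.ofLp := by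
          intro y; simp [dotProduct, sq]
        rw [h1, h1]
        change (O *ᵥ x.ofLp) ⬝ᵥ (O *ᵥ x.ofLp) = _
        rw [Matrix.dotProduct_mulVec, Matrix.vecMul_mulVec, hOO, Matrix.vecMul_one] }
  let e := L.toLinearIsometryEquiv rfl
  have h := stdGaussian_map e
  rw [← map_pi_eq_stdGaussian, Measure.map_map (by fun_prop) (by fun_prop)] at h
  have h2 := congrArg (Measure.map (WithLp.ofLp (p := 2))) h
  rw [Measure.map_map (by fun_prop) (by fun_prop), Measure.map_map (by fun_prop) (by fun_prop)] at h2
  have e2 : (WithLp.ofLp ∘ WithLp.toLp 2 : (n → ℝ) → (n → ℝ)) = id := by ext; rfl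
  rw [e2, Measure.map_id] at h2
  exact h2

/-- The squared lengths of the components of a standard normal vector along an orthogonal
projection of rank `r` and its complement are independent chi-square variables. -/
lemma gaussPi_map_projection {H : Matrix n n ℝ} (hH : Hᵀ = H) (hHH : H * H = H) {r d : ℕ}
    (hr : H.trace = r) (hd : Fintype.card n = r + d) :
    (gaussPi n).map (fun g => (g ⬝ᵥ (H *ᵥ g), (g - H *ᵥ g) ⬝ᵥ (g - H *ᵥ g))) =
      (chiSq r).prod (chiSq d) := by
  have hherm : H.IsHermitian := by
    rw [Matrix.IsHermitian, Matrix.conjTranspose_eq_transpose_of_trivial, hH]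
  set lam := hherm.eigenvalues with hlam
  set U : Matrix n n ℝ := hherm.eigenvectorUnitary.1 with hU
  have hUU : Uᵀ * U = 1 := by
    have := (Matrix.mem_orthogonalGroup_iff' n ℝ).1 hherm.eigenvectorUnitary.2
    simpa [Matrix.star_eq_conjTranspose] using this
  have hUU' : U * Uᵀ = 1 := mul_eq_one_comm.1 hUU
  have hspec : H = U * Matrix.diagonal lam * Uᵀ := by
    have := hherm.spectral_theorem
    simpa [Unitary.conjStarAlgAut_apply, Matrix.star_eq_conjTranspose] using this
  have hD : Matrix.diagonal lam = Uᵀ * H * U := by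
    rw [hspec]
    calc Matrix.diagonal lam = (Uᵀ * U) * Matrix.diagonal lam * (Uᵀ * U) := by
          rw [hUU, Matrix.one_mul, Matrix.mul_one]
      _ = _ := by simp only [Matrix.mul_assoc]
  have hlam2 : ∀ i, lam i = 0 ∨ lam i = 1 := by
    have h1 : Matrix.diagonal lam * Matrix.diagonal lam = Matrix.diagonal lam := by
      conv_rhs => rw [hD, ← hHH]
      rw [hD]
      calc Uᵀ * H * U * (Uᵀ * H * U) = Uᵀ * H * (U * Uᵀ) * (H * U) := by
            simp only [Matrix.mul_assoc]
        _ = _ := by rw [hUU', Matrix.mul_one]; simp only [Matrix.mul_assoc]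
    intro i
    have h2 := congrFun (congrFun h1 i) i
    simp only [Matrix.diagonal_mul_diagonal, Matrix.diagonal_apply_eq] at h2
    have : lam i * (lam i - 1) = 0 := by linarith
    rcases mul_eq_zero.1 this with h | h
    · left; exact h
    · right; linarith
  have hform : ∀ g : n → ℝ, g ⬝ᵥ (H *ᵥ g) = ∑ i, lam i * (Uᵀ *ᵥ g) i ^ 2 := by
    intro g
    rw [hspec, ← Matrix.mulVec_mulVec, ← Matrix.mulVec_mulVec, Matrix.dotProduct_mulVec,
      ← Matrix.mulVec_transpose, dotProduct]
    refine Finset.sum_congr rfl fun i _ => ?_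
    rw [Matrix.mulVec_diagonal]; ring
  have hnorm : ∀ g : n → ℝ, g ⬝ᵥ g = ∑ i, (Uᵀ *ᵥ g) i ^ 2 := by
    intro g
    have : g ⬝ᵥ g = (Uᵀ *ᵥ g) ⬝ᵥ (Uᵀ *ᵥ g) := by
      rw [Matrix.dotProduct_mulVec, Matrix.vecMul_mulVec, Matrix.transpose_transpose, hUU',
        Matrix.vecMul_one]
    rw [this, dotProduct]
    exact Finset.sum_congr rfl fun i _ => by ring
  have hres : ∀ g : n → ℝ, (g - H *ᵥ g) ⬝ᵥ (g - H *ᵥ g) = g ⬝ᵥ g - g ⬝ᵥ (H *ᵥ g) := by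
    intro g
    have h3 : (H *ᵥ g) ⬝ᵥ (H *ᵥ g) = g ⬝ᵥ (H *ᵥ g) := by
      rw [Matrix.dotProduct_mulVec, Matrix.vecMul_mulVec, hH, hHH, ← Matrix.dotProduct_mulVec]
    rw [sub_dotProduct, dotProduct_sub, dotProduct_sub, h3, dotProduct_comm (H *ᵥ g) g]
    ring
  have hUorth : Uᵀ ∈ Matrix.orthogonalGroup n ℝ := by
    rw [Matrix.mem_orthogonalGroup_iff']
    simpa [Matrix.star_eq_conjTranspose] using hUU'
  let p : n → Prop := fun i => lam i = 1
  have hsumlam : ∑ i, lam i = r := by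
    have h4 : (Matrix.diagonal lam).trace = r := by
      rw [hD, Matrix.trace_mul_comm, ← Matrix.mul_assoc, hUU', Matrix.one_mul, hr]
    simpa [Matrix.trace_diagonal] using h4
  classical
  have hcard : Fintype.card {i // p i} = r := by
    have h5 : ∑ i, lam i = ∑ i, if p i then (1 : ℝ) else 0 := by
      refine Finset.sum_congr rfl fun i _ => ?_
      rcases hlam2 i with h | h <;> simp [p, h]
    rw [h5, Finset.sum_boole] at hsumlam
    rw [Fintype.card_subtype]
    exact_mod_cast hsumlam
  have hcard' : Fintype.card {i // ¬ p i} = d := by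
    rw [Fintype.card_subtype_compl, hcard, hd]; omega
  have hfun : (fun g : n → ℝ => (g ⬝ᵥ (H *ᵥ g), (g - H *ᵥ g) ⬝ᵥ (g - H *ᵥ g))) =
      (Prod.map (fun w : {i // p i} → ℝ => ∑ i, w i ^ 2)
        (fun w : {i // ¬ p i} → ℝ => ∑ i, w i ^ 2)) ∘
      (MeasurableEquiv.piEquivPiSubtypeProd (fun _ : n => ℝ) p) ∘ fun g => Uᵀ *ᵥ g := by
    ext g
    · simp only [hform, Function.comp_apply, Prod.map_fst]
      rw [← Fintype.sum_subtype_add_sum_subtype p]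
      have h6 : ∑ i : {i // ¬ p i}, lam i * (Uᵀ *ᵥ g) i ^ 2 = 0 :=
        Finset.sum_eq_zero fun i _ => by
          rcases hlam2 i with h | h
          · simp [h]
          · exact absurd h i.2
      rw [h6, add_zero]
      refine Finset.sum_congr rfl fun i _ => ?_
      have : lam i = 1 := i.2
      rw [this, one_mul]
      rfl
    · simp only [Function.comp_apply, Prod.map_snd]
      rw [hres, hform, hnorm, ← Finset.sum_sub_distrib, ← Fintype.sum_subtype_add_sum_subtype p]
      have h6 : ∑ i : {i // p i}, ((Uᵀ *ᵥ g) i ^ 2 - lam i * (Uᵀ *ᵥ g) i ^ 2) = 0 :=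
        Finset.sum_eq_zero fun i _ => by
          have : lam i = 1 := i.2
          rw [this]; ring
      rw [h6, zero_add]
      refine Finset.sum_congr rfl fun i _ => ?_
      have : lam i = 0 := (hlam2 i).resolve_right i.2
      rw [this, zero_mul, sub_zero]
      rfl
  have hlin : Measurable fun g : n → ℝ => Uᵀ *ᵥ g := measurable_mulVec _
  have hmp := measurePreserving_piEquivPiSubtypeProd (fun _ : n => gaussianReal 0 1) p
  rw [hfun, ← Measure.map_map (by fun_prop) (hmp.measurable.comp hlin),
    ← Measure.map_map hmp.measurable hlin, gaussPi_map_orthogonal hUorth, gaussPi, hmp.map_eq,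
    ← Measure.map_prod_map _ _ (by fun_prop) (by fun_prop), gaussPi_map_sum_sq hcard,
    gaussPi_map_sum_sq hcard']

lemma gaussPi_map_hat {W : Matrix n κ ℝ} (hW : IsUnit (Wᵀ * W).det) {d : ℕ}
    (hd : Fintype.card n = Fintype.card κ + d) :
    (gaussPi n).map (fun g => (g ⬝ᵥ (hat W *ᵥ g), (g - hat W *ᵥ g) ⬝ᵥ (g - hat W *ᵥ g))) =
      (chiSq (Fintype.card κ)).prod (chiSq d) :=
  gaussPi_map_projection (hat_transpose W) (hat_mul_hat hW) (trace_hat hW) hd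

end Projections

section Measurability

variable {Ω : Type*} [MeasurableSpace Ω] {n κ ρ : Type*} [Fintype n] [DecidableEq n]
  [Fintype κ] [DecidableEq κ]

/-- Entrywise measurability of a random matrix. -/
def EntryMeasurable {n κ : Type*} (W : Ω → Matrix n κ ℝ) : Prop := ∀ i j, Measurable fun ω => W ω i j

lemma EntryMeasurable.transpose {n κ : Type*} {W : Ω → Matrix n κ ℝ} (h : EntryMeasurable W) :
    EntryMeasurable fun ω => (W ω)ᵀ := fun i j => h j i

lemma EntryMeasurable.mul {n κ ρ : Type*} [Fintype κ] {W : Ω → Matrix n κ ℝ} {V : Ω → Matrix κ ρ ℝ}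
    (h : EntryMeasurable W) (h' : EntryMeasurable V) : EntryMeasurable fun ω => W ω * V ω := by
  intro i j
  simp only [Matrix.mul_apply]
  exact Finset.measurable_sum _ fun l _ => (h i l).mul (h' l j)

lemma EntryMeasurable.det {W : Ω → Matrix n n ℝ} (h : EntryMeasurable W) :
    Measurable fun ω => (W ω).det := by
  simp only [Matrix.det_apply]
  exact Finset.measurable_sum _ fun σ _ =>
    (Finset.measurable_prod _ fun i _ => h _ _).const_smul _

lemma EntryMeasurable.inv {W : Ω → Matrix n n ℝ} (h : EntryMeasurable W) :
    EntryMeasurable fun ω => (W ω)⁻¹ := by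
  intro i j
  simp only [Matrix.inv_def, Matrix.smul_apply, smul_eq_mul, Ring.inverse_eq_inv']
  refine h.det.inv.mul ?_
  simp only [Matrix.adjugate_apply]
  refine EntryMeasurable.det fun a b => ?_
  by_cases hab : a = j
  · subst hab; simp
  · simpa [Matrix.updateRow_ne hab] using h a b

omit [DecidableEq n] in
lemma EntryMeasurable.hat {W : Ω → Matrix n κ ℝ} (h : EntryMeasurable W) :
    EntryMeasurable fun ω => hat (W ω) :=
  (h.mul (h.transpose.mul h).inv).mul h.transpose

lemma EntryMeasurable.mulVec {n κ : Type*} [Fintype κ] {W : Ω → Matrix n κ ℝ} {v : Ω → κ → ℝ}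
    (h : EntryMeasurable W) (hv : Measurable v) : Measurable fun ω => W ω *ᵥ v ω := by
  refine measurable_pi_lambda _ fun i => ?_
  simp only [Matrix.mulVec, dotProduct]
  exact Finset.measurable_sum _ fun l _ => (h i l).mul ((measurable_pi_apply l).comp hv)

lemma measurable_dotProduct {n : Type*} [Fintype n] {u v : Ω → n → ℝ} (hu : Measurable u)
    (hv : Measurable v) : Measurable fun ω => u ω ⬝ᵥ v ω := by
  simp only [dotProduct]
  exact Finset.measurable_sum _ fun l _ => ((measurable_pi_apply l).comp hu).mul
    ((measurable_pi_apply l).comp hv)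

end Measurability

section FullRank

variable {ι κ n ρ : Type*} [Fintype ι] [Fintype κ] [Fintype n] [Fintype ρ] [DecidableEq ρ]

/-- The Gram determinant of a linear image of a Gaussian matrix is almost surely nonzero unless it
vanishes identically. -/
lemma ae_isUnit_gram (L : (ι → κ → ℝ) →ₗ[ℝ] Matrix n ρ ℝ) {x₀ : ι → κ → ℝ}
    (hx₀ : IsUnit ((L x₀)ᵀ * L x₀).det) :
    ∀ᵐ x ∂(Measure.pi fun _ : ι => gaussPi κ), IsUnit ((L x)ᵀ * L x).det := by
  set f : (ι → κ → ℝ) → ℝ := fun x => ((L x)ᵀ * L x).det with hf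
  have hLm : EntryMeasurable fun x => L x := fun i j => by
    have : Continuous ((LinearMap.proj j ∘ₗ LinearMap.proj (R := ℝ) (φ := fun _ : n => ρ → ℝ) i) ∘ₗ L) :=
      LinearMap.continuous_of_finiteDimensional _
    exact this.measurable
  have hfm : Measurable f := (EntryMeasurable.mul (fun i j => hLm j i) hLm).det
  set A := {x | f x = 0} with hA
  have hAm : MeasurableSet A := hfm (measurableSet_singleton 0)
  have hline : ∀ v, Set.Finite {t : ℝ | f (x₀ + t • v) = 0} := by
    intro v
    let P : Matrix n ρ (Polynomial ℝ) := Matrix.of fun i j =>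
      Polynomial.C (L x₀ i j) + Polynomial.X * Polynomial.C (L v i j)
    let q : Polynomial ℝ := (Pᵀ * P).det
    have hq : ∀ t, q.eval t = f (x₀ + t • v) := by
      intro t
      have h1 : (Polynomial.evalRingHom t).mapMatrix (Pᵀ * P) =
          (L (x₀ + t • v))ᵀ * L (x₀ + t • v) := by
        ext i j
        simp [P, Matrix.mul_apply, Polynomial.eval_finsetSum, mul_comm t]
      change Polynomial.evalRingHom t (Pᵀ * P).det = _
      rw [RingHom.map_det, h1]
    have hq0 : q ≠ 0 := by
      intro h
      have := hq 0
      rw [h] at this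
      simp only [Polynomial.eval_zero, zero_smul, add_zero] at this
      exact hx₀.ne_zero this.symm
    refine (Polynomial.finite_setOfPred_isRoot hq0).subset fun t ht => ?_
    change q.eval t = 0
    rw [hq]; exact ht
  have hprod : (volume.prod volume : Measure (ℝ × (ι → κ → ℝ)))
      {z | f (x₀ + z.1 • z.2) = 0} = 0 := by
    have hms : MeasurableSet {z : ℝ × (ι → κ → ℝ) | f (x₀ + z.1 • z.2) = 0} :=
      (hfm.comp (by fun_prop)) (measurableSet_singleton 0)
    rw [Measure.prod_apply_symm hms]
    simp only [lintegral_eq_zero_iff (measurable_measure_prodMk_right hms)]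
    refine ae_of_all _ fun v => (hline v).measure_zero _
  have hms : MeasurableSet {z : ℝ × (ι → κ → ℝ) | f (x₀ + z.1 • z.2) = 0} :=
      (hfm.comp (by fun_prop)) (measurableSet_singleton 0)
  rw [Measure.measure_prod_null hms] at hprod
  have h0 : ∀ᵐ t : ℝ, t ≠ 0 := by rw [ae_iff]; simp
  obtain ⟨t, ht, ht0⟩ := (hprod.and h0).exists
  have hvol : (volume : Measure (ι → κ → ℝ)) A = 0 := by
    have h1 : (volume : Measure (ι → κ → ℝ)) ((fun v => t • v) ⁻¹' ((fun v => x₀ + v) ⁻¹' A)) = 0 := ht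
    rw [Measure.addHaar_preimage_smul _ ht0, measure_preimage_add] at h1
    rcases mul_eq_zero.1 h1 with h2 | h2
    · rw [ENNReal.ofReal_eq_zero] at h2
      have : 0 < |(t ^ Module.finrank ℝ (ι → κ → ℝ))⁻¹| := abs_pos.2 (inv_ne_zero (pow_ne_zero _ ht0))
      linarith
    · exact h2
  have hle : (Measure.pi fun _ : ι => gaussPi κ) ≤ volume := pi_mono fun _ => gaussPi_le_volume κ
  rw [ae_iff]
  simp only [isUnit_iff_ne_zero, not_not]
  exact le_antisymm ((hle A).trans hvol.le) (zero_le)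

end FullRank


section Rows

variable {p k : ℕ} {Sig : Matrix (Fin p) (Fin p) ℝ}

/-- The linear functional `x ↦ x ⬝ a` on a Euclidean space. -/
def dotCLM (a : Fin p → ℝ) : EuclideanSpace ℝ (Fin p) →L[ℝ] ℝ := innerSL ℝ (WithLp.toLp 2 a)

lemma dotCLM_apply (a : Fin p → ℝ) (x : EuclideanSpace ℝ (Fin p)) :
    dotCLM a x = x.ofLp ⬝ᵥ a := by
  simp [dotCLM, PiLp.inner_apply, dotProduct]

lemma covariance_dot (hSig : Sig.PosSemidef) (a b : Fin p → ℝ) :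
    cov[fun x : EuclideanSpace ℝ (Fin p) => x.ofLp ⬝ᵥ a, fun x => x.ofLp ⬝ᵥ b;
      multivariateGaussian 0 Sig] = a ⬝ᵥ (Sig *ᵥ b) := by
  have h := covarianceBilin_apply_eq_cov (μ := multivariateGaussian 0 Sig) IsGaussian.memLp_two_id
    (WithLp.toLp 2 a) (WithLp.toLp 2 b)
  rw [covarianceBilin_multivariateGaussian hSig] at h
  refine (Eq.trans ?_ h.symm).trans rfl
  have e : ∀ a : Fin p → ℝ, (fun x : EuclideanSpace ℝ (Fin p) => x.ofLp ⬝ᵥ a) =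
      fun x => inner ℝ (WithLp.toLp 2 a) x := fun a => by
    ext x; exact (dotCLM_apply a x).symm
  rw [e, e]

lemma map_dot_multivariateGaussian (hSig : Sig.PosSemidef) (a : Fin p → ℝ) :
    (multivariateGaussian 0 Sig).map (fun x => x.ofLp ⬝ᵥ a) =
      gaussianReal 0 (a ⬝ᵥ (Sig *ᵥ a)).toNNReal := by
  have h := IsGaussian.map_eq_gaussianReal (μ := multivariateGaussian 0 Sig) (dotCLM a)
  have e : ⇑(dotCLM a) = fun x => x.ofLp ⬝ᵥ a := by ext x; exact dotCLM_apply a x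
  have hint : ∫ x, dotCLM a x ∂multivariateGaussian 0 Sig = 0 := by
    rw [(dotCLM a).integral_comp_id_comm IsGaussian.integrable_id,
      integral_id_multivariateGaussian, map_zero]
  rw [hint, e, ← covariance_self (by rw [← e]; fun_prop), covariance_dot hSig] at h
  exact h

/-- The law of a row of the sketched design. -/
def sketchedRow (Sig : Matrix (Fin p) (Fin p) ℝ) (S : Matrix (Fin p) (Fin k) ℝ) :
    Measure (Fin k → ℝ) := (multivariateGaussian 0 Sig).map fun x => Sᵀ *ᵥ x.ofLp

lemma measurable_mulVec_ofLp (S : Matrix (Fin p) (Fin k) ℝ) :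
    Measurable fun x : EuclideanSpace ℝ (Fin p) => Sᵀ *ᵥ x.ofLp :=
  (measurable_mulVec Sᵀ).comp (by fun_prop)

instance (S : Matrix (Fin p) (Fin k) ℝ) : IsProbabilityMeasure (sketchedRow Sig S) :=
  Measure.isProbabilityMeasure_map (measurable_mulVec_ofLp S).aemeasurable

lemma measurable_dot_ofLp (a : Fin p → ℝ) :
    Measurable fun x : EuclideanSpace ℝ (Fin p) => x.ofLp ⬝ᵥ a :=
  measurable_dotProduct (by fun_prop) measurable_const

/-- A sketched row is independent of the projection of the row on a direction that is
`Sig`-orthogonal to the sketch. -/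
lemma map_row_pair (hSig : Sig.PosSemidef) {S : Matrix (Fin p) (Fin k) ℝ} {v : Fin p → ℝ}
    (hv : Sᵀ *ᵥ (Sig *ᵥ v) = 0) :
    (multivariateGaussian 0 Sig).map (fun x => (Sᵀ *ᵥ x.ofLp, x.ofLp ⬝ᵥ v)) =
      (sketchedRow Sig S).prod (gaussianReal 0 (v ⬝ᵥ (Sig *ᵥ v)).toNNReal) := by
  let L : EuclideanSpace ℝ (Fin p) →L[ℝ] (Fin k → ℝ) × (Unit → ℝ) :=
    (ContinuousLinearMap.pi fun i => dotCLM fun l => S l i).prod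
      (ContinuousLinearMap.pi fun _ => dotCLM v)
  have hG : HasGaussianLaw (fun x => L x) (multivariateGaussian 0 Sig) :=
    (IsGaussian.hasGaussianLaw_id (μ := multivariateGaussian 0 Sig)).map_fun L
  have hind := HasGaussianLaw.indepFun_of_covariance_eval
    (X := fun (i : Fin k) (x : EuclideanSpace ℝ (Fin p)) => x.ofLp ⬝ᵥ fun l => S l i)
    (Y := fun (_ : Unit) (x : EuclideanSpace ℝ (Fin p)) => x.ofLp ⬝ᵥ v)
    (P := multivariateGaussian 0 Sig) ?_ ?_
  · have h2 := hind.comp (φ := id) (ψ := fun y : Unit → ℝ => y ()) measurable_id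
      (measurable_pi_apply (X := fun _ => ℝ) ())
    have h3 : (fun x : EuclideanSpace ℝ (Fin p) => Sᵀ *ᵥ x.ofLp) ⟂ᵢ[multivariateGaussian 0 Sig]
        fun x => x.ofLp ⬝ᵥ v := by
      convert h2 using 1
      · ext x i
        simp [Matrix.mulVec, dotProduct, mul_comm]
      · rfl
    rw [indepFun_iff_map_prod_eq_prod_map_map (measurable_mulVec_ofLp S).aemeasurable
      (measurable_dot_ofLp v).aemeasurable] at h3
    rw [h3, map_dot_multivariateGaussian hSig]
    rfl
  · convert hG using 1
    ext x
    · simp [L, dotCLM_apply]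
    · simp [L, dotCLM_apply]
  · intro i _
    rw [covariance_dot hSig]
    exact congrFun hv i

lemma map_noise {t σ : ℝ} (ht : 0 ≤ t) (hσ : 0 < σ) :
    ((gaussianReal 0 t.toNNReal).prod (gaussianReal 0 1)).map
      (fun w => (w.1 + σ * w.2) / √(t + σ ^ 2)) = gaussianReal 0 1 := by
  set P := (gaussianReal 0 t.toNNReal).prod (gaussianReal 0 1)
  have hind : (fun w : ℝ × ℝ => w.1) ⟂ᵢ[P] fun w => σ * w.2 :=
    indepFun_prod (X := id) (Y := fun z => σ * z) measurable_id (by fun_prop)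
  have h1 : P.map (fun w => w.1) = gaussianReal 0 t.toNNReal := by
    change P.map Prod.fst = _
    simp [P]
  have h2 : P.map (fun w => σ * w.2) = gaussianReal 0 (σ ^ 2).toNNReal := by
    have e : (fun w : ℝ × ℝ => σ * w.2) = (fun z => σ * z) ∘ Prod.snd := rfl
    rw [e, ← Measure.map_map (by fun_prop) (by fun_prop)]
    have e2 : P.map Prod.snd = gaussianReal 0 1 := by simp [P]
    rw [e2, gaussianReal_map_const_mul]
    congr 1
    · simp
    · rw [mul_one]; ext; simp [sq_nonneg]
  have h3 := gaussianReal_add_gaussianReal_of_indepFun hind h1 h2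
  have hc : 0 < t + σ ^ 2 := by positivity
  have e : (fun w : ℝ × ℝ => (w.1 + σ * w.2) / √(t + σ ^ 2)) =
      (fun z => (√(t + σ ^ 2))⁻¹ * z) ∘ ((fun w : ℝ × ℝ => w.1) + fun w => σ * w.2) := by
    ext w
    simp [div_eq_inv_mul]
  rw [e, ← Measure.map_map (by fun_prop) (by fun_prop), h3, gaussianReal_map_const_mul]
  congr 1
  · simp
  · ext
    simp only [NNReal.coe_mul, NNReal.coe_mk, NNReal.coe_add, NNReal.coe_one,
      Real.coe_toNNReal _ ht, Real.coe_toNNReal _ (sq_nonneg σ), inv_pow, Real.sq_sqrt hc.le]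
    field_simp

lemma map_row (hSig : Sig.PosSemidef) {S : Matrix (Fin p) (Fin k) ℝ} {v : Fin p → ℝ}
    (hv : Sᵀ *ᵥ (Sig *ᵥ v) = 0) {σ : ℝ} (hσ : 0 < σ) :
    ((multivariateGaussian 0 Sig).prod (gaussianReal 0 1)).map
      (fun d => (Sᵀ *ᵥ d.1.ofLp, (d.1.ofLp ⬝ᵥ v + σ * d.2) / √(v ⬝ᵥ (Sig *ᵥ v) + σ ^ 2))) =
      (sketchedRow Sig S).prod (gaussianReal 0 1) := by
  set t := v ⬝ᵥ (Sig *ᵥ v) with ht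
  have ht0 : 0 ≤ t := by
    have := hSig.dotProduct_mulVec_nonneg v
    simpa using this
  have hF : Measurable fun x : EuclideanSpace ℝ (Fin p) => (Sᵀ *ᵥ x.ofLp, x.ofLp ⬝ᵥ v) :=
    (measurable_mulVec_ofLp S).prodMk (measurable_dot_ofLp v)
  have hh : Measurable fun w : ℝ × ℝ => (w.1 + σ * w.2) / √(t + σ ^ 2) := by fun_prop
  have e : (fun d : EuclideanSpace ℝ (Fin p) × ℝ =>
      (Sᵀ *ᵥ d.1.ofLp, (d.1.ofLp ⬝ᵥ v + σ * d.2) / √(t + σ ^ 2))) =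
      (Prod.map id fun w : ℝ × ℝ => (w.1 + σ * w.2) / √(t + σ ^ 2)) ∘
        (MeasurableEquiv.prodAssoc ∘ Prod.map (fun x => (Sᵀ *ᵥ x.ofLp, x.ofLp ⬝ᵥ v)) id) := rfl
  rw [e, ← Measure.map_map (measurable_id.prodMap hh)
      (MeasurableEquiv.prodAssoc.measurable.comp (hF.prodMap measurable_id)),
    ← Measure.map_map MeasurableEquiv.prodAssoc.measurable (hF.prodMap measurable_id),
    ← Measure.map_prod_map _ _ hF measurable_id, map_row_pair hSig hv, Measure.map_id,
    (measurePreserving_prodAssoc _ _ _).map_eq, ← Measure.map_prod_map _ _ measurable_id hh,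
    Measure.map_id, map_noise ht0 hσ]

/-- The sketched design and the standardized noise of the regression on it. -/
def reduceData (n : ℕ) (Sig : Matrix (Fin p) (Fin p) ℝ) (S : Matrix (Fin p) (Fin k) ℝ)
    (v : Fin p → ℝ) (σ : ℝ) (d : (Fin n → EuclideanSpace ℝ (Fin p)) × (Fin n → ℝ)) :
    (Fin n → Fin k → ℝ) × (Fin n → ℝ) :=
  (fun i => Sᵀ *ᵥ (d.1 i).ofLp,
    fun i => ((d.1 i).ofLp ⬝ᵥ v + σ * d.2 i) / √(v ⬝ᵥ (Sig *ᵥ v) + σ ^ 2))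

lemma measurable_rowMap (Sig : Matrix (Fin p) (Fin p) ℝ) (S : Matrix (Fin p) (Fin k) ℝ)
    (v : Fin p → ℝ) (σ : ℝ) : Measurable fun d : EuclideanSpace ℝ (Fin p) × ℝ =>
      (Sᵀ *ᵥ d.1.ofLp, (d.1.ofLp ⬝ᵥ v + σ * d.2) / √(v ⬝ᵥ (Sig *ᵥ v) + σ ^ 2)) := by
  refine ((measurable_mulVec_ofLp S).comp measurable_fst).prodMk ?_
  exact (((measurable_dot_ofLp v).comp measurable_fst).add
    (measurable_snd.const_mul σ)).div_const _

lemma measurePreserving_reduceData (n : ℕ) (hSig : Sig.PosSemidef) {S : Matrix (Fin p) (Fin k) ℝ}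
    {v : Fin p → ℝ} (hv : Sᵀ *ᵥ (Sig *ᵥ v) = 0) {σ : ℝ} (hσ : 0 < σ) :
    MeasurePreserving (reduceData n Sig S v σ) (dataLaw n Sig)
      ((Measure.pi fun _ => sketchedRow Sig S).prod (stdNormalVector n)) := by
  have hrow := measurable_rowMap Sig S v σ
  have m1 := measurePreserving_arrowProdEquivProdArrow (EuclideanSpace ℝ (Fin p)) ℝ (Fin n)
    (fun _ => multivariateGaussian 0 Sig) fun _ => gaussianReal 0 1
  have m2 := measurePreserving_arrowProdEquivProdArrow (Fin k → ℝ) ℝ (Fin n)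
    (fun _ => sketchedRow Sig S) fun _ => gaussianReal 0 1
  have hr := map_row hSig hv hσ
  have m3 : MeasurePreserving (fun (x : Fin n → EuclideanSpace ℝ (Fin p) × ℝ) i =>
      (Sᵀ *ᵥ (x i).1.ofLp, ((x i).1.ofLp ⬝ᵥ v + σ * (x i).2) / √(v ⬝ᵥ (Sig *ᵥ v) + σ ^ 2)))
      (Measure.pi fun _ => (multivariateGaussian 0 Sig).prod (gaussianReal 0 1))
      (Measure.pi fun _ => (sketchedRow Sig S).prod (gaussianReal 0 1)) := by
    refine measurePreserving_pi _ _ fun _ => ⟨hrow, hr⟩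
  exact (m2.comp m3).comp m1.symm

end Rows


section Design

open scoped MatrixOrder

variable {n p k : ℕ} {Sig : Matrix (Fin p) (Fin p) ℝ} {S : Matrix (Fin p) (Fin k) ℝ}

lemma sqrt_mul_sqrt_of_posSemidef (hSig : Sig.PosSemidef) :
    CFC.sqrt Sig * CFC.sqrt Sig = Sig :=
  CFC.sqrt_mul_sqrt_self Sig hSig.nonneg

lemma sqrt_transpose (Sig : Matrix (Fin p) (Fin p) ℝ) : (CFC.sqrt Sig)ᵀ = CFC.sqrt Sig := by
  have h : (CFC.sqrt Sig).PosSemidef := Matrix.nonneg_iff_posSemidef.1 (CFC.sqrt_nonneg Sig)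
  have := h.isHermitian
  rwa [Matrix.IsHermitian, Matrix.conjTranspose_eq_transpose_of_trivial] at this

lemma gram_sqrt_mul (hSig : Sig.PosSemidef) (S : Matrix (Fin p) (Fin k) ℝ) :
    (CFC.sqrt Sig * S)ᵀ * (CFC.sqrt Sig * S) = Sᵀ * Sig * S := by
  rw [transpose_mul, sqrt_transpose, Matrix.mul_assoc, ← Matrix.mul_assoc (CFC.sqrt Sig),
    sqrt_mul_sqrt_of_posSemidef hSig, Matrix.mul_assoc]

lemma sketchedRow_eq_map (Sig : Matrix (Fin p) (Fin p) ℝ) (S : Matrix (Fin p) (Fin k) ℝ) :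
    sketchedRow Sig S = (gaussPi (Fin p)).map fun g => (CFC.sqrt Sig * S)ᵀ *ᵥ g := by
  rw [sketchedRow, multivariateGaussian, ← map_pi_eq_stdGaussian,
    Measure.map_map (measurable_mulVec_ofLp S) (by fun_prop), Measure.map_map
      ((measurable_mulVec_ofLp S).comp (by fun_prop)) (by fun_prop)]
  congr 1
  ext g : 1
  simp [transpose_mul, sqrt_transpose, Matrix.mulVec_mulVec]

/-- The product of a Gaussian matrix with at least `k` rows and a matrix of full column rank `k`
almost surely has full column rank. -/
lemma ae_isUnit_gram_mul {M : Matrix (Fin p) (Fin k) ℝ} (hM : IsUnit (Mᵀ * M).det)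
    (hkn : k ≤ n) :
    ∀ᵐ Z ∂(Measure.pi fun _ : Fin n => gaussPi (Fin p)),
      IsUnit ((Matrix.of Z * M)ᵀ * (Matrix.of Z * M)).det := by
  let E : Matrix (Fin n) (Fin k) ℝ := (1 : Matrix (Fin n) (Fin n) ℝ).submatrix id (Fin.castLE hkn)
  have hE : Eᵀ * E = 1 := by
    ext i j
    simp [E, Matrix.mul_apply, Matrix.one_apply]
  let L : (Fin n → Fin p → ℝ) →ₗ[ℝ] Matrix (Fin n) (Fin k) ℝ :=
    { toFun := fun Z => Matrix.of Z * M
      map_add' := fun Z Z' => Matrix.add_mul (Matrix.of Z) (Matrix.of Z') M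
      map_smul' := fun t Z => Matrix.smul_mul t (Matrix.of Z) M }
  refine ae_isUnit_gram L (x₀ := E * ((Mᵀ * M)⁻¹ * Mᵀ)) ?_
  have : L (E * ((Mᵀ * M)⁻¹ * Mᵀ)) = E := by
    change E * ((Mᵀ * M)⁻¹ * Mᵀ) * M = E
    rw [Matrix.mul_assoc, Matrix.mul_assoc, Matrix.nonsing_inv_mul _ hM, Matrix.mul_one]
  rw [this, hE]
  simp

lemma ae_isUnit_gram_sketchedRow (hSig : Sig.PosSemidef) (hA : IsUnit (Sᵀ * Sig * S).det)
    (hkn : k ≤ n) :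
    ∀ᵐ W ∂(Measure.pi fun _ : Fin n => sketchedRow Sig S),
      IsUnit ((Matrix.of W)ᵀ * Matrix.of W).det := by
  rw [← gram_sqrt_mul hSig] at hA
  have h := ae_isUnit_gram_mul (n := n) hA hkn
  have hm : Measurable fun (Z : Fin n → Fin p → ℝ) i => (CFC.sqrt Sig * S)ᵀ *ᵥ Z i :=
    measurable_pi_lambda _ fun i => (measurable_mulVec _).comp (measurable_pi_apply i)
  have e : (Measure.pi fun _ : Fin n => sketchedRow Sig S) =
      (Measure.pi fun _ : Fin n => gaussPi (Fin p)).map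
        fun Z i => (CFC.sqrt Sig * S)ᵀ *ᵥ Z i := by
    rw [Measure.pi_map_pi fun _ => (measurable_mulVec _).aemeasurable]
    simp only [sketchedRow_eq_map]
  have hs : MeasurableSet {W : Fin n → Fin k → ℝ | IsUnit ((Matrix.of W)ᵀ * Matrix.of W).det} := by
    have hW : EntryMeasurable fun W : Fin n → Fin k → ℝ => Matrix.of W := fun i j => by
      simp only [Matrix.of_apply]; fun_prop
    simp only [isUnit_iff_ne_zero]
    exact ((hW.transpose.mul hW).det (measurableSet_singleton 0)).compl
  rw [e, ae_map_iff hm.aemeasurable hs]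
  filter_upwards [h] with Z hZ
  convert hZ using 3 <;>
  · ext i j
    simp [Matrix.mul_apply, Matrix.mulVec, dotProduct, mul_comm]

/-- The law of a linear functional of a sketched row. -/
lemma sketchedRow_map_dot (hSig : Sig.PosSemidef) (S : Matrix (Fin p) (Fin k) ℝ) (γ : Fin k → ℝ) :
    (sketchedRow Sig S).map (fun w => w ⬝ᵥ γ) =
      (gaussianReal 0 1).map fun x => √(γ ⬝ᵥ ((Sᵀ * Sig * S) *ᵥ γ)) * x := by
  have hm : Measurable fun w : Fin k → ℝ => w ⬝ᵥ γ :=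
    measurable_dotProduct measurable_id measurable_const
  have e : ((fun w : Fin k → ℝ => w ⬝ᵥ γ) ∘ fun x : EuclideanSpace ℝ (Fin p) => Sᵀ *ᵥ x.ofLp) =
      fun x => x.ofLp ⬝ᵥ (S *ᵥ γ) := by
    ext x
    simp [Matrix.dotProduct_mulVec, Matrix.mulVec_transpose]
  rw [sketchedRow, Measure.map_map hm (measurable_mulVec_ofLp S), e,
    map_dot_multivariateGaussian hSig, gaussianReal_map_const_mul]
  have h0 : 0 ≤ γ ⬝ᵥ ((Sᵀ * Sig * S) *ᵥ γ) := by
    have := (hSig.conjTranspose_mul_mul_same S).dotProduct_mulVec_nonneg γ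
    simpa using this
  have e2 : (S *ᵥ γ) ⬝ᵥ (Sig *ᵥ (S *ᵥ γ)) = γ ⬝ᵥ ((Sᵀ * Sig * S) *ᵥ γ) := by
    simp only [Matrix.mulVec_mulVec, Matrix.dotProduct_mulVec, Matrix.vecMul_mulVec,
      Matrix.mul_assoc]
  rw [e2]
  congr 1
  · simp
  · ext
    simp [Real.sq_sqrt h0, h0]

lemma map_sum_sq_sketchedRow (n : ℕ) (hSig : Sig.PosSemidef) (S : Matrix (Fin p) (Fin k) ℝ)
    (γ : Fin k → ℝ) :
    (Measure.pi fun _ : Fin n => sketchedRow Sig S).map (fun W => ∑ i, (W i ⬝ᵥ γ) ^ 2) =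
      (stdNormalVector n).map fun w => (γ ⬝ᵥ ((Sᵀ * Sig * S) *ᵥ γ)) * ∑ i, w i ^ 2 := by
  have h0 : 0 ≤ γ ⬝ᵥ ((Sᵀ * Sig * S) *ᵥ γ) := by
    have := (hSig.conjTranspose_mul_mul_same S).dotProduct_mulVec_nonneg γ
    simpa using this
  set δ := √(γ ⬝ᵥ ((Sᵀ * Sig * S) *ᵥ γ)) with hδ
  have hm : Measurable fun w : Fin k → ℝ => w ⬝ᵥ γ :=
    measurable_dotProduct measurable_id measurable_const
  have h1 := Measure.pi_map_pi (μ := fun _ : Fin n => sketchedRow Sig S)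
    (f := fun _ w => w ⬝ᵥ γ) fun _ => hm.aemeasurable
  have h2 := Measure.pi_map_pi (μ := fun _ : Fin n => gaussianReal 0 1)
    (f := fun _ x => δ * x) fun _ => by fun_prop
  simp only [sketchedRow_map_dot hSig] at h1
  rw [← hδ, ← h2] at h1
  have h3 := congrArg (fun μ => Measure.map (fun w : Fin n → ℝ => ∑ i, w i ^ 2) μ) h1
  have hm' : Measurable fun (W : Fin n → Fin k → ℝ) i => W i ⬝ᵥ γ :=
    measurable_pi_lambda _ fun i => hm.comp (measurable_pi_apply i)
  rw [Measure.map_map (by fun_prop) hm', Measure.map_map (by fun_prop) (by fun_prop)] at h3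
  have e : ((fun w : Fin n → ℝ => ∑ i, w i ^ 2) ∘ fun (x : Fin n → ℝ) i => δ * x i) =
      fun w : Fin n → ℝ => (γ ⬝ᵥ ((Sᵀ * Sig * S) *ᵥ γ)) * ∑ i, w i ^ 2 := by
    ext w
    simp only [Function.comp_apply, mul_pow, Finset.mul_sum]
    rw [hδ, Real.sq_sqrt h0]
  rw [e] at h3
  exact h3

lemma stdNormalVector_map_dot (a : Fin n → ℝ) :
    (stdNormalVector n).map (fun e => e ⬝ᵥ a) = gaussianReal 0 (a ⬝ᵥ a).toNNReal := by
  have h1 := map_dot_multivariateGaussian (Matrix.PosSemidef.one (n := Fin n) (R := ℝ)) a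
  rw [multivariateGaussian_zero_one, ← map_pi_eq_stdGaussian,
    Measure.map_map (measurable_dot_ofLp a) (by fun_prop), Matrix.one_mulVec] at h1
  exact h1

/-- Chebyshev's inequality for a linear functional of a Gaussian vector. -/
lemma stdNormalVector_dot_chebyshev (a : Fin n → ℝ) {t : ℝ} (ht : 0 < t) :
    stdNormalVector n {e | t ≤ |e ⬝ᵥ a|} ≤ ENNReal.ofReal ((a ⬝ᵥ a) / t ^ 2) := by
  have hm : Measurable fun e : Fin n → ℝ => e ⬝ᵥ a :=
    measurable_dotProduct measurable_id measurable_const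
  have h := stdNormalVector_map_dot a
  have hc := meas_ge_le_variance_div_sq (μ := gaussianReal 0 (a ⬝ᵥ a).toNNReal)
    IsGaussian.memLp_two_id ht
  have h0 : 0 ≤ a ⬝ᵥ a := Finset.sum_nonneg fun i _ => mul_self_nonneg _
  simp only [id, integral_id_gaussianReal, sub_zero] at hc
  rw [variance_id_gaussianReal, Real.coe_toNNReal _ h0, ← h, Measure.map_apply hm
    (measurableSet_le measurable_const (by fun_prop))] at hc
  exact hc

end Design


section Model

variable {n p k : ℕ} {Sig : Matrix (Fin p) (Fin p) ℝ} {S : Matrix (Fin p) (Fin k) ℝ}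

/-- The explained sum of squares of the noise. -/
def explainedSq (z : (Fin n → Fin k → ℝ) × (Fin n → ℝ)) : ℝ :=
  z.2 ⬝ᵥ (hat (Matrix.of z.1) *ᵥ z.2)

/-- The residual sum of squares of the noise. -/
def residualSq (z : (Fin n → Fin k → ℝ) × (Fin n → ℝ)) : ℝ :=
  (z.2 - hat (Matrix.of z.1) *ᵥ z.2) ⬝ᵥ (z.2 - hat (Matrix.of z.1) *ᵥ z.2)

/-- The cross product of the noise and the standardized signal. -/
def crossTerm (γ : Fin k → ℝ) (c : ℝ) (z : (Fin n → Fin k → ℝ) × (Fin n → ℝ)) : ℝ :=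
  z.2 ⬝ᵥ (Matrix.of z.1 *ᵥ γ) / c

/-- The squared norm of the standardized signal. -/
def shiftTerm (γ : Fin k → ℝ) (c : ℝ) (z : (Fin n → Fin k → ℝ) × (Fin n → ℝ)) : ℝ :=
  (Matrix.of z.1 *ᵥ γ) ⬝ᵥ (Matrix.of z.1 *ᵥ γ) / c ^ 2

lemma entryMeasurable_fst :
    EntryMeasurable fun z : (Fin n → Fin k → ℝ) × (Fin n → ℝ) => Matrix.of z.1 := fun i j => by
  simp only [Matrix.of_apply]; fun_prop

lemma measurable_explainedSq :
    Measurable (explainedSq : (Fin n → Fin k → ℝ) × (Fin n → ℝ) → ℝ) :=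
  measurable_dotProduct measurable_snd (entryMeasurable_fst.hat.mulVec measurable_snd)

lemma measurable_residualSq :
    Measurable (residualSq : (Fin n → Fin k → ℝ) × (Fin n → ℝ) → ℝ) := by
  have := measurable_snd.sub (entryMeasurable_fst (n := n) (k := k).hat.mulVec measurable_snd)
  exact measurable_dotProduct this this

lemma measurable_crossTerm (γ : Fin k → ℝ) (c : ℝ) :
    Measurable (crossTerm γ c : (Fin n → Fin k → ℝ) × (Fin n → ℝ) → ℝ) :=
  (measurable_dotProduct measurable_snd
    (entryMeasurable_fst.mulVec measurable_const)).div_const _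

lemma measurable_shiftTerm (γ : Fin k → ℝ) (c : ℝ) :
    Measurable (shiftTerm γ c : (Fin n → Fin k → ℝ) × (Fin n → ℝ) → ℝ) := by
  have := entryMeasurable_fst (n := n) (k := k).mulVec (measurable_const (a := γ))
  exact (measurable_dotProduct this this).div_const _

/-- The law of the reduced data of the regression on the sketched design. -/
abbrev modelLaw (n : ℕ) (Sig : Matrix (Fin p) (Fin p) ℝ) (S : Matrix (Fin p) (Fin k) ℝ) :
    Measure ((Fin n → Fin k → ℝ) × (Fin n → ℝ)) :=
  (Measure.pi fun _ => sketchedRow Sig S).prod (stdNormalVector n)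

lemma modelLaw_map_sq (hSig : Sig.PosSemidef) (hA : IsUnit (Sᵀ * Sig * S).det) (hkn : k ≤ n) :
    (modelLaw n Sig S).map (fun z => (explainedSq z, residualSq z)) =
      (chiSq k).prod (chiSq (n - k)) := by
  have hm : Measurable fun z : (Fin n → Fin k → ℝ) × (Fin n → ℝ) =>
      (explainedSq z, residualSq z) := measurable_explainedSq.prodMk measurable_residualSq
  ext s hs
  rw [Measure.map_apply hm hs, Measure.prod_apply (hm hs)]
  have : ∀ᵐ W ∂(Measure.pi fun _ : Fin n => sketchedRow Sig S),
      stdNormalVector n (Prod.mk W ⁻¹' ((fun z => (explainedSq z, residualSq z)) ⁻¹' s)) =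
        (chiSq k).prod (chiSq (n - k)) s := by
    filter_upwards [ae_isUnit_gram_sketchedRow hSig hA hkn] with W hW
    have h := gaussPi_map_hat hW (d := n - k) (by simp; omega)
    rw [Fintype.card_fin] at h
    rw [← h]
    exact (Measure.map_apply (μ := stdNormalVector n)
      (hm.comp (measurable_prodMk_left (x := W))) hs).symm
  rw [lintegral_congr_ae this]
  simp

lemma modelLaw_crossTerm_le (hSig : Sig.PosSemidef) (S : Matrix (Fin p) (Fin k) ℝ)
    (γ : Fin k → ℝ) (c : ℝ) {t : ℝ} (ht : 0 < t) :
    modelLaw n Sig S {z | t ≤ |crossTerm γ c z|} ≤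
      ENNReal.ofReal (n * (γ ⬝ᵥ ((Sᵀ * Sig * S) *ᵥ γ) / c ^ 2) / t ^ 2) := by
  have hs : MeasurableSet {z : (Fin n → Fin k → ℝ) × (Fin n → ℝ) | t ≤ |crossTerm γ c z|} :=
    measurableSet_le measurable_const (measurable_crossTerm γ c).abs
  rw [Measure.prod_apply hs]
  set D := γ ⬝ᵥ ((Sᵀ * Sig * S) *ᵥ γ) with hD
  have hD0 : 0 ≤ D := by
    have := (hSig.conjTranspose_mul_mul_same S).dotProduct_mulVec_nonneg γ
    simpa using this
  have hF : Measurable fun (x : ℝ) => ENNReal.ofReal (x / c ^ 2 / t ^ 2) := by fun_prop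
  have hG : Measurable fun W : Fin n → Fin k → ℝ => ∑ i, (W i ⬝ᵥ γ) ^ 2 :=
    Finset.measurable_sum _ fun i _ =>
      (measurable_dotProduct (measurable_pi_apply i) measurable_const).pow_const 2
  have key : ∀ W : Fin n → Fin k → ℝ, stdNormalVector n
      (Prod.mk W ⁻¹' {z | t ≤ |crossTerm γ c z|}) ≤
        ENNReal.ofReal ((∑ i, (W i ⬝ᵥ γ) ^ 2) / c ^ 2 / t ^ 2) := by
    intro W
    have h := stdNormalVector_dot_chebyshev (c⁻¹ • (Matrix.of W *ᵥ γ)) ht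
    convert h using 2
    · ext e
      simp [crossTerm, div_eq_inv_mul]
    · simp only [dotProduct_smul, smul_dotProduct, smul_eq_mul]
      congr 1
      rw [← mul_assoc, ← mul_inv, ← pow_two, ← div_eq_inv_mul]
      congr 1
      exact Finset.sum_congr rfl fun i _ => pow_two _
  calc _ ≤ ∫⁻ W, ENNReal.ofReal ((∑ i, (W i ⬝ᵥ γ) ^ 2) / c ^ 2 / t ^ 2)
        ∂(Measure.pi fun _ : Fin n => sketchedRow Sig S) := lintegral_mono key
    _ = ∫⁻ w, ENNReal.ofReal ((D * ∑ i, w i ^ 2) / c ^ 2 / t ^ 2) ∂stdNormalVector n := by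
      rw [← lintegral_map hF hG, map_sum_sq_sketchedRow n hSig,
        lintegral_map hF (by fun_prop)]
    _ = ENNReal.ofReal (n * (D / c ^ 2) / t ^ 2) := by
      have e : (fun w : Fin n → ℝ => (D * ∑ i, w i ^ 2) / c ^ 2 / t ^ 2) =
          fun w => (D / c ^ 2 / t ^ 2) * ∑ i, w i ^ 2 := by ext; ring
      rw [← ofReal_integral_eq_lintegral_ofReal, e, integral_const_mul, integral_sum_sq]
      · congr 1; ring
      · rw [e]
        exact ((memLp_sum_sq n).integrable one_le_two).const_mul _
      · exact ae_of_all _ fun w => div_nonneg (div_nonneg (mul_nonneg hD0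
          (Finset.sum_nonneg fun i _ => sq_nonneg _)) (sq_nonneg _)) (sq_nonneg _)

lemma modelLaw_shiftTerm_le (hSig : Sig.PosSemidef) (S : Matrix (Fin p) (Fin k) ℝ)
    (γ : Fin k → ℝ) (c : ℝ) {t : ℝ} (ht : 0 < t) :
    modelLaw n Sig S {z | t ≤ |shiftTerm γ c z - n * (γ ⬝ᵥ ((Sᵀ * Sig * S) *ᵥ γ) / c ^ 2)|} ≤
      ENNReal.ofReal (2 * n * (γ ⬝ᵥ ((Sᵀ * Sig * S) *ᵥ γ) / c ^ 2) ^ 2 / t ^ 2) := by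
  set D := γ ⬝ᵥ ((Sᵀ * Sig * S) *ᵥ γ) with hD
  have hG : Measurable fun W : Fin n → Fin k → ℝ => ∑ i, (W i ⬝ᵥ γ) ^ 2 :=
    Finset.measurable_sum _ fun i _ =>
      (measurable_dotProduct (measurable_pi_apply i) measurable_const).pow_const 2
  have hs : MeasurableSet {x : ℝ | t ≤ |x / c ^ 2 - n * (D / c ^ 2)|} :=
    measurableSet_le measurable_const (by fun_prop)
  refine le_trans (le_of_eq ?_) (stdNormalVector_chebyshev n (D / c ^ 2) ht)
  have e : {z : (Fin n → Fin k → ℝ) × (Fin n → ℝ) |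
      t ≤ |shiftTerm γ c z - n * (D / c ^ 2)|} =
      ((fun W : Fin n → Fin k → ℝ => ∑ i, (W i ⬝ᵥ γ) ^ 2) ⁻¹'
        {x : ℝ | t ≤ |x / c ^ 2 - n * (D / c ^ 2)|}) ×ˢ Set.univ := by
    ext z
    have : (Matrix.of z.1 *ᵥ γ) ⬝ᵥ (Matrix.of z.1 *ᵥ γ) = ∑ i, (z.1 i ⬝ᵥ γ) ^ 2 :=
      Finset.sum_congr rfl fun i _ => (pow_two _).symm
    simp [shiftTerm, this]
  rw [e, Measure.prod_prod, measure_univ, mul_one, ← Measure.map_apply hG hs,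
    map_sum_sq_sketchedRow n hSig, Measure.map_apply (by fun_prop) hs]
  congr 1
  ext w
  simp only [Set.mem_preimage, Set.mem_ofPred_eq, ← hD]
  rw [mul_div_right_comm]

lemma isFModel_modelLaw (hSig : Sig.PosSemidef) (hA : IsUnit (Sᵀ * Sig * S).det) (hkn : k ≤ n)
    (γ : Fin k → ℝ) (c : ℝ) :
    IsFModel (modelLaw n Sig S) k (n - k) (γ ⬝ᵥ ((Sᵀ * Sig * S) *ᵥ γ) / c ^ 2)
      explainedSq residualSq (crossTerm γ c) (shiftTerm γ c) := by
  have hn : (k : ℝ) + (n - k : ℕ) = n := by rw [Nat.cast_sub hkn]; ring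
  have hD0 : 0 ≤ γ ⬝ᵥ ((Sᵀ * Sig * S) *ᵥ γ) := by
    have := (hSig.conjTranspose_mul_mul_same S).dotProduct_mulVec_nonneg γ
    simpa using this
  refine ⟨⟨(measurable_explainedSq.prodMk measurable_residualSq).aemeasurable,
    modelLaw_map_sq hSig hA hkn⟩, fun t ht => ?_, fun t ht => ?_⟩
  · rw [hn]
    exact ENNReal.toReal_le_of_le_ofReal (by positivity) (modelLaw_crossTerm_le hSig S γ c ht)
  · rw [hn]
    exact ENNReal.toReal_le_of_le_ofReal (by positivity) (modelLaw_shiftTerm_le hSig S γ c ht)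

end Model


section Regression

variable {n p k : ℕ}

lemma mulVec_sketchedEstimate (X : Matrix (Fin n) (Fin p) ℝ) (y : Fin n → ℝ)
    (S : Matrix (Fin p) (Fin k) ℝ) :
    (X * S) *ᵥ sketchedEstimate X y S = hat (X * S) *ᵥ y := by
  simp only [sketchedEstimate, hat, Matrix.mulVec_mulVec, Matrix.mul_assoc]

lemma hat_mulVec_add {W : Matrix (Fin n) (Fin k) ℝ} (hW : IsUnit (Wᵀ * W).det) (γ : Fin k → ℝ)
    (c : ℝ) (e : Fin n → ℝ) :
    hat W *ᵥ (W *ᵥ γ + c • e) = W *ᵥ γ + c • (hat W *ᵥ e) := by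
  rw [Matrix.mulVec_add, Matrix.mulVec_mulVec, hat_mul hW, Matrix.mulVec_smul]

lemma add_smul_dotProduct_hat {W : Matrix (Fin n) (Fin k) ℝ} (hW : IsUnit (Wᵀ * W).det)
    (γ : Fin k → ℝ) (c : ℝ) (e : Fin n → ℝ) :
    (W *ᵥ γ + c • e) ⬝ᵥ (hat W *ᵥ (W *ᵥ γ + c • e)) =
      c ^ 2 * (e ⬝ᵥ (hat W *ᵥ e)) + 2 * c * (e ⬝ᵥ (W *ᵥ γ)) + (W *ᵥ γ) ⬝ᵥ (W *ᵥ γ) := by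
  have h : (W *ᵥ γ) ⬝ᵥ (hat W *ᵥ e) = e ⬝ᵥ (W *ᵥ γ) := by
    rw [Matrix.dotProduct_mulVec, ← Matrix.mulVec_transpose, hat_transpose, Matrix.mulVec_mulVec,
      hat_mul hW, dotProduct_comm]
  rw [hat_mulVec_add hW]
  simp only [add_dotProduct, dotProduct_add, smul_dotProduct, dotProduct_smul, smul_eq_mul, h]
  ring

variable {Sig : Matrix (Fin p) (Fin p) ℝ} {S : Matrix (Fin p) (Fin k) ℝ}

/-- The coefficients of the best linear predictor of the signal from the sketched covariates. -/
def projCoef (Sig : Matrix (Fin p) (Fin p) ℝ) (S : Matrix (Fin p) (Fin k) ℝ) (β : Fin p → ℝ) :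
    Fin k → ℝ := (Sᵀ * Sig * S)⁻¹ *ᵥ (Sᵀ *ᵥ (Sig *ᵥ β))

/-- The part of the coefficient vector that the sketch does not capture. -/
def projResidual (Sig : Matrix (Fin p) (Fin p) ℝ) (S : Matrix (Fin p) (Fin k) ℝ) (β : Fin p → ℝ) :
    Fin p → ℝ := β - S *ᵥ projCoef Sig S β

lemma sketch_projResidual (hA : IsUnit (Sᵀ * Sig * S).det) (β : Fin p → ℝ) :
    Sᵀ *ᵥ (Sig *ᵥ projResidual Sig S β) = 0 := by
  simp only [projResidual, projCoef, Matrix.mulVec_sub]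
  rw [sub_eq_zero]
  have : Sᵀ *ᵥ (Sig *ᵥ (S *ᵥ ((Sᵀ * Sig * S)⁻¹ *ᵥ (Sᵀ *ᵥ (Sig *ᵥ β))))) =
      ((Sᵀ * Sig * S) * (Sᵀ * Sig * S)⁻¹) *ᵥ (Sᵀ *ᵥ (Sig *ᵥ β)) := by
    simp only [Matrix.mulVec_mulVec, Matrix.mul_assoc]
  rw [this, Matrix.mul_nonsing_inv _ hA, Matrix.one_mulVec]

/-- The signal that the sketch does not capture. -/
def lostSignal (Sig : Matrix (Fin p) (Fin p) ℝ) (S : Matrix (Fin p) (Fin k) ℝ) (β : Fin p → ℝ) :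
    ℝ := signal (projResidual Sig S β) Sig

lemma signal_nonneg (hSig : Sig.PosSemidef) (β : Fin p → ℝ) : 0 ≤ signal β Sig := by
  simpa [signal] using hSig.dotProduct_mulVec_nonneg β

lemma dotProduct_mulVec_comm (hSig : Sig.PosSemidef) (u v : Fin p → ℝ) :
    u ⬝ᵥ (Sig *ᵥ v) = v ⬝ᵥ (Sig *ᵥ u) := by
  have h : Sigᵀ = Sig := by
    have := hSig.isHermitian
    rwa [Matrix.IsHermitian, Matrix.conjTranspose_eq_transpose_of_trivial] at this
  rw [Matrix.dotProduct_mulVec, ← Matrix.mulVec_transpose, h, dotProduct_comm]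

lemma signal_add_mulVec (hSig : Sig.PosSemidef) {v : Fin p → ℝ} (hv : Sᵀ *ᵥ (Sig *ᵥ v) = 0)
    (w : Fin k → ℝ) :
    signal (v + S *ᵥ w) Sig = signal v Sig + w ⬝ᵥ ((Sᵀ * Sig * S) *ᵥ w) := by
  have h1 : (S *ᵥ w) ⬝ᵥ (Sig *ᵥ v) = 0 := by
    rw [dotProduct_comm, Matrix.dotProduct_mulVec, ← Matrix.mulVec_transpose, hv, zero_dotProduct]
  have h2 : (S *ᵥ w) ⬝ᵥ (Sig *ᵥ (S *ᵥ w)) = w ⬝ᵥ ((Sᵀ * Sig * S) *ᵥ w) := by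
    simp only [Matrix.mulVec_mulVec, Matrix.dotProduct_mulVec, Matrix.vecMul_mulVec,
      Matrix.mul_assoc]
  simp only [signal, Matrix.mulVec_add, add_dotProduct, dotProduct_add]
  rw [dotProduct_mulVec_comm hSig v (S *ᵥ w), h1, h2]
  ring

lemma signal_eq_lostSignal_add (hSig : Sig.PosSemidef) (hA : IsUnit (Sᵀ * Sig * S).det)
    (β : Fin p → ℝ) :
    signal β Sig = lostSignal Sig S β +
      projCoef Sig S β ⬝ᵥ ((Sᵀ * Sig * S) *ᵥ projCoef Sig S β) := by
  rw [lostSignal, ← signal_add_mulVec hSig (sketch_projResidual hA β), projResidual,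
    sub_add_cancel]

lemma sketchedGram_nonneg (hSig : Sig.PosSemidef) (S : Matrix (Fin p) (Fin k) ℝ) (w : Fin k → ℝ) :
    0 ≤ w ⬝ᵥ ((Sᵀ * Sig * S) *ᵥ w) := by
  simpa using (hSig.conjTranspose_mul_mul_same S).dotProduct_mulVec_nonneg w

lemma lostSignal_le (hSig : Sig.PosSemidef) (hA : IsUnit (Sᵀ * Sig * S).det) (β : Fin p → ℝ)
    (w : Fin k → ℝ) : lostSignal Sig S β ≤ signal (β - S *ᵥ w) Sig := by
  have e : β - S *ᵥ w = projResidual Sig S β + S *ᵥ (projCoef Sig S β - w) := by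
    rw [Matrix.mulVec_sub, projResidual]; abel
  rw [e, signal_add_mulVec hSig (sketch_projResidual hA β), ← lostSignal]
  linarith [sketchedGram_nonneg hSig S (projCoef Sig S β - w)]

lemma design_mul (S : Matrix (Fin p) (Fin k) ℝ) (v : Fin p → ℝ) (σ : ℝ)
    (d : (Fin n → EuclideanSpace ℝ (Fin p)) × (Fin n → ℝ)) :
    designMatrix d.1 * S = Matrix.of (reduceData n Sig S v σ d).1 := by
  ext i j
  simp [designMatrix, reduceData, Matrix.mul_apply, Matrix.mulVec, dotProduct, mul_comm]

/-- The response is a regression on the sketched design with a larger noise. -/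
lemma response_eq (hSig : Sig.PosSemidef) (β : Fin p → ℝ) {σ : ℝ} (hσ : 0 < σ)
    (d : (Fin n → EuclideanSpace ℝ (Fin p)) × (Fin n → ℝ)) :
    response β σ d = Matrix.of (reduceData n Sig S (projResidual Sig S β) σ d).1 *ᵥ
        projCoef Sig S β + √(lostSignal Sig S β + σ ^ 2) •
          (reduceData n Sig S (projResidual Sig S β) σ d).2 := by
  have hc : 0 < √(lostSignal Sig S β + σ ^ 2) := by
    have := signal_nonneg hSig (projResidual Sig S β)
    rw [← lostSignal] at this
    positivity
  rw [← design_mul, ← Matrix.mulVec_mulVec]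
  have h1 : √(lostSignal Sig S β + σ ^ 2) •
      (reduceData n Sig S (projResidual Sig S β) σ d).2 =
      designMatrix d.1 *ᵥ projResidual Sig S β + σ • d.2 := by
    ext i
    simp only [Pi.smul_apply, smul_eq_mul, reduceData, Pi.add_apply]
    rw [← signal, ← lostSignal, mul_div_cancel₀ _ hc.ne']
    rfl
  rw [h1, projResidual, Matrix.mulVec_sub, response]
  abel

variable {β : Fin p → ℝ} {σ : ℝ}

lemma sketchedResidual_sq (hSig : Sig.PosSemidef) (β : Fin p → ℝ) (hσ : 0 < σ)
    {d : (Fin n → EuclideanSpace ℝ (Fin p)) × (Fin n → ℝ)}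
    (hd : IsUnit ((Matrix.of (reduceData n Sig S (projResidual Sig S β) σ d).1)ᵀ *
      Matrix.of (reduceData n Sig S (projResidual Sig S β) σ d).1).det) :
    sketchedResidual (designMatrix d.1) (response β σ d) S ⬝ᵥ
      sketchedResidual (designMatrix d.1) (response β σ d) S =
      √(lostSignal Sig S β + σ ^ 2) ^ 2 *
        residualSq (reduceData n Sig S (projResidual Sig S β) σ d) := by
  have e : sketchedResidual (designMatrix d.1) (response β σ d) S =
      √(lostSignal Sig S β + σ ^ 2) • ((reduceData n Sig S (projResidual Sig S β) σ d).2 -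
        hat (Matrix.of (reduceData n Sig S (projResidual Sig S β) σ d).1) *ᵥ
          (reduceData n Sig S (projResidual Sig S β) σ d).2) := by
    rw [sketchedResidual, mulVec_sketchedEstimate,
      design_mul (Sig := Sig) S (projResidual Sig S β) σ d, response_eq hSig β hσ,
      hat_mulVec_add hd, smul_sub]
    abel
  rw [e, residualSq, smul_dotProduct, dotProduct_smul, smul_eq_mul, smul_eq_mul]
  ring

lemma sketchedF_eq (hSig : Sig.PosSemidef) (hkn : k ≤ n) (hσ : 0 < σ)
    {d : (Fin n → EuclideanSpace ℝ (Fin p)) × (Fin n → ℝ)}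
    (hd : IsUnit ((Matrix.of (reduceData n Sig S (projResidual Sig S β) σ d).1)ᵀ *
      Matrix.of (reduceData n Sig S (projResidual Sig S β) σ d).1).det) :
    sketchedF (designMatrix d.1) (response β σ d) S =
      ((explainedSq (reduceData n Sig S (projResidual Sig S β) σ d) +
        2 * crossTerm (projCoef Sig S β) √(lostSignal Sig S β + σ ^ 2)
          (reduceData n Sig S (projResidual Sig S β) σ d) +
        shiftTerm (projCoef Sig S β) √(lostSignal Sig S β + σ ^ 2)
          (reduceData n Sig S (projResidual Sig S β) σ d)) / k) /
      (residualSq (reduceData n Sig S (projResidual Sig S β) σ d) / (n - k : ℕ)) := by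
  have hc : 0 < √(lostSignal Sig S β + σ ^ 2) := by
    have := signal_nonneg hSig (projResidual Sig S β)
    rw [← lostSignal] at this
    positivity
  rw [sketchedF, sketchedResidual_sq hSig β hσ hd, mulVec_sketchedEstimate,
    design_mul (Sig := Sig) S (projResidual Sig S β) σ d, response_eq hSig β hσ,
    add_smul_dotProduct_hat hd, Nat.cast_sub hkn]
  simp only [explainedSq, crossTerm, shiftTerm]
  set c := √(lostSignal Sig S β + σ ^ 2)
  generalize residualSq (reduceData n Sig S (projResidual Sig S β) σ d) = Q
  generalize (reduceData n Sig S (projResidual Sig S β) σ d).2 ⬝ᵥ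
    (Matrix.of (reduceData n Sig S (projResidual Sig S β) σ d).1 *ᵥ projCoef Sig S β) = x
  generalize (reduceData n Sig S (projResidual Sig S β) σ d).2 ⬝ᵥ
    (hat (Matrix.of (reduceData n Sig S (projResidual Sig S β) σ d).1) *ᵥ
      (reduceData n Sig S (projResidual Sig S β) σ d).2) = y
  generalize (Matrix.of (reduceData n Sig S (projResidual Sig S β) σ d).1 *ᵥ
    projCoef Sig S β) ⬝ᵥ (Matrix.of (reduceData n Sig S (projResidual Sig S β) σ d).1 *ᵥ
    projCoef Sig S β) = w
  have e : c ^ 2 * y + 2 * c * x + w = c ^ 2 * (y + 2 * (x / c) + w / c ^ 2) := by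
    field_simp
  rw [e, mul_div_assoc, mul_div_assoc (c ^ 2) Q, mul_div_mul_left _ _ (pow_ne_zero 2 hc.ne')]

lemma ae_isUnit_gram_reduceData (hSig : Sig.PosSemidef) (hA : IsUnit (Sᵀ * Sig * S).det)
    (hkn : k ≤ n) (β : Fin p → ℝ) (hσ : 0 < σ) :
    ∀ᵐ d ∂dataLaw n Sig,
      IsUnit ((Matrix.of (reduceData n Sig S (projResidual Sig S β) σ d).1)ᵀ *
        Matrix.of (reduceData n Sig S (projResidual Sig S β) σ d).1).det := by
  have h := ae_isUnit_gram_sketchedRow hSig hA hkn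
  have h2 : ∀ᵐ z ∂modelLaw n Sig S, IsUnit ((Matrix.of z.1)ᵀ * Matrix.of z.1).det :=
    Measure.quasiMeasurePreserving_fst.ae h
  exact (measurePreserving_reduceData n hSig (sketch_projResidual hA β)
    hσ).quasiMeasurePreserving.ae h2

lemma sketchedPower_eq_fPower (hSig : Sig.PosSemidef) (hA : IsUnit (Sᵀ * Sig * S).det)
    (hkn : k ≤ n) (hσ : 0 < σ) (α : ℝ) :
    sketchedPower n α σ β Sig S = fPower (modelLaw n Sig S) k (n - k) α explainedSq residualSq
      (crossTerm (projCoef Sig S β) √(lostSignal Sig S β + σ ^ 2))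
      (shiftTerm (projCoef Sig S β) √(lostSignal Sig S β + σ ^ 2)) := by
  have hmp := measurePreserving_reduceData n hSig (sketch_projResidual hA β) hσ
  rw [fPower, ← hmp.measureReal_preimage, sketchedPower]
  · refine measureReal_congr ?_
    filter_upwards [ae_isUnit_gram_reduceData hSig hA hkn β hσ] with d hd
    simp only [eq_iff_iff]
    change upperQuantile (fDist k (n - k)) α < sketchedF _ _ _ ↔ _
    rw [sketchedF_eq hSig hkn hσ hd]
    rfl
  · refine (measurableSet_lt measurable_const ?_).nullMeasurableSet
    exact (((measurable_explainedSq.add ((measurable_crossTerm _ _).const_mul 2)).add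
      (measurable_shiftTerm _ _)).div_const _).div (measurable_residualSq.div_const _)

lemma ae_sketchedFDefined (hSig : Sig.PosSemidef) (hA : IsUnit (Sᵀ * Sig * S).det)
    (hkn : k < n) (β : Fin p → ℝ) (hσ : 0 < σ) :
    ∀ᵐ d ∂dataLaw n Sig, SketchedFDefined (designMatrix d.1) (response β σ d) S := by
  have hmp := measurePreserving_reduceData n hSig (sketch_projResidual hA β) hσ
  have h1 : ∀ᵐ z ∂modelLaw n Sig S, 0 < residualSq z := by
    have hm := measurable_explainedSq.prodMk (measurable_residualSq (n := n) (k := k))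
    have h : ∀ᵐ w ∂(chiSq k).prod (chiSq (n - k)), 0 < w.2 :=
      Measure.quasiMeasurePreserving_snd.ae (chiSq_ae_pos (by omega))
    rw [← modelLaw_map_sq hSig hA hkn.le] at h
    exact ae_of_ae_map hm.aemeasurable h
  filter_upwards [ae_isUnit_gram_reduceData hSig hA hkn.le β hσ,
    hmp.quasiMeasurePreserving.ae h1] with d hd hd1
  refine ⟨?_, fun h0 => ?_⟩
  · rwa [design_mul (Sig := Sig) S (projResidual Sig S β) σ d]
  · have h2 := sketchedResidual_sq hSig β hσ hd
    have hc : 0 < √(lostSignal Sig S β + σ ^ 2) := by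
      have := signal_nonneg hSig (projResidual Sig S β)
      rw [← lostSignal] at this
      positivity
    rw [h0, zero_dotProduct] at h2
    exact (mul_pos (pow_pos hc 2) hd1).ne h2

end Regression


section SketchLaw

variable {p k : ℕ}

instance (p k : ℕ) : IsProbabilityMeasure (sketchLaw p k) := by
  unfold sketchLaw; infer_instance

lemma sketchLaw_eq_map_curry (p k : ℕ) :
    sketchLaw p k = (gaussPi (Fin p × Fin k)).map (MeasurableEquiv.curry (Fin p) (Fin k) ℝ) := by
  have h := Measure.infinitePi_map_curry (ι := Fin p) (κ := Fin k) fun _ _ => gaussianReal 0 1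
  simp only [Measure.infinitePi_eq_pi] at h
  exact h.symm

open scoped Kronecker in
lemma sketchLaw_map_orthogonal {O : Matrix (Fin p) (Fin p) ℝ}
    (hO : O ∈ Matrix.orthogonalGroup (Fin p) ℝ) (k : ℕ) :
    MeasurePreserving (fun (S : Fin p → Fin k → ℝ) i j => (O * Matrix.of S) i j)
      (sketchLaw p k) (sketchLaw p k) := by
  have hOk : O ⊗ₖ (1 : Matrix (Fin k) (Fin k) ℝ) ∈
      Matrix.orthogonalGroup (Fin p × Fin k) ℝ := Matrix.kronecker_mem_unitary hO (one_mem _)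
  have hm : Measurable fun (S : Fin p → Fin k → ℝ) i j => (O * Matrix.of S) i j := by
    refine measurable_pi_lambda _ fun i => measurable_pi_lambda _ fun j => ?_
    simp only [Matrix.mul_apply, Matrix.of_apply]
    fun_prop
  refine ⟨hm, ?_⟩
  have h := gaussPi_map_orthogonal hOk
  rw [sketchLaw_eq_map_curry, Measure.map_map hm (MeasurableEquiv.measurable _)]
  conv_rhs => rw [← h]
  rw [Measure.map_map (MeasurableEquiv.measurable _) (measurable_mulVec _)]
  congr 1
  ext g i j
  simp [Matrix.mul_apply, Matrix.mulVec, dotProduct, Fintype.sum_prod_type, Matrix.one_apply]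

/-- A Householder reflection that moves the head of a vector to a multiple of the first coordinate
vector, and that fixes the other coordinates. -/
lemma exists_orthogonal_head {p r : ℕ} (hr : 1 ≤ r) (hrp : r ≤ p) (b : Fin p → ℝ) :
    ∃ Q ∈ Matrix.orthogonalGroup (Fin p) ℝ, (∀ x : Fin p → ℝ, ∀ i, r ≤ i.val → (Q *ᵥ x) i = x i) ∧
      ∀ i : Fin p, i.val < r → (Q *ᵥ b) i =
        if i.val = 0 then √(∑ i with i.val < r, b i ^ 2) else 0 := by
  set c := √(∑ i with i.val < r, b i ^ 2) with hc
  have hc2 : c ^ 2 = ∑ i with i.val < r, b i ^ 2 :=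
    Real.sq_sqrt (Finset.sum_nonneg fun i _ => sq_nonneg _)
  let z : Fin p := ⟨0, by omega⟩
  let v : Fin p → ℝ := fun i => if i.val < r then b i - (if i.val = 0 then c else 0) else 0
  have hvb : v ⬝ᵥ b = c ^ 2 - c * b z := by
    have e : ∀ i, v i * b i = (if i.val < r then b i ^ 2 else 0) - if i = z then c * b z else 0 := by
      intro i
      by_cases h0 : i = z
      · subst h0; simp [v, z, show 0 < r by omega]; ring
      · have h1 : i.val ≠ 0 := fun h => h0 (Fin.ext h)
        by_cases h2 : i.val < r <;> simp [v, h0, h1, h2, pow_two]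
    simp only [dotProduct, e, Finset.sum_sub_distrib]
    rw [← Finset.sum_filter, ← hc2]
    simp
  have hvv : v ⬝ᵥ v = 2 * (v ⬝ᵥ b) := by
    have e : ∀ i, v i * v i = v i * b i + if i = z then c ^ 2 - c * b z else 0 := by
      intro i
      by_cases h0 : i = z
      · subst h0; simp [v, z, show 0 < r by omega]; ring
      · have h1 : i.val ≠ 0 := fun h => h0 (Fin.ext h)
        by_cases h2 : i.val < r <;> simp [v, h0, h1, h2]
    have : v ⬝ᵥ v = v ⬝ᵥ b + (c ^ 2 - c * b z) := by
      simp only [dotProduct, e, Finset.sum_add_distrib]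
      simp
    rw [this, ← hvb]; ring
  set t := 2 / (v ⬝ᵥ v) with ht
  let Q : Matrix (Fin p) (Fin p) ℝ := 1 - t • Matrix.vecMulVec v v
  have hQx : ∀ x, Q *ᵥ x = x - (t * (v ⬝ᵥ x)) • v := by
    intro x
    simp only [Q, Matrix.sub_mulVec, Matrix.one_mulVec, Matrix.smul_mulVec,
      Matrix.vecMulVec_mulVec]
    ext i
    simp
    ring
  have htt : t * t * (v ⬝ᵥ v) = 2 * t := by
    by_cases h : v ⬝ᵥ v = 0
    · simp [ht, h]
    · rw [ht]; field_simp
  have hQT : Qᵀ = Q := by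
    simp [Q, Matrix.transpose_vecMulVec]
  refine ⟨Q, ?_, ?_, ?_⟩
  · rw [Matrix.mem_orthogonalGroup_iff, hQT]
    refine Matrix.toLin'.injective ?_
    refine LinearMap.ext fun x => ?_
    simp only [Matrix.toLin'_apply, Matrix.one_mulVec, ← Matrix.mulVec_mulVec, hQx]
    ext i
    simp only [dotProduct_sub, dotProduct_smul, Pi.sub_apply, Pi.smul_apply, smul_eq_mul]
    linear_combination (v ⬝ᵥ x) * v i * htt
  · intro x i hi
    rw [hQx]
    simp [v, not_lt.2 hi]
  · intro i hi
    rw [hQx]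
    have h1 : (t * (v ⬝ᵥ b)) * v i = v i := by
      by_cases h : v ⬝ᵥ v = 0
      · have : v = 0 := dotProduct_self_eq_zero.1 h
        simp [this]
      · have : t * (v ⬝ᵥ b) = 1 := by
          rw [ht, div_mul_eq_mul_div, ← hvv, div_self h]
        rw [this, one_mul]
    simp only [Pi.sub_apply, Pi.smul_apply, smul_eq_mul]
    rw [h1]
    simp [v, hi]

end SketchLaw


section Head

variable {p k r : ℕ}

/-- The rows `1, …, r - 1` of a sketching matrix. -/
def headRows (hrp : r ≤ p) (T : Fin p → Fin k → ℝ) : Matrix (Fin (r - 1)) (Fin k) ℝ :=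
  Matrix.of fun i j => T ⟨i.val + 1, by omega⟩ j

lemma ae_isUnit_gram_headRows (hrp : r ≤ p) (hrk : r ≤ k) :
    ∀ᵐ T ∂sketchLaw p k,
      IsUnit (((headRows hrp T)ᵀᵀ * (headRows hrp T)ᵀ : Matrix (Fin (r - 1)) (Fin (r - 1)) ℝ)).det := by
  let L : (Fin p → Fin k → ℝ) →ₗ[ℝ] Matrix (Fin k) (Fin (r - 1)) ℝ :=
    { toFun := fun T => (headRows hrp T)ᵀ
      map_add' := fun _ _ => rfl
      map_smul' := fun _ _ => rfl }
  refine ae_isUnit_gram L (x₀ := fun i j => if i.val = j.val + 1 then 1 else 0) ?_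
  have : (L fun i j => if i.val = j.val + 1 then 1 else 0)ᵀ *
      (L fun i j => if i.val = j.val + 1 then 1 else 0) = 1 := by
    have hL : ∀ (x : Fin k) (i : Fin (r - 1)), L (fun i j => if i.val = j.val + 1 then 1 else 0) x i =
        if i.val = x.val then 1 else 0 := by
      intro x i
      simp [L, headRows]
    ext i j
    rw [Matrix.mul_apply, Finset.sum_eq_single (⟨i.val, by omega⟩ : Fin k)]
    · simp [hL, Matrix.one_apply, Fin.ext_iff, eq_comm]
    · intro x _ hx
      have : i.val ≠ x.val := fun h => hx (Fin.ext h.symm)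
      simp [hL, this]
    · simp
  rw [this]
  simp

variable (hrp : r ≤ p) (z : Fin p)

/-- The component of row `z` that is orthogonal to the rows `1, …, r - 1`. -/
def headResidual (T : Fin p → Fin k → ℝ) : Fin k → ℝ := T z - hat (headRows hrp T)ᵀ *ᵥ T z

lemma entryMeasurable_headRows : EntryMeasurable fun T : Fin p → Fin k → ℝ => headRows hrp T :=
  fun i j => by simp only [headRows, Matrix.of_apply]; fun_prop

lemma measurable_headResidual :
    Measurable (headResidual hrp z : (Fin p → Fin k → ℝ) → Fin k → ℝ) :=
  (measurable_pi_apply z).sub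
    ((entryMeasurable_headRows hrp).transpose.hat.mulVec (measurable_pi_apply z))

variable {hrp z}

lemma headRows_update {i : Fin p} (hi : i.val = 0 ∨ r ≤ i.val) (T : Fin p → Fin k → ℝ)
    (y : Fin k → ℝ) : headRows hrp (Function.update T i y) = headRows hrp T := by
  ext a b
  have : (⟨a.val + 1, by omega⟩ : Fin p) ≠ i := by
    intro h
    have := congrArg Fin.val h
    simp only at this
    omega
  simp [headRows, Function.update_of_ne this]

lemma headResidual_update {i : Fin p} (hi : r ≤ i.val) (hz : z.val < r) (T : Fin p → Fin k → ℝ)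
    (y : Fin k → ℝ) : headResidual hrp z (Function.update T i y) = headResidual hrp z T := by
  have : z ≠ i := fun h => by subst h; omega
  rw [headResidual, headRows_update (Or.inr hi), Function.update_of_ne this, headResidual]

lemma headResidual_sq_lower_tail (hz : z.val = 0) (hr : 1 ≤ r) {d : ℕ} (hd : 1 ≤ d)
    (hk : k = r - 1 + d) {κ : ℝ} (hκ : 0 < κ) :
    sketchLaw p k {T | headResidual hrp z T ⬝ᵥ headResidual hrp z T < κ * d / 2} ≤
      ENNReal.ofReal (4 * √κ) := by
  have hm := measurable_dotProduct (measurable_headResidual (k := k) hrp z)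
    (measurable_headResidual hrp z)
  refine measure_pi_update_le _ z (measurableSet_lt hm measurable_const) ?_
  filter_upwards [ae_isUnit_gram_headRows hrp (show r ≤ k by omega)] with T hT
  refine le_trans (le_of_eq ?_) (chiSq_lower_tail hd hκ)
  have h := gaussPi_map_hat hT (d := d) (by simp [hk])
  have h2 := congrArg (fun μ => μ (Set.univ ×ˢ Set.Iio (κ * d / 2))) h
  have hmg : Measurable fun g : Fin k → ℝ => (g ⬝ᵥ (hat (headRows hrp T)ᵀ *ᵥ g),
      (g - hat (headRows hrp T)ᵀ *ᵥ g) ⬝ᵥ (g - hat (headRows hrp T)ᵀ *ᵥ g)) := by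
    have := measurable_mulVec (hat (headRows hrp T)ᵀ)
    exact (measurable_dotProduct measurable_id this).prodMk
      (measurable_dotProduct (measurable_id.sub this) (measurable_id.sub this))
  simp only [Measure.prod_prod, measure_univ, one_mul] at h2
  rw [Measure.map_apply hmg (MeasurableSet.univ.prod measurableSet_Iio)] at h2
  rw [← h2]
  congr 1
  ext y
  simp only [Set.mem_ofPred_eq, headResidual, headRows_update (hrp := hrp) (Or.inl hz) T y,
    Function.update_self, Set.mem_preimage, Set.mem_prod, Set.mem_univ, true_and, Set.mem_Iio]

lemma lintegral_dot_sq (u : Fin k → ℝ) :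
    ∫⁻ y, ENNReal.ofReal ((y ⬝ᵥ u) ^ 2) ∂gaussPi (Fin k) = ENNReal.ofReal (u ⬝ᵥ u) := by
  have hm : Measurable fun e : Fin k → ℝ => e ⬝ᵥ u :=
    measurable_dotProduct measurable_id measurable_const
  have h := stdNormalVector_map_dot u
  have h1 : ∫⁻ y, ENNReal.ofReal ((y ⬝ᵥ u) ^ 2) ∂gaussPi (Fin k) =
      ∫⁻ x, ENNReal.ofReal (x ^ 2) ∂gaussianReal 0 (u ⬝ᵥ u).toNNReal := by
    rw [← h, lintegral_map (by fun_prop) hm]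
    rfl
  have h2 := variance_id_gaussianReal (μ := 0) (v := (u ⬝ᵥ u).toNNReal)
  rw [variance_eq_integral (by fun_prop)] at h2
  simp only [id, integral_id_gaussianReal, sub_zero] at h2
  have hi : MemLp (fun x : ℝ => x) 2 (gaussianReal 0 (u ⬝ᵥ u).toNNReal) := IsGaussian.memLp_two_id
  rw [h1, ← ofReal_integral_eq_lintegral_ofReal hi.integrable_sq
    (ae_of_all _ fun x => sq_nonneg _)]
  rw [h2]
  exact ENNReal.ofReal_coe_nnreal

/-- The normalized head residual. -/
def headDirection (hrp : r ≤ p) (z : Fin p) (T : Fin p → Fin k → ℝ) : Fin k → ℝ :=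
  (√(headResidual hrp z T ⬝ᵥ headResidual hrp z T))⁻¹ • headResidual hrp z T

lemma measurable_headDirection :
    Measurable (headDirection hrp z : (Fin p → Fin k → ℝ) → Fin k → ℝ) := by
  have h := measurable_headResidual (k := k) hrp z
  exact (measurable_dotProduct h h).sqrt.inv.smul h

lemma headDirection_sq_le (T : Fin p → Fin k → ℝ) :
    headDirection hrp z T ⬝ᵥ headDirection hrp z T ≤ 1 := by
  have h0 : 0 ≤ headResidual hrp z T ⬝ᵥ headResidual hrp z T :=
    Finset.sum_nonneg fun i _ => mul_self_nonneg _
  simp only [headDirection, smul_dotProduct, dotProduct_smul, smul_eq_mul]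
  rw [← mul_assoc, ← mul_inv, Real.mul_self_sqrt h0]
  exact inv_mul_le_one

lemma lintegral_tail_dot_sq (hz : z.val < r) {i : Fin p} (hi : r ≤ i.val) :
    ∫⁻ T, ENNReal.ofReal ((T i ⬝ᵥ headDirection hrp z T) ^ 2) ∂sketchLaw p k ≤ 1 := by
  have hm : Measurable fun T : Fin p → Fin k → ℝ =>
      ENNReal.ofReal ((T i ⬝ᵥ headDirection hrp z T) ^ 2) :=
    ((measurable_dotProduct (measurable_pi_apply i) measurable_headDirection).pow_const
      2).ennreal_ofReal
  rw [sketchLaw, lintegral_pi_update _ i hm]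
  refine (lintegral_mono (g := fun _ => 1) fun T => ?_).trans (by simp)
  simp only [headDirection, headResidual_update hi hz, Function.update_self]
  rw [lintegral_dot_sq]
  exact ENNReal.ofReal_le_one.2 (headDirection_sq_le T)

lemma tail_markov (hz : z.val < r) {l : Fin p → ℝ} (hl : ∀ i, 0 ≤ l i) {δ : ℝ} (hδ : 0 < δ) :
    sketchLaw p k {T | (∑ i with r ≤ i.val, l i) / δ <
      ∑ i with r ≤ i.val, l i * (T i ⬝ᵥ headDirection hrp z T) ^ 2} ≤ ENNReal.ofReal δ := by
  set L := ∑ i with r ≤ i.val, l i with hL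
  have hL0 : 0 ≤ L := Finset.sum_nonneg fun i _ => hl i
  rcases hL0.eq_or_lt with h0 | h0
  · have hl0 : ∀ i ∈ Finset.univ.filter (fun i : Fin p => r ≤ i.val), l i = 0 :=
      (Finset.sum_eq_zero_iff_of_nonneg fun i _ => hl i).1 h0.symm
    have : {T : Fin p → Fin k → ℝ | L / δ <
        ∑ i with r ≤ i.val, l i * (T i ⬝ᵥ headDirection hrp z T) ^ 2} = ∅ := by
      ext T
      have e : ∑ i with r ≤ i.val, l i * (T i ⬝ᵥ headDirection hrp z T) ^ 2 = 0 :=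
        Finset.sum_eq_zero fun i hi => by rw [hl0 i hi, zero_mul]
      simp [e, ← h0]
    rw [this]; simp
  · have hmi : ∀ i, Measurable fun T : Fin p → Fin k → ℝ =>
        ENNReal.ofReal ((T i ⬝ᵥ headDirection hrp z T) ^ 2) := fun i =>
      ((measurable_dotProduct (measurable_pi_apply i) measurable_headDirection).pow_const
        2).ennreal_ofReal
    set V : (Fin p → Fin k → ℝ) → ℝ≥0∞ := fun T => ∑ i with r ≤ i.val,
      ENNReal.ofReal (l i) * ENNReal.ofReal ((T i ⬝ᵥ headDirection hrp z T) ^ 2) with hV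
    have hVm : Measurable V := Finset.measurable_sum _ fun i _ => (hmi i).const_mul _
    have hVe : ∀ T, V T = ENNReal.ofReal
        (∑ i with r ≤ i.val, l i * (T i ⬝ᵥ headDirection hrp z T) ^ 2) := by
      intro T
      rw [ENNReal.ofReal_sum_of_nonneg fun i _ => mul_nonneg (hl i) (sq_nonneg _)]
      exact Finset.sum_congr rfl fun i _ => (ENNReal.ofReal_mul (hl i)).symm
    have hE : ∫⁻ T, V T ∂sketchLaw p k ≤ ENNReal.ofReal L := by
      rw [hV, lintegral_finsetSum _ fun i _ => (hmi i).const_mul _, hL,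
        ENNReal.ofReal_sum_of_nonneg fun i _ => hl i]
      refine Finset.sum_le_sum fun i hi => ?_
      rw [lintegral_const_mul _ (hmi i)]
      exact mul_le_of_le_one_right (zero_le) (lintegral_tail_dot_sq hz (Finset.mem_filter.1 hi).2)
    have hLd : 0 < L / δ := div_pos h0 hδ
    have hM := meas_ge_le_lintegral_div (μ := sketchLaw p k) hVm.aemeasurable
      (ε := ENNReal.ofReal (L / δ)) (by simpa using hLd) ENNReal.ofReal_ne_top
    refine (measure_mono fun T hT => ?_).trans (hM.trans
      ((ENNReal.div_le_div_right hE _).trans (le_of_eq ?_)))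
    · simp only [Set.mem_ofPred_eq] at hT ⊢
      rw [hVe]
      exact ENNReal.ofReal_le_ofReal hT.le
    · rw [← ENNReal.ofReal_div_of_pos hLd]
      congr 1
      field_simp

lemma headRows_mulVec_headResidual {T : Fin p → Fin k → ℝ}
    (hT : IsUnit (((headRows hrp T)ᵀᵀ * (headRows hrp T)ᵀ).det)) :
    headRows hrp T *ᵥ headResidual hrp z T = 0 := by
  have h := congrArg Matrix.transpose (hat_mul hT)
  rw [Matrix.transpose_mul, hat_transpose, Matrix.transpose_transpose] at h
  rw [headResidual, Matrix.mulVec_sub, Matrix.mulVec_mulVec, h, sub_self]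

lemma dotProduct_headResidual {T : Fin p → Fin k → ℝ}
    (hT : IsUnit (((headRows hrp T)ᵀᵀ * (headRows hrp T)ᵀ).det)) :
    T z ⬝ᵥ headResidual hrp z T = headResidual hrp z T ⬝ᵥ headResidual hrp z T := by
  have h : (hat (headRows hrp T)ᵀ *ᵥ T z) ⬝ᵥ headResidual hrp z T = 0 := by
    rw [dotProduct_comm, Matrix.dotProduct_mulVec, ← Matrix.mulVec_transpose, hat_transpose,
      headResidual, Matrix.mulVec_sub, Matrix.mulVec_mulVec, hat_mul_hat hT, sub_self,
      zero_dotProduct]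
  conv_rhs => rw [headResidual.eq_1, sub_dotProduct, ← headResidual.eq_1, h, sub_zero]

/-- With high probability the head of the sketch can be inverted at a small cost in the tail. -/
lemma exists_head_inverse {a : ℝ} (ha : 1 < a) {ε : ℝ} (hε : 0 < ε) :
    ∃ K : ℝ, 0 < K ∧ ∀ (p k r : ℕ) (z : Fin p), z.val = 0 → 1 ≤ r → r ≤ p → a * r ≤ k →
      ∀ l : Fin p → ℝ, (∀ i, 0 ≤ l i) →
        sketchLaw p k {T | ∀ w : Fin k → ℝ, T z ⬝ᵥ w = 1 →
          (∀ i : Fin p, i.val ≠ 0 → i.val < r → T i ⬝ᵥ w = 0) →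
          K / r * ∑ i with r ≤ i.val, l i < ∑ i with r ≤ i.val, l i * (T i ⬝ᵥ w) ^ 2} ≤
          ENNReal.ofReal ε := by
  set κ := (ε / 8) ^ 2 with hκd
  have hκ : 0 < κ := by positivity
  have ha0 : 0 < a - 1 := by linarith
  refine ⟨2 / (ε / 2) / (κ * (a - 1)), by positivity, ?_⟩
  intro p k r z hz hr hrp hak l hl
  have hr0 : (1 : ℝ) ≤ r := by exact_mod_cast hr
  have hrk : r ≤ k := by
    have : (r : ℝ) ≤ k := by nlinarith
    exact_mod_cast this
  obtain ⟨d, hd⟩ : ∃ d, k = r - 1 + d := ⟨k - (r - 1), by omega⟩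
  have hd1 : 1 ≤ d := by omega
  have hdr : (a - 1) * r ≤ d := by
    have : (k : ℝ) + 1 = r + d := by
      have : k + 1 = r + d := by omega
      exact_mod_cast this
    linarith
  have hzr : z.val < r := by omega
  set L := ∑ i with r ≤ i.val, l i with hL
  have hL0 : 0 ≤ L := Finset.sum_nonneg fun i _ => hl i
  have b1 := headResidual_sq_lower_tail (hrp := hrp) hz hr hd1 hd hκ
  have b2 := tail_markov (hrp := hrp) (k := k) hzr hl (half_pos hε)
  have b3 := ae_isUnit_gram_headRows hrp hrk
  have hsub : {T : Fin p → Fin k → ℝ | ∀ w : Fin k → ℝ, T z ⬝ᵥ w = 1 →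
          (∀ i : Fin p, i.val ≠ 0 → i.val < r → T i ⬝ᵥ w = 0) →
          2 / (ε / 2) / (κ * (a - 1)) / r * L < ∑ i with r ≤ i.val, l i * (T i ⬝ᵥ w) ^ 2} ⊆
      ({T | headResidual hrp z T ⬝ᵥ headResidual hrp z T < κ * d / 2} ∪
        {T | L / (ε / 2) < ∑ i with r ≤ i.val, l i * (T i ⬝ᵥ headDirection hrp z T) ^ 2}) ∪
        {T | ¬ IsUnit (((headRows hrp T)ᵀᵀ * (headRows hrp T)ᵀ).det)} := by
    intro T hT
    by_contra hc
    simp only [Set.mem_union, Set.mem_ofPred_eq, not_or, not_lt, not_not] at hc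
    obtain ⟨⟨h1, h2⟩, h3⟩ := hc
    set N := headResidual hrp z T ⬝ᵥ headResidual hrp z T with hN
    have hdpos : (0 : ℝ) < d := by exact_mod_cast hd1
    have hN0 : 0 < N := lt_of_lt_of_le (by positivity) h1
    refine absurd (hT (N⁻¹ • headResidual hrp z T) ?_ ?_) (not_lt.2 ?_)
    · rw [dotProduct_smul, dotProduct_headResidual h3, smul_eq_mul, ← hN, inv_mul_cancel₀ hN0.ne']
    · intro i hi0 hir
      have h4 := congrFun (headRows_mulVec_headResidual (z := z) h3) ⟨i.val - 1, by omega⟩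
      have h5 : T i ⬝ᵥ headResidual hrp z T = 0 := by
        refine Eq.trans ?_ h4
        simp only [Matrix.mulVec, headRows]
        congr 1
        have : i = ⟨i.val - 1 + 1, by omega⟩ := Fin.ext (by simp; omega)
        conv_lhs => rw [this]
        rfl
      rw [dotProduct_smul, h5, smul_zero]
    · have e : ∀ i, (T i ⬝ᵥ (N⁻¹ • headResidual hrp z T)) ^ 2 =
          N⁻¹ * (T i ⬝ᵥ headDirection hrp z T) ^ 2 := by
        intro i
        simp only [headDirection, dotProduct_smul, smul_eq_mul, ← hN, mul_pow, inv_pow,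
          Real.sq_sqrt hN0.le]
        ring
      have e2 : ∑ i with r ≤ i.val, l i * (T i ⬝ᵥ (N⁻¹ • headResidual hrp z T)) ^ 2 =
          N⁻¹ * ∑ i with r ≤ i.val, l i * (T i ⬝ᵥ headDirection hrp z T) ^ 2 := by
        rw [Finset.mul_sum]
        refine Finset.sum_congr rfl fun i _ => ?_
        rw [e]; ring
      rw [e2]
      have h6 : N⁻¹ ≤ (κ * ((a - 1) * r) / 2)⁻¹ := by
        refine inv_anti₀ (by positivity) (le_trans ?_ h1)
        gcongr
      calc _ ≤ (κ * ((a - 1) * r) / 2)⁻¹ * (L / (ε / 2)) :=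
            mul_le_mul h6 h2 (Finset.sum_nonneg fun i _ => mul_nonneg (hl i) (sq_nonneg _))
              (by positivity)
        _ = _ := by field_simp
  refine (measure_mono hsub).trans ((measure_union_le _ _).trans ?_)
  have hz0 : sketchLaw p k {T | ¬ IsUnit (((headRows hrp T)ᵀᵀ * (headRows hrp T)ᵀ).det)} = 0 := b3
  rw [hz0, add_zero]
  refine (measure_union_le _ _).trans ((add_le_add b1 b2).trans (le_of_eq ?_))
  rw [hκd, Real.sqrt_sq (by positivity), ← ENNReal.ofReal_add (by positivity) (by positivity)]
  congr 1
  ring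

end Head


section Approximation

open scoped MatrixOrder

variable {p k r : ℕ} {Sig : Matrix (Fin p) (Fin p) ℝ}

lemma exists_isUnit_sketchedGram (hSig : Sig.PosSemidef) (hk : k ≤ Sig.rank) :
    ∃ S : Matrix (Fin p) (Fin k) ℝ, IsUnit (Sᵀ * Sig * S).det := by
  have hH := hSig.isHermitian
  rw [hH.rank_eq_card_non_zero_eigs] at hk
  obtain ⟨e⟩ : Nonempty (Fin k ↪ {i // hH.eigenvalues i ≠ 0}) := by
    rw [Function.Embedding.nonempty_iff_card_le]; simpa using hk
  set U : Matrix (Fin p) (Fin p) ℝ := (hH.eigenvectorUnitary : Matrix (Fin p) (Fin p) ℝ) with hU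
  have hUU : Uᵀ * U = 1 := by
    have := (Matrix.mem_orthogonalGroup_iff' (Fin p) ℝ).1 hH.eigenvectorUnitary.2
    simpa [Matrix.star_eq_conjTranspose] using this
  have hspec : Sig = U * Matrix.diagonal hH.eigenvalues * Uᵀ := by
    have := hH.spectral_theorem
    simpa [Unitary.conjStarAlgAut_apply, Matrix.star_eq_conjTranspose] using this
  refine ⟨U.submatrix id fun j => (e j).1, ?_⟩
  have h : (U.submatrix id fun j => (e j).1)ᵀ * Sig * (U.submatrix id fun j => (e j).1) =
      Matrix.diagonal fun j => hH.eigenvalues (e j).1 := by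
    have h1 : Uᵀ * Sig * U = Matrix.diagonal hH.eigenvalues := by
      calc Uᵀ * Sig * U = (Uᵀ * U) * Matrix.diagonal hH.eigenvalues * (Uᵀ * U) := by
            conv_lhs => rw [hspec]
            simp only [Matrix.mul_assoc]
        _ = _ := by rw [hUU]; simp
    have h2 : (U.submatrix id fun j => (e j).1)ᵀ * Sig * (U.submatrix id fun j => (e j).1) =
        (Uᵀ * Sig * U).submatrix (fun j => (e j).1) fun j => (e j).1 := by
      ext i j
      simp [Matrix.mul_apply]
    rw [h2, h1]
    exact Matrix.submatrix_diagonal _ _ (Subtype.val_injective.comp e.injective)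
  rw [h, Matrix.det_diagonal, isUnit_iff_ne_zero]
  exact Finset.prod_ne_zero_iff.2 fun j _ => (e j).2

/-- Almost surely the sketched covariance matrix is nonsingular. -/
lemma ae_isUnit_sketchedGram (hSig : Sig.PosSemidef) (hk : k ≤ Sig.rank) :
    ∀ᵐ S ∂sketchLaw p k, IsUnit ((Matrix.of S)ᵀ * Sig * Matrix.of S).det := by
  obtain ⟨S₀, hS₀⟩ := exists_isUnit_sketchedGram hSig hk
  let L : (Fin p → Fin k → ℝ) →ₗ[ℝ] Matrix (Fin p) (Fin k) ℝ :=
    { toFun := fun S => CFC.sqrt Sig * Matrix.of S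
      map_add' := fun S S' => Matrix.mul_add (CFC.sqrt Sig) (Matrix.of S) (Matrix.of S')
      map_smul' := fun t S => Matrix.mul_smul (CFC.sqrt Sig) t (Matrix.of S) }
  have h := ae_isUnit_gram L (x₀ := S₀) (by
    change IsUnit ((CFC.sqrt Sig * S₀)ᵀ * (CFC.sqrt Sig * S₀)).det
    rwa [gram_sqrt_mul hSig])
  filter_upwards [h] with S hS
  rw [← gram_sqrt_mul hSig]
  exact hS

lemma eigenvalues_nonneg_of_isSpectralDecomposition (hSig : Sig.PosSemidef)
    {U : Matrix (Fin p) (Fin p) ℝ} {l : Fin p → ℝ} (h : IsSpectralDecomposition Sig U l)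
    (i : Fin p) : 0 ≤ l i := by
  obtain ⟨hU, -, hS⟩ := h
  have hUU : Uᵀ * U = 1 := by
    have := (Matrix.mem_orthogonalGroup_iff' (Fin p) ℝ).1 hU
    simpa [Matrix.star_eq_conjTranspose] using this
  have h1 : Uᵀ * Sig * U = Matrix.diagonal l := by
    calc Uᵀ * Sig * U = (Uᵀ * U) * Matrix.diagonal l * (Uᵀ * U) := by
          rw [hS]; simp only [Matrix.mul_assoc]
      _ = _ := by rw [hUU]; simp
  have h2 := (hSig.conjTranspose_mul_mul_same U).diag_nonneg (i := i)
  rw [Matrix.conjTranspose_eq_transpose_of_trivial, h1] at h2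
  simpa using h2

lemma signal_eq_sum {U : Matrix (Fin p) (Fin p) ℝ} {l : Fin p → ℝ}
    (h : IsSpectralDecomposition Sig U l) (x : Fin p → ℝ) :
    signal x Sig = ∑ i, l i * (Uᵀ *ᵥ x) i ^ 2 := by
  rw [signal, h.2.2, ← Matrix.mulVec_mulVec, ← Matrix.mulVec_mulVec, Matrix.dotProduct_mulVec,
    ← Matrix.mulVec_transpose]
  refine Finset.sum_congr rfl fun i _ => ?_
  rw [Matrix.mulVec_diagonal]
  ring

/-- A vector whose image under an orthogonal matrix that fixes the tail has no head has no head. -/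
lemma head_eq_zero_of_orthogonal {Q : Matrix (Fin p) (Fin p) ℝ}
    (hQ : Q ∈ Matrix.orthogonalGroup (Fin p) ℝ)
    (hfix : ∀ x : Fin p → ℝ, ∀ i, r ≤ i.val → (Q *ᵥ x) i = x i) {x : Fin p → ℝ}
    (hx : ∀ i : Fin p, i.val < r → (Q *ᵥ x) i = 0) {i : Fin p} (hi : i.val < r) : x i = 0 := by
  have hQQ : Qᵀ * Q = 1 := by
    have := (Matrix.mem_orthogonalGroup_iff' (Fin p) ℝ).1 hQ
    simpa [Matrix.star_eq_conjTranspose] using this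
  have hn : (Q *ᵥ x) ⬝ᵥ (Q *ᵥ x) = x ⬝ᵥ x := by
    rw [Matrix.dotProduct_mulVec, ← Matrix.mulVec_transpose, Matrix.mulVec_mulVec, hQQ,
      Matrix.one_mulVec]
  have hs : ∑ j, (x j * x j - (Q *ᵥ x) j * (Q *ᵥ x) j) = 0 := by
    rw [Finset.sum_sub_distrib]
    exact sub_eq_zero.2 hn.symm
  have h0 : ∀ j ∈ Finset.univ, 0 ≤ x j * x j - (Q *ᵥ x) j * (Q *ᵥ x) j := by
    intro j _
    by_cases hj : j.val < r
    · rw [hx j hj]; simpa using mul_self_nonneg (x j)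
    · rw [hfix x j (not_lt.1 hj)]; simp
  have h1 := (Finset.sum_eq_zero_iff_of_nonneg h0).1 hs i (Finset.mem_univ i)
  rw [hx i hi] at h1
  simpa using h1

/-- With high probability the sketch captures the signal up to a multiple of the accuracy. -/
lemma exists_sketch_approximation {a : ℝ} (ha : 1 < a) {ε : ℝ} (hε : 0 < ε) :
    ∃ K : ℝ, 0 < K ∧ ∀ (p k r : ℕ) (η : ℝ) (β : Fin p → ℝ) (Sig : Matrix (Fin p) (Fin p) ℝ),
      Sig.PosSemidef → IntrinsicDimBounds r η β Sig → a * r ≤ k →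
        sketchLaw p k {S | ∀ w : Fin k → ℝ,
          K * η * signal β Sig < signal (β - Matrix.of S *ᵥ w) Sig} ≤ ENNReal.ofReal ε := by
  obtain ⟨K, hK, hmain⟩ := exists_head_inverse ha hε
  refine ⟨2 + 2 * K, by positivity, ?_⟩
  intro p k r η β Sig hSig hD hak
  obtain ⟨hr, hrp, U, l, hspec, h1, -⟩ := hD
  set b := Uᵀ *ᵥ β with hb
  have hl := eigenvalues_nonneg_of_isSpectralDecomposition hSig hspec
  obtain ⟨Q, hQ, hfix, hhead⟩ := exists_orthogonal_head hr hrp b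
  set c := √(∑ i with i.val < r, b i ^ 2) with hc
  have hc2 : c ^ 2 = ∑ i with i.val < r, b i ^ 2 :=
    Real.sq_sqrt (Finset.sum_nonneg fun i _ => sq_nonneg _)
  have hUt : Uᵀ ∈ Matrix.orthogonalGroup (Fin p) ℝ := by
    have := Unitary.star_mem hspec.1
    simpa [Matrix.star_eq_conjTranspose] using this
  have hmp := sketchLaw_map_orthogonal (mul_mem hQ hUt) k
  set z : Fin p := ⟨0, by omega⟩ with hz
  have hb' := hmain p k r z rfl hr hrp hak l hl
  have key : ∀ S : Fin p → Fin k → ℝ, (∀ w : Fin k → ℝ,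
      (2 + 2 * K) * η * signal β Sig < signal (β - Matrix.of S *ᵥ w) Sig) →
      ∀ w : Fin k → ℝ, (fun i j => (Q * Uᵀ * Matrix.of S) i j) z ⬝ᵥ w = 1 →
        (∀ i : Fin p, i.val ≠ 0 → i.val < r →
          (fun i j => (Q * Uᵀ * Matrix.of S) i j) i ⬝ᵥ w = 0) →
        K / r * ∑ i with r ≤ i.val, l i <
          ∑ i with r ≤ i.val, l i * ((fun i j => (Q * Uᵀ * Matrix.of S) i j) i ⬝ᵥ w) ^ 2 := by
    intro S hS w hw0 hw1
    have hT : ∀ i, (fun i j => (Q * Uᵀ * Matrix.of S) i j) i ⬝ᵥ w =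
        (Q *ᵥ (Uᵀ *ᵥ (Matrix.of S *ᵥ w))) i := by
      intro i
      rw [Matrix.mulVec_mulVec, Matrix.mulVec_mulVec]
      rfl
    simp only [hT] at hw0 hw1 ⊢
    by_contra hcon
    rw [not_lt] at hcon
    refine absurd (hS (c • w)) (not_lt.2 ?_)
    set s := Uᵀ *ᵥ (Matrix.of S *ᵥ w) with hs
    have hx : Uᵀ *ᵥ (β - Matrix.of S *ᵥ (c • w)) = b - c • s := by
      rw [Matrix.mulVec_sub, Matrix.mulVec_smul, Matrix.mulVec_smul]
    have hx0 : ∀ i : Fin p, i.val < r → (b - c • s) i = 0 := by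
      intro i hi
      refine head_eq_zero_of_orthogonal hQ hfix (fun j hj => ?_) hi
      rw [Matrix.mulVec_sub, Matrix.mulVec_smul, Pi.sub_apply, hhead j hj, Pi.smul_apply,
        smul_eq_mul]
      by_cases hj0 : j.val = 0
      · have : j = z := Fin.ext hj0
        rw [this, hw0]; simp [hz]
      · rw [hw1 j hj0 hj, if_neg hj0]; ring
    rw [signal_eq_sum hspec, hx]
    have hsplit : ∑ i, l i * (b - c • s) i ^ 2 =
        ∑ i with r ≤ i.val, l i * (b i - c * (Q *ᵥ s) i) ^ 2 := by
      rw [Finset.sum_filter]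
      refine Finset.sum_congr rfl fun i _ => ?_
      split_ifs with hi
      · rw [hfix s i hi]; simp
      · rw [hx0 i (not_le.1 hi)]; simp
    rw [hsplit]
    have hr0 : (0 : ℝ) < r := by exact_mod_cast hr
    set L := ∑ i with r ≤ i.val, l i with hL
    have hL0 : 0 ≤ L := Finset.sum_nonneg fun i _ => hl i
    set B := ∑ i with r ≤ i.val, b i ^ 2 * l i with hB
    have hB0 : 0 ≤ B := Finset.sum_nonneg fun i _ => mul_nonneg (sq_nonneg _) (hl i)
    rw [← hc2] at h1
    have hA0 : 0 ≤ 1 / (r : ℝ) * c ^ 2 * L := by positivity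
    calc ∑ i with r ≤ i.val, l i * (b i - c * (Q *ᵥ s) i) ^ 2
        ≤ ∑ i with r ≤ i.val, (2 * (b i ^ 2 * l i) + 2 * c ^ 2 * (l i * (Q *ᵥ s) i ^ 2)) := by
          refine Finset.sum_le_sum fun i _ => ?_
          have := mul_nonneg (hl i) (sq_nonneg (b i + c * (Q *ᵥ s) i))
          linarith
      _ = 2 * B + 2 * c ^ 2 * ∑ i with r ≤ i.val, l i * (Q *ᵥ s) i ^ 2 := by
          rw [Finset.sum_add_distrib, ← Finset.mul_sum, ← Finset.mul_sum]
      _ ≤ 2 * B + 2 * c ^ 2 * (K / r * L) := by gcongr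
      _ = 2 * B + 2 * K * (1 / (r : ℝ) * c ^ 2 * L) := by ring
      _ ≤ (2 + 2 * K) * (1 / (r : ℝ) * c ^ 2 * L + B) := by
          have := mul_nonneg hK.le hB0
          linarith
      _ ≤ (2 + 2 * K) * (η * signal β Sig) := mul_le_mul_of_nonneg_left h1 (by positivity)
      _ = (2 + 2 * K) * η * signal β Sig := by ring
  refine (measure_mono key).trans ?_
  exact (hmp.measure_preimage_le _).trans hb'

end Approximation


section Asymptotics

lemma sqrt_mul_signal_eq_fScale {n k : ℕ} (hk : 1 ≤ k) (hkn : k < n) (x : ℝ) :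
    √(n : ℝ) * x * √((1 - (k : ℝ) / n) / (2 * ((k : ℝ) / n))) =
      ((k : ℝ) + (n - k : ℕ)) * x / fScale k (n - k) := by
  have hk0 : (0 : ℝ) < k := by exact_mod_cast hk
  have hn0 : (0 : ℝ) < n := by exact_mod_cast (by omega : 0 < n)
  have hm0 : (0 : ℝ) < (n : ℝ) - k := by
    have : (k : ℝ) < n := by exact_mod_cast hkn
    linarith
  rw [eq_div_iff (fScale_pos hk _).ne', fScale, Nat.cast_sub hkn.le]
  have e1 : (1 - (k : ℝ) / n) / (2 * ((k : ℝ) / n)) = ((n : ℝ) - k) / (2 * k) := by field_simp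
  have e2 : 2 / (k : ℝ) + 2 / ((n : ℝ) - k) = 2 * n / (k * ((n : ℝ) - k)) := by field_simp; ring
  have e3 : √(n : ℝ) * √(((n : ℝ) - k) / (2 * k)) * √(2 * n / (k * ((n : ℝ) - k))) = n / k := by
    rw [← Real.sqrt_mul hn0.le, ← Real.sqrt_mul (by positivity)]
    rw [show (n : ℝ) * (((n : ℝ) - k) / (2 * k)) * (2 * n / (k * ((n : ℝ) - k))) =
      ((n : ℝ) / k) ^ 2 by field_simp, Real.sqrt_sq (by positivity)]
  rw [e1, e2]
  calc _ = (√(n : ℝ) * √(((n : ℝ) - k) / (2 * k)) * √(2 * n / (k * ((n : ℝ) - k)))) * x * k := by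
        ring
    _ = _ := by rw [e3]; field_simp; ring

/-- The standardized signal that the sketch retains is close to the full one. -/
lemma one_sub_mul_le_retained {s τ σ δ ε : ℝ} (hσ : 0 < σ) (hτ : 0 ≤ τ) (hτs : τ ≤ s)
    (hδ : τ ≤ δ * s) (hδ0 : 0 ≤ δ) (hδε : δ ≤ ε / 2) (hs : s ≤ σ ^ 2) :
    (1 - ε) * (s / σ ^ 2) ≤ (s - τ) / (τ + σ ^ 2) := by
  have hs0 : 0 ≤ s := hτ.trans hτs
  have hσ2 : 0 < σ ^ 2 := by positivity
  have hc : 0 < τ + σ ^ 2 := by positivity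
  rcases le_total 1 ε with h | h
  · exact (mul_nonpos_of_nonpos_of_nonneg (by linarith) (by positivity)).trans
      (div_nonneg (by linarith) hc.le)
  · rw [le_div_iff₀ hc]
    have h1 : τ + σ ^ 2 ≤ (1 + δ) * σ ^ 2 := by
      have := mul_le_mul_of_nonneg_left hs hδ0
      linarith
    have h2 : (1 - ε) * (s / σ ^ 2) * (τ + σ ^ 2) ≤
        (1 - ε) * (s / σ ^ 2) * ((1 + δ) * σ ^ 2) :=
      mul_le_mul_of_nonneg_left h1 (mul_nonneg (by linarith) (by positivity))
    have h3 : (1 - ε) * (s / σ ^ 2) * ((1 + δ) * σ ^ 2) = (1 - ε) * (1 + δ) * s := by field_simp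
    have h4 : (1 - ε) * (1 + δ) ≤ 1 - δ := by
      have : 0 ≤ ε * δ := mul_nonneg (by linarith) hδ0
      linarith
    have h5 := mul_le_mul_of_nonneg_right h4 hs0
    linarith

variable {α σ : ℝ} {p k : ℕ → ℕ} {β : (n : ℕ) → Fin (p n) → ℝ}
    {Sig : (n : ℕ) → Matrix (Fin (p n)) (Fin (p n)) ℝ}

/-- The error of the normal approximation of the power of the sketched test. -/
def powerError (α σ : ℝ) (β : (n : ℕ) → Fin (p n) → ℝ)
    (Sig : (n : ℕ) → Matrix (Fin (p n)) (Fin (p n)) ℝ) (n : ℕ)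
    (S : Matrix (Fin (p n)) (Fin (k n)) ℝ) : ℝ :=
  sketchedPower n α σ (β n) (Sig n) S -
    stdNormalCDF
      (-upperQuantile (gaussianReal 0 1) α +
        Real.sqrt (n : ℝ) * signal (β n) (Sig n) / σ ^ 2 *
          Real.sqrt ((1 - (k n : ℝ) / (n : ℝ)) / (2 * ((k n : ℝ) / (n : ℝ)))))

/-- The normal approximation of the power along a sequence of sketches that capture the signal. -/
lemma tendsto_powerError (hα : 0 < α) (hα' : α < 1) (hσ : 0 < σ)
    (hSig : ∀ n, (Sig n).PosSemidef) (hk : ∀ᶠ n in atTop, 1 ≤ k n ∧ k n < n)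
    (hsignal : (fun n => signal (β n) (Sig n)) =o[atTop] fun n => (k n : ℝ) / (n : ℝ))
    {N : ℕ → ℕ} (hN : Tendsto N atTop atTop)
    {S : (i : ℕ) → Matrix (Fin (p (N i))) (Fin (k (N i))) ℝ}
    (hS : ∀ i, IsUnit ((S i)ᵀ * Sig (N i) * S i).det) {δ : ℕ → ℝ} (hδ : Tendsto δ atTop (𝓝 0))
    (hδ0 : ∀ i, 0 ≤ δ i)
    (hlost : ∀ i, lostSignal (Sig (N i)) (S i) (β (N i)) ≤ δ i * signal (β (N i)) (Sig (N i))) :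
    Tendsto (fun i => powerError α σ β Sig (N i) (S i)) atTop (𝓝 0) := by
  have hkN := hN.eventually hk
  have hσ2 : 0 < σ ^ 2 := by positivity
  have hτ0 : ∀ i, 0 ≤ lostSignal (Sig (N i)) (S i) (β (N i)) := fun i =>
    signal_nonneg (hSig (N i)) _
  have hdec := fun i => signal_eq_lostSignal_add (hSig (N i)) (hS i) (β (N i))
  have hgram := fun i => sketchedGram_nonneg (hSig (N i)) (S i)
    (projCoef (Sig (N i)) (S i) (β (N i)))
  have hτs : ∀ i, lostSignal (Sig (N i)) (S i) (β (N i)) ≤ signal (β (N i)) (Sig (N i)) :=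
    fun i => by linarith [hdec i, hgram i]
  have hratio : Tendsto (fun i => signal (β (N i)) (Sig (N i)) / ((k (N i) : ℝ) / (N i : ℝ)))
      atTop (𝓝 0) := hsignal.tendsto_div_nhds_zero.comp hN
  have hsmall : ∀ᶠ i in atTop, signal (β (N i)) (Sig (N i)) ≤ σ ^ 2 := by
    filter_upwards [hratio.eventually (gt_mem_nhds hσ2), hkN] with i h1 ⟨h2, h3⟩
    have hk0 : (0 : ℝ) < k (N i) := by exact_mod_cast h2
    have hn0 : (0 : ℝ) < N i := by exact_mod_cast (by omega : 0 < N i)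
    have hkn : (k (N i) : ℝ) / N i ≤ 1 := by
      rw [div_le_one hn0]; exact_mod_cast h3.le
    rw [div_lt_iff₀ (by positivity)] at h1
    exact h1.le.trans (mul_le_of_le_one_right hσ2.le hkn)
  have hmain := tendsto_fPower_sub (l := atTop) (α := α)
    (μ := fun i => modelLaw (N i) (Sig (N i)) (S i)) (k := fun i => k (N i))
    (m := fun i => N i - k (N i))
    (θ := fun i => projCoef (Sig (N i)) (S i) (β (N i)) ⬝ᵥ
      (((S i)ᵀ * Sig (N i) * S i) *ᵥ projCoef (Sig (N i)) (S i) (β (N i))) /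
        √(lostSignal (Sig (N i)) (S i) (β (N i)) + σ ^ 2) ^ 2)
    (θ₀ := fun i => signal (β (N i)) (Sig (N i)) / σ ^ 2)
    (Q₁ := fun i => explainedSq) (Q₂ := fun i => residualSq)
    (C := fun i => crossTerm (projCoef (Sig (N i)) (S i) (β (N i)))
      √(lostSignal (Sig (N i)) (S i) (β (N i)) + σ ^ 2))
    (N := fun i => shiftTerm (projCoef (Sig (N i)) (S i) (β (N i)))
      √(lostSignal (Sig (N i)) (S i) (β (N i)) + σ ^ 2)) hα hα' ?_ ?_ ?_ ?_ ?_ ?_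
  · refine hmain.congr' ?_
    filter_upwards [hkN] with i ⟨h1, h2⟩
    rw [powerError, sketchedPower_eq_fPower (hSig (N i)) (hS i) h2.le hσ,
      mul_div_assoc (√(N i : ℝ)),
      sqrt_mul_signal_eq_fScale h1 h2]
  · filter_upwards [hkN] with i ⟨h1, h2⟩
    exact isFModel_modelLaw (hSig (N i)) (hS i) h2.le _ _
  · filter_upwards [hkN] with i hi using hi.1
  · filter_upwards [hkN] with i hi
    have := hi.2
    omega
  · refine Eventually.of_forall fun i => ?_
    have hc : 0 < lostSignal (Sig (N i)) (S i) (β (N i)) + σ ^ 2 := by linarith [hτ0 i]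
    rw [Real.sq_sqrt hc.le]
    refine ⟨div_nonneg (hgram i) hc.le, div_le_div₀ ?_ ?_ hσ2 ?_⟩
    · exact signal_nonneg (hSig (N i)) _
    · linarith [hdec i, hτ0 i]
    · linarith [hτ0 i]
  · intro ε hε
    filter_upwards [hsmall, hδ.eventually (gt_mem_nhds (half_pos hε))] with i h1 h2
    have hc : 0 < lostSignal (Sig (N i)) (S i) (β (N i)) + σ ^ 2 := by linarith [hτ0 i]
    rw [Real.sq_sqrt hc.le, ← sub_eq_of_eq_add' (hdec i)]
    exact one_sub_mul_le_retained hσ (hτ0 i) (hτs i) (hlost i) (hδ0 i) h2.le h1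
  · have h := hratio.mul_const (σ ^ 2)⁻¹
    rw [zero_mul] at h
    refine h.congr' ?_
    filter_upwards [hkN] with i ⟨h1, h2⟩
    have hk0 : (0 : ℝ) < k (N i) := by exact_mod_cast h1
    have hn0 : (0 : ℝ) < N i := by exact_mod_cast (by omega : 0 < N i)
    rw [Nat.cast_sub h2.le]
    field_simp
    ring

/-- The normal approximation of the power is uniform over sketches that capture the signal. -/
lemma exists_forall_powerError_lt (hα : 0 < α) (hα' : α < 1) (hσ : 0 < σ)
    (hSig : ∀ n, (Sig n).PosSemidef) (hk : ∀ᶠ n in atTop, 1 ≤ k n ∧ k n < n)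
    (hsignal : (fun n => signal (β n) (Sig n)) =o[atTop] fun n => (k n : ℝ) / (n : ℝ))
    {ε : ℝ} (hε : 0 < ε) :
    ∃ δ : ℝ, 0 < δ ∧ ∀ᶠ n in atTop, ∀ S : Matrix (Fin (p n)) (Fin (k n)) ℝ,
      IsUnit (Sᵀ * Sig n * S).det → lostSignal (Sig n) S (β n) ≤ δ * signal (β n) (Sig n) →
        |powerError α σ β Sig n S| < ε := by
  by_contra! hcon
  have h : ∀ i : ℕ, ∃ n, i ≤ n ∧ ∃ S : Matrix (Fin (p n)) (Fin (k n)) ℝ,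
      IsUnit (Sᵀ * Sig n * S).det ∧
      lostSignal (Sig n) S (β n) ≤ 1 / ((i : ℝ) + 1) * signal (β n) (Sig n) ∧
        ε ≤ |powerError α σ β Sig n S| := by
    intro i
    obtain ⟨n, hn, S, h1, h2, h3⟩ :=
      frequently_atTop.1 (hcon (1 / ((i : ℝ) + 1)) (by positivity)) i
    exact ⟨n, hn, S, h1, h2, h3⟩
  choose N hN S hS hlost hbad using h
  have ht := tendsto_powerError hα hα' hσ hSig hk hsignal
    (tendsto_atTop_mono hN tendsto_id) hS tendsto_one_div_add_atTop_nhds_zero_nat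
    (fun i => by positivity) hlost
  obtain ⟨i, hi⟩ := (ht.abs.eventually (gt_mem_nhds (by simpa using hε))).exists
  exact absurd hi (not_lt.2 (hbad i))

end Asymptotics

end SketchedFTest

end

open SketchedFTest in
theorem mainTheorem3
    (α σ : ℝ) (hα : 0 < α) (hα' : α < 1) (hσ : 0 < σ)
    (p r k : ℕ → ℕ)
    (β : (n : ℕ) → Fin (p n) → ℝ)
    (Sig : (n : ℕ) → Matrix (Fin (p n)) (Fin (p n)) ℝ)
    (hSig : ∀ n, (Sig n).PosSemidef)
    (hD : InClassD r β Sig)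
    (a b : ℝ) (ha : 1 < a) (hab : a ≤ b)
    (hk : ∀ᶠ n in atTop, a * (r n : ℝ) ≤ (k n : ℝ) ∧ (k n : ℝ) ≤ b * (r n : ℝ))
    (hrank : ∀ᶠ n in atTop, k n < n ∧ k n < (Sig n).rank)
    (hsignal : (fun n => signal (β n) (Sig n)) =o[atTop] fun n => (k n : ℝ) / (n : ℝ))
    {Ω : Type*} [MeasurableSpace Ω] (P : Measure Ω) [IsProbabilityMeasure P]
    (S : (n : ℕ) → Ω → Fin (p n) → Fin (k n) → ℝ)
    (hS : ∀ n, HasLaw (S n) (sketchLaw (p n) (k n)) P) :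
    (∀ᵐ ω ∂P, ∀ᶠ n in atTop, ∀ᵐ d ∂(dataLaw n (Sig n)),
      SketchedFDefined (designMatrix d.1) (response (β n) σ d) (Matrix.of (S n ω))) ∧
    TendstoInMeasure P
      (fun n ω =>
        sketchedPower n α σ (β n) (Sig n) (Matrix.of (S n ω)) -
          stdNormalCDF
            (-upperQuantile (gaussianReal 0 1) α +
              Real.sqrt (n : ℝ) * signal (β n) (Sig n) / σ ^ 2 *
                Real.sqrt ((1 - (k n : ℝ) / (n : ℝ)) / (2 * ((k n : ℝ) / (n : ℝ))))))
      atTop (fun _ => 0) := by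
  obtain ⟨η, hη, hDη⟩ := hD
  have hr : ∀ᶠ n in atTop, 1 ≤ k n ∧ k n < n := by
    filter_upwards [hDη, hk, hrank] with n h1 h2 h3
    refine ⟨?_, h3.1⟩
    have hr1 : (1 : ℝ) ≤ r n := by exact_mod_cast h1.1
    have : (1 : ℝ) ≤ k n := by nlinarith [h2.1]
    exact_mod_cast this
  have hgram : ∀ n, k n ≤ (Sig n).rank →
      ∀ᵐ ω ∂P, IsUnit ((Matrix.of (S n ω))ᵀ * Sig n * Matrix.of (S n ω)).det := by
    intro n hn
    have h := ae_isUnit_sketchedGram (hSig n) hn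
    rw [← (hS n).map_eq] at h
    exact ae_of_ae_map (hS n).aemeasurable h
  constructor
  · have h : ∀ᵐ ω ∂P, ∀ n, k n ≤ (Sig n).rank →
        IsUnit ((Matrix.of (S n ω))ᵀ * Sig n * Matrix.of (S n ω)).det := by
      refine ae_all_iff.2 fun n => ?_
      by_cases hn : k n ≤ (Sig n).rank
      · filter_upwards [hgram n hn] with ω hω _ using hω
      · exact ae_of_all _ fun ω h => absurd h hn
    filter_upwards [h] with ω hω
    filter_upwards [hrank] with n hn
    exact ae_sketchedFDefined (hSig n) (hω n hn.2.le) hn.1 (β n) hσ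
  · rw [tendstoInMeasure_iff_norm]
    intro ε hε
    obtain ⟨δ, hδ, hunif⟩ := exists_forall_powerError_lt hα hα' hσ hSig hr hsignal hε
    rw [ENNReal.tendsto_nhds_zero]
    intro ε' hε'
    obtain ⟨ρ, hρ, hρε⟩ : ∃ ρ : ℝ, 0 < ρ ∧ ENNReal.ofReal ρ ≤ ε' := by
      obtain ⟨ρ, hρ0, hρ, hρε⟩ := ENNReal.lt_iff_exists_real_btwn.1 hε'
      exact ⟨ρ, by simpa using hρ, hρε.le⟩
    obtain ⟨K, hK, happrox⟩ := exists_sketch_approximation ha hρ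
    have hKη : Tendsto (fun n => K * η n) atTop (𝓝 0) := by simpa using hη.const_mul K
    filter_upwards [hunif, hDη, hk, hrank, hKη.eventually (gt_mem_nhds hδ)] with n h1 h2 h3 h4 h5
    set B := {T : Fin (p n) → Fin (k n) → ℝ | ∀ w : Fin (k n) → ℝ,
      K * η n * signal (β n) (Sig n) < signal (β n - Matrix.of T *ᵥ w) (Sig n)} with hB
    have hB1 : P (S n ⁻¹' B) ≤ ENNReal.ofReal ρ := by
      refine (Measure.le_map_apply (hS n).aemeasurable B).trans ?_
      rw [(hS n).map_eq]
      exact happrox _ _ _ _ _ _ (hSig n) h2 h3.1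
    refine le_trans ?_ (hB1.trans hρε)
    refine measure_mono_ae ?_
    filter_upwards [hgram n h4.2.le] with ω hω hbad
    intro w
    by_contra hw
    refine absurd (h1 _ hω ?_) (not_lt.2 ?_)
    · refine (lostSignal_le (hSig n) hω (β n) w).trans ((not_lt.1 hw).trans ?_)
      exact mul_le_mul_of_nonneg_right h5.le (signal_nonneg (hSig n) _)
    · have h6 : ε ≤ ‖_ - (0 : ℝ)‖ := hbad
      rwa [sub_zero, Real.norm_eq_abs] at h6
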